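/- Let $m\ge 1$ be an integer, $\mathbb K\in\{\mathbb R,\mathbb C\}$, and let $\mathcal S_m$ be the metric star graph consisting of $m$ half-lines $[0,\infty)$ glued at $0$, so that a function $f$ on $\mathcal S_m$ is a family $(f_i)_{1\le i\le m}$ of functions on $(0,\infty)$. Let $\mu_m$ be the probability measure on $\mathcal S_m$ with density $\frac{2}{m\sqrt\pi}e^{-x^2}$ with respect to Lebesgue measure on each edge, and let $L^2_{\mu_m}(\mathcal S_m)=\bigoplus_{i=1}^m L^2_{\mu_m}(0,\infty)$ be the space of $\mathbb K$-valued functions with norm $\|f\|^2=\sum_i\|f_i\|^2_{L^2_{\mu_m}(0,\infty)}$. Let $$k(t,x,y)=\frac{1}{\sqrt{\pi(1-e^{-2t})}}\exp\!\Big(-\frac{(e^{-t}x-y)^2}{1-e^{-2t}}\Big),\qquad t>0,\ x,y\in\mathbb R,$$ and let $(S_m(t))_{t\ge0}$ be the Ornstein--Uhlenbeck semigroup on $L^2_{\mu_m}(\mathcal S_m)$, given by $S_m(0)=I$ and, for $t>0$, $$(S_m(t)f)_i(x)=\int_0^\infty\big(k(t,x,y)-k(t,x,-y)\big)f_i(y)\,dy+\frac2m\sum_{j=1}^m\int_0^\infty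 k(t,x,-y)f_j(y)\,dy .$$ Let $A_2$ be its generator, i.e. $D(A_2)$ is the set of all $f\in L^2_{\mu_m}(\mathcal S_m)$ for which $A_2f:=\lim_{t\to0^+}\frac1t(S_m(t)f-f)$ exists in $L^2_{\mu_m}(\mathcal S_m)$. Let $\widetilde{H^2_{\mu_m}}(\mathcal S_m)$ be the space of all $f\in L^2_{\mu_m}(\mathcal S_m)$ such that each $f_i$ has weak derivatives $f_i',f_i''$ on $(0,\infty)$ belonging to $L^2_{\mu_m}(0,\infty)$; the values $f_i(0)$ and $f_i'(0)$ are those of the representatives continuous on $[0,\infty)$. Then $$D(A_2)=\Big\{f\in\widetilde{H^2_{\mu_m}}(\mathcal S_m):\ f_i(0)=f_j(0)\text{ for all }i,j=1,\dots,m,\ \text{and}\ \sum_{i=1}^m f_i'(0)=0\Big\},$$ and, for every $f\in D(A_2)$ and $i=1,\dots,m$, $$(A_2f)_i(x)=\tfrac12 f_i''(x)-x f_i'(x)\qquad\text{for almost every }x>0 .$$ -/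

import Mathlib

open MeasureTheory Filter Topology Set
open scoped NNReal ENNReal ContDiff

noncomputable section

namespace StarOU

/-- The density `2 / (m √π) · exp (-x²)` of the measure `μ_m` on each of the `m` half-lines. -/
def density (m : ℕ) (x : ℝ) : ℝ := 2 / (m * √Real.pi) * Real.exp (-x ^ 2)

/-- The restriction of `μ_m` to one edge, identified with the half-line `(0, ∞)`. -/
def edgeMeasure (m : ℕ) : Measure ℝ :=
  (volume.restrict (Ioi 0)).withDensity fun x => ENNReal.ofReal (density m x)

/-- `L²_{μ_m}` of one edge. -/
abbrev EdgeL2 (𝕜 : Type*) [RCLike 𝕜] (m : ℕ) : Type _ := Lp 𝕜 2 (edgeMeasure m)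

/-- `L²_{μ_m}(S_m)`: the Hilbert direct sum of the `L²_{μ_m}` spaces of the `m` edges of the
star; an element is a family `(f_i)` with `‖f‖² = ∑ ‖f_i‖²`. -/
abbrev StarL2 (𝕜 : Type*) [RCLike 𝕜] (m : ℕ) : Type _ := PiLp 2 fun _ : Fin m => EdgeL2 𝕜 m

/-! ### Weak derivatives and boundary values on an edge -/

/-- `g` is the weak derivative of `f` on `(0, ∞)`, tested against `C_c^∞((0, ∞))`, the integrals
being with respect to Lebesgue measure. (Elements of `L²_{μ_m}` of an edge are locally integrable,
because the density is bounded below on compact sets.) -/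
def IsWeakDeriv {𝕜 : Type*} [RCLike 𝕜] {m : ℕ} (f g : EdgeL2 𝕜 m) : Prop :=
  ∀ φ : ℝ → ℝ, ContDiff ℝ ∞ φ → HasCompactSupport φ → tsupport φ ⊆ Ioi 0 →
    ∫ x in Ioi 0, deriv φ x • f x = -∫ x in Ioi 0, φ x • g x

/-- The boundary value at `0` of `u` is `c`: `u` has a representative that is continuous on
`[0, ∞)` and takes the value `c` at `0`. -/
def HasBoundaryValue {𝕜 : Type*} [RCLike 𝕜] {m : ℕ} (u : EdgeL2 𝕜 m) (c : 𝕜) : Prop :=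
  ∃ v : ℝ → 𝕜, ContinuousOn v (Ici 0) ∧ u =ᵐ[edgeMeasure m] v ∧ v 0 = c

/-! ### The Ornstein–Uhlenbeck semigroup on the star -/

/-- The Ornstein–Uhlenbeck kernel on the real line. -/
def ouKernel (t x y : ℝ) : ℝ :=
  1 / √(Real.pi * (1 - Real.exp (-2 * t))) *
    Real.exp (-(1 - Real.exp (-2 * t))⁻¹ * (Real.exp (-t) * x - y) ^ 2)

/-- The kernel of the Ornstein–Uhlenbeck semigroup on the star, between the point `x` of the
`i`-th edge and the point `y` of the `j`-th edge. -/
def starKernel (m : ℕ) (t : ℝ) (i j : Fin m) (x y : ℝ) : ℝ :=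
  (if i = j then ouKernel t x y - ouKernel t x (-y) else 0) + 2 / m * ouKernel t x (-y)

/-- The contribution at the point `x` of the `i`-th edge of a function `f` living on the `j`-th
edge. -/
def edgeIntegral {𝕜 : Type*} [RCLike 𝕜] (m : ℕ) (t : ℝ) (i j : Fin m) (f : ℝ → 𝕜) (x : ℝ) : 𝕜 :=
  ∫ y in Ioi 0, starKernel m t i j x y • f y

lemma density_nonneg (m : ℕ) (x : ℝ) : 0 ≤ density m x := by
  unfold density; positivity

lemma measurable_density (m : ℕ) : Measurable (density m) := by
  unfold density; fun_prop

lemma integral_edgeMeasure {E : Type*} [NormedAddCommGroup E] [NormedSpace ℝ E] (m : ℕ)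
    (g : ℝ → E) : ∫ x, g x ∂edgeMeasure m = ∫ x in Ioi 0, density m x • g x := by
  unfold edgeMeasure
  rw [integral_withDensity_eq_integral_toReal_smul (measurable_density m).ennreal_ofReal (by simp)]
  simp [ENNReal.toReal_ofReal (density_nonneg m _)]

lemma integrable_edgeMeasure {E : Type*} [NormedAddCommGroup E] [NormedSpace ℝ E] (m : ℕ)
    (g : ℝ → E) :
    Integrable g (edgeMeasure m) ↔ Integrable (fun x => density m x • g x)
      (volume.restrict (Ioi 0)) := by
  unfold edgeMeasure
  rw [integrable_withDensity_iff_integrable_smul' (measurable_density m).ennreal_ofReal (by simp)]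
  simp [ENNReal.toReal_ofReal (density_nonneg m _)]

lemma memLp_exp (m : ℕ) {s : ℝ} (hs : s < 1 / 2) :
    MemLp (fun x : ℝ => Real.exp (s * x ^ 2)) 2 (edgeMeasure m) := by
  rw [memLp_two_iff_integrable_sq (by fun_prop), integrable_edgeMeasure]
  have h := ((integrable_exp_neg_mul_sq (b := 1 - 2 * s) (by linarith)).const_mul
    (2 / (m * √Real.pi))).restrict (s := Ioi (0 : ℝ))
  refine h.congr (ae_of_all _ fun x => ?_)
  simp only [density, smul_eq_mul, ← Real.exp_nat_mul, mul_assoc, ← Real.exp_add]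
  congr 2
  push_cast
  ring

lemma ouKernel_nonneg (t x y : ℝ) : 0 ≤ ouKernel t x y := by
  unfold ouKernel; positivity

lemma ouKernel_le {t : ℝ} (ht : 0 < t) (x y : ℝ) :
    ouKernel t x y ≤ 1 / √(Real.pi * (1 - Real.exp (-2 * t))) *
      (Real.exp ((1 - (1 - Real.exp (-t)) / (1 + Real.exp (-t))) / 2 * x ^ 2) *
        Real.exp (-(1 + (1 - Real.exp (-t)) / (1 + Real.exp (-t))) / 2 * y ^ 2)) := by
  unfold ouKernel
  have h2 : Real.exp (-2 * t) = Real.exp (-t) ^ 2 := by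
    rw [← Real.exp_nat_mul]; congr 1; push_cast; ring
  have hq : Real.exp (-t) < 1 := by rw [Real.exp_lt_one_iff]; linarith
  rw [h2, ← Real.exp_add]
  generalize hq' : Real.exp (-t) = q at *
  have hq0 : 0 < q := hq' ▸ Real.exp_pos _
  gcongr
  have h1 : 0 < 1 - q ^ 2 := by nlinarith
  have key : (1 - (1 - q) / (1 + q)) / 2 * x ^ 2 + -(1 + (1 - q) / (1 + q)) / 2 * y ^ 2
      - -(1 - q ^ 2)⁻¹ * (q * x - y) ^ 2 = (1 - q ^ 2)⁻¹ * (q * (x - y) ^ 2) := by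
    have : (1 - q ^ 2) = (1 - q) * (1 + q) := by ring
    have h3 : (1 - q) ≠ 0 := by linarith
    have h4 : (1 + q) ≠ 0 := by linarith
    rw [this]
    field_simp
    ring
  have : 0 ≤ (1 - q ^ 2)⁻¹ * (q * (x - y) ^ 2) := by positivity
  linarith

lemma exists_kernel_bound {m : ℕ} {t : ℝ} (ht : 0 < t) (i j : Fin m) :
    ∃ a b : ℝ → ℝ, MemLp a 2 (edgeMeasure m) ∧ MemLp b 2 (edgeMeasure m) ∧
      (∀ x, 0 ≤ a x) ∧
      ∀ x y, |starKernel m t i j x y| ≤ a x * (density m y * b y) := by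
  have hm : (0 : ℝ) < m := by exact_mod_cast i.pos
  set q := Real.exp (-t) with hq
  have hq0 : 0 < q := Real.exp_pos _
  have hq1 : q < 1 := by rw [hq, Real.exp_lt_one_iff]; linarith
  set δ := (1 - q) / (1 + q) with hδ
  have hδ0 : 0 < δ := by apply div_pos <;> linarith
  set c := 1 / √(Real.pi * (1 - Real.exp (-2 * t))) with hc
  have hc0 : 0 ≤ c := by positivity
  have hp : 0 < √Real.pi := Real.sqrt_pos.2 Real.pi_pos
  set C := (2 + 2 / m) * c * (m * √Real.pi / 2)
  refine ⟨fun x => C * Real.exp ((1 - δ) / 2 * x ^ 2), fun y => Real.exp ((1 - δ) / 2 * y ^ 2),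
    (memLp_exp m (by linarith)).const_mul _, memLp_exp m (by linarith), fun x => by positivity,
    fun x y => ?_⟩
  set B := c * (Real.exp ((1 - δ) / 2 * x ^ 2) * Real.exp (-(1 + δ) / 2 * y ^ 2)) with hB
  have h1 : ouKernel t x y ≤ B := ouKernel_le ht x y
  have h2 : ouKernel t x (-y) ≤ B := by
    have h := ouKernel_le ht x (-y)
    rwa [neg_sq] at h
  have h1' := ouKernel_nonneg t x y
  have h2' := ouKernel_nonneg t x (-y)
  have hmain : |starKernel m t i j x y| ≤ (2 + 2 / m) * B := by
    unfold starKernel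
    have hm2 : (0 : ℝ) < 2 / m := by positivity
    have h3 : 2 / (m : ℝ) * ouKernel t x (-y) ≤ 2 / m * B := by gcongr
    have h3' : 0 ≤ 2 / (m : ℝ) * ouKernel t x (-y) := by positivity
    split_ifs <;> rw [abs_le] <;> constructor <;> nlinarith
  refine hmain.trans (le_of_eq ?_)
  have he : Real.exp (-(1 + δ) / 2 * y ^ 2)
      = Real.exp (-y ^ 2) * Real.exp ((1 - δ) / 2 * y ^ 2) := by
    rw [← Real.exp_add]; congr 1; ring
  simp only [hB, he, density, C]
  field_simp

lemma measurable_starKernel (m : ℕ) (t : ℝ) (i j : Fin m) :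
    Measurable (Function.uncurry (starKernel m t i j)) := by
  unfold starKernel ouKernel Function.uncurry
  split_ifs <;> fun_prop

lemma ae_edgeMeasure_iff {m : ℕ} (hm : 0 < m) {p : ℝ → Prop} :
    (∀ᵐ x ∂edgeMeasure m, p x) ↔ ∀ᵐ x ∂volume.restrict (Ioi 0), p x := by
  have hm' : (0 : ℝ) < m := by exact_mod_cast hm
  unfold edgeMeasure
  rw [ae_withDensity_iff (measurable_density m).ennreal_ofReal]
  refine eventually_congr (ae_of_all _ fun x => ?_)
  have : 0 < density m x := by unfold density; positivity
  simp [this]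

lemma aestronglyMeasurable_volume {𝕜 : Type*} [RCLike 𝕜] {m : ℕ} (hm : 0 < m) (f : EdgeL2 𝕜 m) :
    AEStronglyMeasurable f (volume.restrict (Ioi 0)) := by
  obtain ⟨g, hg, hfg⟩ := (Lp.memLp f).aestronglyMeasurable
  exact ⟨g, hg, (ae_edgeMeasure_iff hm).1 hfg⟩

lemma integral_mul_norm_le {𝕜 : Type*} [RCLike 𝕜] {m : ℕ} {b : ℝ → ℝ}
    (hb : MemLp b 2 (edgeMeasure m)) (f : EdgeL2 𝕜 m) :
    ∫ y, b y * ‖f y‖ ∂edgeMeasure m ≤ ‖hb.toLp b‖ * ‖f‖ := by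
  have hf := (Lp.memLp f).norm
  have h1 : ∫ y, b y * ‖f y‖ ∂edgeMeasure m
      = inner ℝ (hb.toLp b) (hf.toLp fun y => ‖f y‖) := by
    rw [L2.inner_def]
    refine integral_congr_ae ?_
    filter_upwards [hb.coeFn_toLp, hf.coeFn_toLp] with y h1 h2
    rw [h1, h2, RCLike.inner_apply, RCLike.conj_to_real, mul_comm]
  have h2 : ‖hf.toLp fun y => ‖f y‖‖ = ‖f‖ := by
    rw [Lp.norm_toLp, eLpNorm_norm, Lp.norm_def]
  rw [h1, ← h2]
  exact real_inner_le_norm _ _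

lemma edgeIntegral_estimate {𝕜 : Type*} [RCLike 𝕜] {m : ℕ} {t : ℝ} (i j : Fin m) {a b : ℝ → ℝ}
    (hb : MemLp b 2 (edgeMeasure m)) (ha0 : ∀ x, 0 ≤ a x)
    (hab : ∀ x y, |starKernel m t i j x y| ≤ a x * (density m y * b y)) (f : EdgeL2 𝕜 m) (x : ℝ) :
    Integrable (fun y => starKernel m t i j x y • f y) (volume.restrict (Ioi 0)) ∧
      ‖edgeIntegral m t i j f x‖ ≤ a x * (‖hb.toLp b‖ * ‖f‖) := by
  have hbf : Integrable (fun y => b y * ‖f y‖) (edgeMeasure m) :=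
    MemLp.integrable_mul (p := 2) (q := 2) hb (Lp.memLp f).norm
  have hdom : Integrable (fun y => a x * (density m y * (b y * ‖f y‖)))
      (volume.restrict (Ioi 0)) := by
    have := (integrable_edgeMeasure m _).1 hbf
    simp only [smul_eq_mul] at this
    exact this.const_mul _
  have hle : ∀ y, ‖starKernel m t i j x y • f y‖ ≤ a x * (density m y * (b y * ‖f y‖)) := by
    intro y
    rw [norm_smul, Real.norm_eq_abs]
    refine (mul_le_mul_of_nonneg_right (hab x y) (norm_nonneg _)).trans (le_of_eq ?_)
    ring
  have hfm := aestronglyMeasurable_volume i.pos f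
  have hKm : Measurable (starKernel m t i j x) := (measurable_starKernel m t i j).of_uncurry_left
  have hm : AEStronglyMeasurable (fun y => starKernel m t i j x y • f y)
      (volume.restrict (Ioi 0)) := hKm.aestronglyMeasurable.smul hfm
  refine ⟨hdom.mono' hm (ae_of_all _ hle), ?_⟩
  unfold edgeIntegral
  calc ‖∫ y in Ioi 0, starKernel m t i j x y • f y‖
      ≤ ∫ y in Ioi 0, a x * (density m y * (b y * ‖f y‖)) :=
        norm_integral_le_of_norm_le hdom (ae_of_all _ hle)
    _ = a x * ∫ y, b y * ‖f y‖ ∂edgeMeasure m := by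
        rw [integral_const_mul, integral_edgeMeasure]; simp
    _ ≤ a x * (‖hb.toLp b‖ * ‖f‖) := by
        exact mul_le_mul_of_nonneg_left (integral_mul_norm_le hb f) (ha0 x)

lemma memLp_edgeIntegral {𝕜 : Type*} [RCLike 𝕜] {m : ℕ} {t : ℝ} (ht : 0 < t) (i j : Fin m)
    (f : EdgeL2 𝕜 m) : MemLp (edgeIntegral m t i j f) 2 (edgeMeasure m) := by
  obtain ⟨a, b, ha, hb, ha0, hab⟩ := exists_kernel_bound ht i j
  have hfm := aestronglyMeasurable_volume i.pos f
  have hmeas : AEStronglyMeasurable (edgeIntegral m t i j f) (edgeMeasure m) := by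
    obtain ⟨g, hg, hfg⟩ := hfm
    have : edgeIntegral m t i j f = edgeIntegral m t i j g := by
      funext x
      refine integral_congr_ae ?_
      filter_upwards [hfg] with y hy
      rw [hy]
    rw [this]
    refine (StronglyMeasurable.integral_prod_right ?_).aestronglyMeasurable
    exact (measurable_starKernel m t i j).stronglyMeasurable.smul (hg.comp_measurable measurable_snd)
  refine (ha.mul_const (‖hb.toLp b‖ * ‖f‖)).of_le hmeas (ae_of_all _ fun x => ?_)
  exact ((edgeIntegral_estimate i j hb ha0 hab f x).2).trans (le_abs_self _)

/-- The bounded operator on `L²_{μ_m}(0, ∞)` with kernel `starKernel m t i j`. -/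
def edgeOp (𝕜 : Type*) [RCLike 𝕜] {m : ℕ} {t : ℝ} (ht : 0 < t) (i j : Fin m) :
    EdgeL2 𝕜 m →L[𝕜] EdgeL2 𝕜 m :=
  LinearMap.mkContinuousOfExistsBound
    { toFun := fun f => (memLp_edgeIntegral ht i j f).toLp (edgeIntegral m t i j f)
      map_add' := fun f g => by
        obtain ⟨a, b, ha, hb, ha0, hab⟩ := exists_kernel_bound ht i j
        rw [← MemLp.toLp_add]
        refine MemLp.toLp_congr _ _ (ae_of_all _ fun x => ?_)
        simp only [Pi.add_apply, edgeIntegral]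
        rw [← integral_add (edgeIntegral_estimate i j hb ha0 hab f x).1
          (edgeIntegral_estimate i j hb ha0 hab g x).1]
        refine integral_congr_ae ?_
        filter_upwards [(ae_edgeMeasure_iff i.pos).1 (Lp.coeFn_add f g)] with y hy
        rw [hy, Pi.add_apply, smul_add]
      map_smul' := fun c f => by
        simp only [RingHom.id_apply]
        rw [← MemLp.toLp_const_smul]
        refine MemLp.toLp_congr _ _ (ae_of_all _ fun x => ?_)
        simp only [Pi.smul_apply, edgeIntegral]
        rw [← integral_smul]
        refine integral_congr_ae ?_
        filter_upwards [(ae_edgeMeasure_iff i.pos).1 (Lp.coeFn_smul c f)] with y hy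
        rw [hy, Pi.smul_apply, smul_comm] }
    (by
      obtain ⟨a, b, ha, hb, ha0, hab⟩ := exists_kernel_bound ht i j
      refine ⟨‖hb.toLp b‖ * ‖ha.toLp a‖, fun f => ?_⟩
      have : ‖(memLp_edgeIntegral ht i j f).toLp (edgeIntegral m t i j f)‖
          ≤ (‖hb.toLp b‖ * ‖f‖) * ‖ha.toLp a‖ := by
        refine Lp.norm_le_mul_norm_of_ae_le_mul ?_
        filter_upwards [(memLp_edgeIntegral ht i j f).coeFn_toLp, ha.coeFn_toLp] with x h1 h2
        rw [h1, h2, Real.norm_of_nonneg (ha0 x), mul_comm]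
        exact (edgeIntegral_estimate i j hb ha0 hab f x).2
      refine this.trans (le_of_eq ?_)
      ring)

/-- The Ornstein–Uhlenbeck semigroup `S_m(t)`, `t ≥ 0`, on `L²_{μ_m}(S_m)`: the identity for
`t = 0`, and for `t > 0` the integral operator
`(S_m(t) f)_i(x) = ∑_j ∫_0^∞ starKernel m t i j x y · f_j(y) dy`. -/
def ouSemigroup (𝕜 : Type*) [RCLike 𝕜] (m : ℕ) (t : ℝ≥0) : StarL2 𝕜 m →L[𝕜] StarL2 𝕜 m :=
  if ht : 0 < (t : ℝ) then
    ((PiLp.continuousLinearEquiv 2 𝕜 fun _ : Fin m => EdgeL2 𝕜 m).symm :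
        (Fin m → EdgeL2 𝕜 m) →L[𝕜] StarL2 𝕜 m) ∘L
      ContinuousLinearMap.pi fun i =>
        ∑ j, edgeOp 𝕜 ht i j ∘L PiLp.proj 2 (fun _ : Fin m => EdgeL2 𝕜 m) j
  else ContinuousLinearMap.id 𝕜 _

/-! ### The generator of a semigroup of operators -/

/-- `f` is in the domain of the infinitesimal generator of `T` and is mapped to `g`:
`(T(t) f - f) / t → g` in norm as `t → 0+`. -/
def IsGeneratorValue {𝕜 E : Type*} [RCLike 𝕜] [NormedAddCommGroup E] [NormedSpace 𝕜 E]
    (T : ℝ≥0 → E →L[𝕜] E) (f g : E) : Prop :=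
  Tendsto (fun t : ℝ≥0 => (((t : ℝ) : 𝕜))⁻¹ • (T t f - f)) (𝓝[>] 0) (𝓝 g)

lemma IsGeneratorValue.add {𝕜 E : Type*} [RCLike 𝕜] [NormedAddCommGroup E] [NormedSpace 𝕜 E]
    {T : ℝ≥0 → E →L[𝕜] E} {f g f' g' : E} (h : IsGeneratorValue T f g)
    (h' : IsGeneratorValue T f' g') : IsGeneratorValue T (f + f') (g + g') := by
  refine (Tendsto.add h h').congr fun t => ?_
  rw [← smul_add, map_add]
  congr 1
  abel

lemma IsGeneratorValue.smul {𝕜 E : Type*} [RCLike 𝕜] [NormedAddCommGroup E] [NormedSpace 𝕜 E]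
    {T : ℝ≥0 → E →L[𝕜] E} {f g : E} (c : 𝕜) (h : IsGeneratorValue T f g) :
    IsGeneratorValue T (c • f) (c • g) := by
  refine (Tendsto.const_smul h c).congr fun t => ?_
  rw [map_smul, smul_comm, ← smul_sub]

lemma IsGeneratorValue.unique {𝕜 E : Type*} [RCLike 𝕜] [NormedAddCommGroup E] [NormedSpace 𝕜 E]
    {T : ℝ≥0 → E →L[𝕜] E} {f g g' : E} (h : IsGeneratorValue T f g)
    (h' : IsGeneratorValue T f g') : g = g' :=
  tendsto_nhds_unique h h'

/-- The infinitesimal generator of `T`, as an unbounded operator: its domain is the set of all `f`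
for which `(T(t) f - f) / t` converges in norm as `t → 0+`, and its value is that limit. -/
def generator {𝕜 E : Type*} [RCLike 𝕜] [NormedAddCommGroup E] [NormedSpace 𝕜 E]
    (T : ℝ≥0 → E →L[𝕜] E) : E →ₗ.[𝕜] E where
  domain :=
    { carrier := {f | ∃ g, IsGeneratorValue T f g}
      add_mem' := fun ⟨_, h⟩ ⟨_, h'⟩ => ⟨_, h.add h'⟩
      zero_mem' := ⟨0, by simp [IsGeneratorValue]⟩
      smul_mem' := fun c _ ⟨_, h⟩ => ⟨_, h.smul c⟩ }
  toFun :=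
    { toFun := fun f => f.2.choose
      map_add' := fun f f' =>
        (f + f').2.choose_spec.unique (f.2.choose_spec.add f'.2.choose_spec)
      map_smul' := fun c f => (c • f).2.choose_spec.unique (f.2.choose_spec.smul c) }

end StarOU

end

open MeasureTheory Filter Topology Set
open scoped NNReal ENNReal ContDiff

noncomputable section

namespace StarOU

section

variable {𝕜 : Type*} [RCLike 𝕜] {m : ℕ}

/-! ### Elements of `L²_μ` given by functions -/

/-! Averaging over the edges decouples the star. Let `K₊`, `K₋` be the operators with kernels
`k(t,x,y)`, `k(t,x,-y)` on the half-line. Then `S_m(t)` acts on the mean of the `f_i` by the Neumann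
operator `K₊ + K₋` and on each deviation `f_i - mean` by the Dirichlet operator `K₊ - K₋`
(`ouSemigroup_apply`). The Neumann condition on the mean is the Kirchhoff condition; the Dirichlet
condition on the deviations is continuity at the vertex. It remains to find the two half-line
generators, with `L = ½ ∂² - x ∂`.

Everything on the half-line is tested against `e_a = cos(a ·)` (Neumann) or `e_a = sin(a ·)`
(Dirichlet). The Gaussian characteristic function gives `T(t) e_a = exp(-a² (1 - e^{-2t}) / 4) e_{a
e^{-t}}` (`halfOp_trigE`), the `e_a` are total in `L²_μ`, and `T(t)` is symmetric. Hence `g` is the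
generator value of `f` if and only if `⟨e_a, g⟩ = ⟨L e_a, f⟩` for all `a`
(`isTrigAdjoint_of_isGeneratorValue`, `isGeneratorValue_of_isTrigAdjoint`). The semigroup law is not
needed.

This adjoint relation is then identified with `H²_μ` and a boundary condition. The key fact is that
the functions `e_a - 2 L e_a` are also total (`eq_zero_of_inner_trigE_sub_eq_zero`): if `u` is
orthogonal to all of them, `F(a) = ⟨e_a, u⟩` solves `(1 + a²) F + 2 a F' = 0`, whose only solution
regular at `0` is zero. It is used twice. It makes bounded `C¹` functions dense in `H¹_μ`
(`IsWeakDeriv.exists_seq`), so that integration by parts with boundary terms extends to `H²_μ` and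
yields the adjoint relation (`isTrigAdjoint_of_isWeakDeriv`). It also makes the range of `1 - 2L` on
smooth functions with the boundary condition dense. With the estimates of `h`, `h'`, `h''` by `h - 2
L h`, the equation `h - 2 L h = f - 2 g` is then solved in `H²_μ`, and totality once more shows that
the solution is `f` (`exists_isWeakDeriv_of_isTrigAdjoint`). -/

instance isFiniteMeasure_edgeMeasure : IsFiniteMeasure (edgeMeasure m) := by
  have h := memLp_exp m (s := 0) (by norm_num)
  simp only [zero_mul, Real.exp_zero] at h
  have h1 : Integrable (fun _ : ℝ => (1 : ℝ)) (edgeMeasure m) := by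
    simpa using h.integrable_sq
  exact (integrable_const_iff_isFiniteMeasure one_ne_zero).1 h1

open Classical in
/-- The class in `L²_μ` of a square-integrable function. -/
def toE (m : ℕ) (u : ℝ → 𝕜) : EdgeL2 𝕜 m :=
  if h : MemLp u 2 (edgeMeasure m) then h.toLp u else 0

lemma coeFn_toE {u : ℝ → 𝕜} (h : MemLp u 2 (edgeMeasure m)) : toE m u =ᵐ[edgeMeasure m] u := by
  rw [toE, dif_pos h]; exact h.coeFn_toLp

lemma toE_eq {u : ℝ → 𝕜} (h : MemLp u 2 (edgeMeasure m)) {f : EdgeL2 𝕜 m}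
    (hf : f =ᵐ[edgeMeasure m] u) : toE m u = f :=
  Lp.ext ((coeFn_toE h).trans hf.symm)

lemma toE_add {u v : ℝ → 𝕜} (hu : MemLp u 2 (edgeMeasure m)) (hv : MemLp v 2 (edgeMeasure m)) :
    toE m (fun x => u x + v x) = toE m u + toE m v := by
  refine toE_eq (hu.add hv) ?_
  filter_upwards [Lp.coeFn_add (toE m u) (toE m v), coeFn_toE hu, coeFn_toE hv] with x h1 h2 h3
  rw [h1, Pi.add_apply, h2, h3, Pi.add_apply]

lemma toE_sub {u v : ℝ → 𝕜} (hu : MemLp u 2 (edgeMeasure m)) (hv : MemLp v 2 (edgeMeasure m)) :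
    toE m (fun x => u x - v x) = toE m u - toE m v := by
  refine toE_eq (hu.sub hv) ?_
  filter_upwards [Lp.coeFn_sub (toE m u) (toE m v), coeFn_toE hu, coeFn_toE hv] with x h1 h2 h3
  rw [h1, Pi.sub_apply, h2, h3, Pi.sub_apply]

lemma toE_const_mul {u : ℝ → 𝕜} (c : 𝕜) (hu : MemLp u 2 (edgeMeasure m)) :
    toE m (fun x => c * u x) = c • toE m u := by
  refine toE_eq (hu.const_mul c) ?_
  filter_upwards [Lp.coeFn_smul c (toE m u), coeFn_toE hu] with x h1 h2
  rw [h1, Pi.smul_apply, h2, smul_eq_mul]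

lemma inner_toE_left {u : ℝ → 𝕜} (hu : MemLp u 2 (edgeMeasure m)) (f : EdgeL2 𝕜 m) :
    inner 𝕜 (toE m u) f = ∫ x, (starRingEnd 𝕜) (u x) * f x ∂edgeMeasure m := by
  rw [L2.inner_def]
  refine integral_congr_ae ?_
  filter_upwards [coeFn_toE hu] with x h1
  rw [h1, RCLike.inner_apply, mul_comm]

lemma inner_toE_toE {u v : ℝ → 𝕜} (hu : MemLp u 2 (edgeMeasure m))
    (hv : MemLp v 2 (edgeMeasure m)) :
    inner 𝕜 (toE m u) (toE m v) = ∫ x, (starRingEnd 𝕜) (u x) * v x ∂edgeMeasure m := by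
  rw [inner_toE_left hu]
  refine integral_congr_ae ?_
  filter_upwards [coeFn_toE hv] with x h1
  rw [h1]

lemma integrable_conj_mul {u v : ℝ → 𝕜} (hu : MemLp u 2 (edgeMeasure m))
    (hv : MemLp v 2 (edgeMeasure m)) :
    Integrable (fun x => (starRingEnd 𝕜) (u x) * v x) (edgeMeasure m) :=
  MemLp.integrable_mul (p := 2) (q := 2) hu.star hv

lemma memLp_of_le_quadratic {u : ℝ → 𝕜} (hu : AEStronglyMeasurable u (edgeMeasure m)) (C : ℝ)
    (h : ∀ x, ‖u x‖ ≤ C * (1 + x ^ 2)) : MemLp u 2 (edgeMeasure m) := by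
  have hC : 0 ≤ C := by simpa using (norm_nonneg _).trans (h 0)
  -- Since `exp(x²/4) ≥ 1 + x²/4`, one has `1 + x² ≤ 4 exp(x²/4)`, and `1/4` is below the
  -- integrability threshold `1/2`.
  refine (memLp_exp m (s := 1 / 4) (by norm_num)).of_le_mul (c := 4 * C) hu
    (ae_of_all _ fun x => (h x).trans ?_)
  rw [Real.norm_of_nonneg (Real.exp_pos _).le]
  have := Real.add_one_le_exp (1 / 4 * x ^ 2)
  nlinarith

/-! ### Integration by parts for smooth functions -/

lemma hasDerivAt_density (m : ℕ) (x : ℝ) :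
    HasDerivAt (density m) (-(2 * x) * density m x) x := by
  have h := (((hasDerivAt_id x).pow 2).neg.exp).const_mul (2 / (m * √Real.pi))
  refine h.congr_deriv ?_
  simp only [density, Pi.neg_apply, Pi.pow_apply, id]
  push_cast
  ring

/-- The logarithmic derivative of the density is `-2x`, so the integrand times the density is the
derivative of `density • F`. The limit at infinity vanishes because this function and its derivative
are both integrable. -/
lemma integral_deriv_edgeMeasure {F F' : ℝ → 𝕜} (hF : ∀ x, HasDerivAt F (F' x) x)
    (hi : Integrable F (edgeMeasure m))
    (hi' : Integrable (fun x => F' x - (2 * x : ℝ) • F x) (edgeMeasure m)) :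
    ∫ x, (F' x - (2 * x : ℝ) • F x) ∂edgeMeasure m = -(density m 0 • F 0) := by
  rw [integrable_edgeMeasure] at hi hi'
  rw [integral_edgeMeasure]
  have hd : ∀ x, HasDerivAt (fun x => density m x • F x)
      (density m x • (F' x - (2 * x : ℝ) • F x)) x := fun x => by
    refine ((hasDerivAt_density m x).smul (hF x)).congr_deriv ?_
    rw [smul_sub, smul_smul, sub_eq_add_neg, ← neg_smul]
    congr 2; ring
  have := integral_Ioi_of_hasDerivAt_of_tendsto' (fun x _ => hd x) hi'
    (tendsto_zero_of_hasDerivAt_of_integrableOn_Ioi (a := 0) (fun x _ => hd x) hi' hi)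
  rw [this, zero_sub]

/-- The formal adjoint of `∂` in `L²_μ` is `-(∂ - 2x)`, up to the boundary term at `0`. This is the
source of every integration by parts below. -/
lemma inner_add_inner_of_memLp {u u' v v' : ℝ → 𝕜} (hu : ∀ x, HasDerivAt u (u' x) x)
    (hv : ∀ x, HasDerivAt v (v' x) x) (mu : MemLp u 2 (edgeMeasure m))
    (mu' : MemLp u' 2 (edgeMeasure m)) (mv : MemLp v 2 (edgeMeasure m))
    (mv' : MemLp v' 2 (edgeMeasure m))
    (mxv : MemLp (fun x : ℝ => (x : 𝕜) * v x) 2 (edgeMeasure m)) :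
    inner 𝕜 (toE m u) (toE m v' - (2 : 𝕜) • toE m fun x => (x : 𝕜) * v x)
      + inner 𝕜 (toE m u') (toE m v) = -(density m 0 • ((starRingEnd 𝕜) (u 0) * v 0)) := by
  have hconj : ∀ x, HasDerivAt (fun x => (starRingEnd 𝕜) (u x)) ((starRingEnd 𝕜) (u' x)) x :=
    fun x => (RCLike.conjCLE (K := 𝕜)).hasFDerivAt.comp_hasDerivAt x (hu x)
  have i1 := integrable_conj_mul (m := m) mu mv
  have i2 := integrable_conj_mul (m := m) mu' mv
  have i3 := integrable_conj_mul (m := m) mu mv'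
  have i4 := integrable_conj_mul (m := m) mu mxv
  have i23 : Integrable (fun x => (starRingEnd 𝕜) (u' x) * v x + (starRingEnd 𝕜) (u x) * v' x)
      (edgeMeasure m) := i2.add i3
  have e : (fun x : ℝ => ((starRingEnd 𝕜) (u' x) * v x + (starRingEnd 𝕜) (u x) * v' x)
      - (2 * x : ℝ) • ((starRingEnd 𝕜) (u x) * v x))
      = fun x : ℝ => ((starRingEnd 𝕜) (u' x) * v x + (starRingEnd 𝕜) (u x) * v' x)
      - 2 * ((starRingEnd 𝕜) (u x) * ((x : 𝕜) * v x)) := by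
    funext x
    rw [RCLike.real_smul_eq_coe_mul]
    push_cast
    ring
  have key := integral_deriv_edgeMeasure (m := m)
    (fun x => (hconj x).mul (hv x)) i1
    (by
      refine Integrable.congr (f := fun x : ℝ => ((starRingEnd 𝕜) (u' x) * v x
        + (starRingEnd 𝕜) (u x) * v' x) - 2 * ((starRingEnd 𝕜) (u x) * ((x : 𝕜) * v x)))
        (i23.sub (i4.const_mul 2)) (ae_of_all _ fun x => (congrFun e x).symm))
  simp only [Pi.mul_apply] at key
  rw [e] at key
  rw [integral_sub i23 (i4.const_mul 2), integral_add i2 i3, integral_const_mul] at key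
  rw [inner_sub_right, inner_smul_right, inner_toE_toE mu mv',
    inner_toE_toE mu mxv, inner_toE_toE mu' mv, ← key]
  ring

/-- `u` is continuously differentiable with derivative `u'`, and both are bounded. -/
structure BddC1 (u u' : ℝ → 𝕜) : Prop where
  hasDerivAt : ∀ x, HasDerivAt u (u' x) x
  continuous' : Continuous u'
  bdd : ∃ C, ∀ x, ‖u x‖ ≤ C ∧ ‖u' x‖ ≤ C

/-! ### Bounded functions with bounded continuous derivative: algebra and integration by parts. -/

namespace BddC1

variable {u u' v v' : ℝ → 𝕜}

lemma continuous (h : BddC1 u u') : Continuous u :=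
  continuous_iff_continuousAt.2 fun x => (h.hasDerivAt x).continuousAt

lemma add (h : BddC1 u u') (k : BddC1 v v') :
    BddC1 (fun x => u x + v x) (fun x => u' x + v' x) := by
  obtain ⟨C, hC⟩ := h.bdd
  obtain ⟨D, hD⟩ := k.bdd
  exact ⟨fun x => (h.hasDerivAt x).add (k.hasDerivAt x), h.continuous'.add k.continuous',
    C + D, fun x => ⟨(norm_add_le _ _).trans (add_le_add (hC x).1 (hD x).1),
      (norm_add_le _ _).trans (add_le_add (hC x).2 (hD x).2)⟩⟩

lemma const_mul (h : BddC1 u u') (c : 𝕜) : BddC1 (fun x => c * u x) (fun x => c * u' x) := by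
  obtain ⟨C, hC⟩ := h.bdd
  refine ⟨fun x => (h.hasDerivAt x).const_mul c, h.continuous'.const_mul c,
    ‖c‖ * C, fun x => ⟨?_, ?_⟩⟩
  · rw [norm_mul]; exact mul_le_mul_of_nonneg_left (hC x).1 (norm_nonneg _)
  · rw [norm_mul]; exact mul_le_mul_of_nonneg_left (hC x).2 (norm_nonneg _)

lemma sub (h : BddC1 u u') (k : BddC1 v v') :
    BddC1 (fun x => u x - v x) (fun x => u' x - v' x) := by
  simpa [sub_eq_add_neg] using h.add (k.const_mul (-1))

lemma zero : BddC1 (fun _ => (0 : 𝕜)) (fun _ => 0) :=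
  ⟨fun x => hasDerivAt_const x 0, continuous_const, 0, by simp⟩

lemma memLp (h : BddC1 u u') : MemLp u 2 (edgeMeasure m) := by
  obtain ⟨C, hC⟩ := h.bdd
  exact MemLp.of_bound h.continuous.aestronglyMeasurable C (ae_of_all _ fun x => (hC x).1)

lemma memLp' (h : BddC1 u u') : MemLp u' 2 (edgeMeasure m) := by
  obtain ⟨C, hC⟩ := h.bdd
  exact MemLp.of_bound h.continuous'.aestronglyMeasurable C (ae_of_all _ fun x => (hC x).2)

lemma memLp_mul (h : BddC1 u u') : MemLp (fun x : ℝ => (x : 𝕜) * u x) 2 (edgeMeasure m) := by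
  obtain ⟨C, hC⟩ := h.bdd
  have hc := h.continuous
  refine memLp_of_le_quadratic
    (Continuous.aestronglyMeasurable (by fun_prop)) C fun x => ?_
  rw [norm_mul, RCLike.norm_ofReal]
  have h0 := (norm_nonneg _).trans (hC x).1
  have h1 : |x| ≤ 1 + x ^ 2 := by nlinarith [sq_abs x, sq_nonneg (|x| - 1)]
  calc |x| * ‖u x‖ ≤ (1 + x ^ 2) * C := by gcongr; exact (hC x).1
    _ = _ := mul_comm _ _

lemma inner_add_inner (h : BddC1 u u') (k : BddC1 v v') :
    inner 𝕜 (toE m u) (toE m v' - (2 : 𝕜) • toE m fun x => (x : 𝕜) * v x)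
      + inner 𝕜 (toE m u') (toE m v) = -(density m 0 • ((starRingEnd 𝕜) (u 0) * v 0)) := by
  exact inner_add_inner_of_memLp h.hasDerivAt k.hasDerivAt h.memLp h.memLp' k.memLp k.memLp'
    k.memLp_mul

/-- Integration by parts of `u` against `x u`: the factor `x` kills the boundary term whatever the
value of `u` at `0`. -/
lemma two_mul_re_inner (h : BddC1 u u') :
    2 * RCLike.re (inner 𝕜 (toE m fun x => (x : 𝕜) * u x) (toE m u'))
      = 2 * ‖toE m fun x : ℝ => (x : 𝕜) * u x‖ ^ 2 - ‖toE m u‖ ^ 2 := by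
  obtain ⟨C, hC⟩ := h.bdd
  have hc := h.continuous
  have hc' := h.continuous'
  have hC0 := (norm_nonneg _).trans (hC 0).1
  have hxx : MemLp (fun x : ℝ => (x : 𝕜) * ((x : 𝕜) * u x)) 2 (edgeMeasure m) := by
    refine memLp_of_le_quadratic (Continuous.aestronglyMeasurable (by fun_prop)) C fun x => ?_
    rw [norm_mul, norm_mul, RCLike.norm_ofReal, ← mul_assoc, ← sq, sq_abs, mul_comm]
    have := (hC x).1
    gcongr
    linarith
  have hxu' : MemLp (fun x : ℝ => (x : 𝕜) * u' x) 2 (edgeMeasure m) := by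
    refine memLp_of_le_quadratic (Continuous.aestronglyMeasurable (by fun_prop)) C fun x => ?_
    rw [norm_mul, RCLike.norm_ofReal, mul_comm]
    have := (hC x).2
    gcongr
    nlinarith [sq_abs x, sq_nonneg (|x| - 1)]
  have hof : ∀ x : ℝ, HasDerivAt (fun x : ℝ => (x : 𝕜)) 1 x := fun x => by
    simpa using (RCLike.ofRealCLM (K := 𝕜)).hasFDerivAt.comp_hasDerivAt x (hasDerivAt_id x)
  have key := inner_add_inner_of_memLp (m := m) h.hasDerivAt
    (fun x => (hof x).mul (h.hasDerivAt x)) h.memLp h.memLp' h.memLp_mul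
    ((h.memLp.add hxu').congr_norm (by fun_prop) (ae_of_all _ fun x => by simp)) hxx
  have e1 : toE m (fun x : ℝ => 1 * u x + (x : 𝕜) * u' x)
      = toE m u + toE m (fun x : ℝ => (x : 𝕜) * u' x) := by
    simp only [one_mul]
    exact toE_add h.memLp hxu'
  have e2 : inner 𝕜 (toE m u) (toE m fun x : ℝ => (x : 𝕜) * ((x : 𝕜) * u x))
      = inner 𝕜 (toE m fun x : ℝ => (x : 𝕜) * u x) (toE m fun x : ℝ => (x : 𝕜) * u x) := by
    rw [inner_toE_toE h.memLp hxx, inner_toE_toE h.memLp_mul h.memLp_mul]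
    congr 1; funext x; simp; ring
  have e3 : inner 𝕜 (toE m u) (toE m fun x : ℝ => (x : 𝕜) * u' x)
      = inner 𝕜 (toE m fun x : ℝ => (x : 𝕜) * u x) (toE m u') := by
    rw [inner_toE_toE h.memLp hxu', inner_toE_toE h.memLp_mul h.memLp']
    congr 1; funext x; simp; ring
  simp only [Pi.mul_apply, RCLike.ofReal_zero, zero_mul, mul_zero, smul_zero, neg_zero] at key
  rw [show (fun x : ℝ => (x : 𝕜)) * u = fun x : ℝ => (x : 𝕜) * u x from rfl, e1, inner_sub_right,
    inner_add_right, inner_smul_right, e2, e3] at key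
  have hre := congrArg RCLike.re key
  simp only [map_add, map_sub, inner_self_eq_norm_sq_to_K, map_zero] at hre
  rw [← inner_conj_symm (toE m u')] at hre
  rw [RCLike.conj_re] at hre
  norm_cast at hre
  linarith

end BddC1

end

section

variable {𝕜 : Type*} [RCLike 𝕜] {m : ℕ}

/-! ### Trigonometric test functions -/

/-- The cosine (`s = true`) or the sine (`s = false`). -/
def trig (s : Bool) (z : ℝ) : ℝ := if s then Real.cos z else Real.sin z

/-- The derivative of `trig s`. -/
def trigD (s : Bool) (z : ℝ) : ℝ := if s then -Real.sin z else Real.cos z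

/-- The parity of `trig s`. -/
def sgn (s : Bool) : ℝ := if s then 1 else -1

lemma hasDerivAt_trig (s : Bool) (z : ℝ) : HasDerivAt (trig s) (trigD s z) z := by
  cases s
  · exact Real.hasDerivAt_sin z
  · exact Real.hasDerivAt_cos z

lemma hasDerivAt_trigD (s : Bool) (z : ℝ) : HasDerivAt (trigD s) (-trig s z) z := by
  cases s
  · exact Real.hasDerivAt_cos z
  · exact (Real.hasDerivAt_sin z).neg

lemma abs_trig_le (s : Bool) (z : ℝ) : |trig s z| ≤ 1 := by
  cases s <;> simp [trig, Real.abs_sin_le_one, Real.abs_cos_le_one]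

lemma abs_trigD_le (s : Bool) (z : ℝ) : |trigD s z| ≤ 1 := by
  cases s <;> simp [trigD, Real.abs_sin_le_one, Real.abs_cos_le_one]

lemma trig_neg (s : Bool) (z : ℝ) : trig s (-z) = sgn s * trig s z := by
  cases s <;> simp [trig, sgn]

lemma continuous_trig (s : Bool) : Continuous (trig s) :=
  continuous_iff_continuousAt.2 fun z => (hasDerivAt_trig s z).continuousAt

lemma continuous_trigD (s : Bool) : Continuous (trigD s) :=
  continuous_iff_continuousAt.2 fun z => (hasDerivAt_trigD s z).continuousAt

lemma abs_trigD_sub_le (s : Bool) (y z : ℝ) : |trigD s y - trigD s z| ≤ |y - z| := by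
  have := Convex.norm_image_sub_le_of_norm_hasDerivWithin_le (s := univ) (C := 1) (x := z) (y := y)
    (f := trigD s) (f' := fun z => -trig s z)
    (fun x _ => (hasDerivAt_trigD s x).hasDerivWithinAt)
    (fun x _ => by simpa using abs_trig_le s x) convex_univ (mem_univ _) (mem_univ _)
  simpa using this

/-- The derivative of `w ↦ trig s w - w * trigD s z` is at most `|y - z|` between `z` and `y`, so
the mean value inequality gives a quadratic remainder. -/
lemma abs_trig_sub_sub_le (s : Bool) (y z : ℝ) :
    |trig s y - trig s z - (y - z) * trigD s z| ≤ (y - z) ^ 2 := by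
  have := Convex.norm_image_sub_le_of_norm_hasDerivWithin_le (s := uIcc z y) (C := |y - z|)
    (x := z) (y := y) (f := fun w => trig s w - w * trigD s z)
    (f' := fun w => trigD s w - 1 * trigD s z)
    (fun x _ => ((hasDerivAt_trig s x).sub
      ((hasDerivAt_id x).mul_const (trigD s z))).hasDerivWithinAt)
    (fun x hx => by
      rw [one_mul]
      exact (abs_trigD_sub_le s x z).trans (abs_sub_left_of_mem_uIcc hx))
    (convex_uIcc _ _) left_mem_uIcc right_mem_uIcc
  rw [Real.norm_eq_abs, Real.norm_eq_abs, abs_mul_abs_self] at this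
  calc _ = |trig s y - y * trigD s z - (trig s z - z * trigD s z)| := by congr 1; ring
    _ ≤ _ := this
    _ = _ := by ring

lemma hasDerivAt_ofReal_trig (s : Bool) (a x : ℝ) :
    HasDerivAt (fun x : ℝ => ((trig s (a * x) : ℝ) : 𝕜)) ((a : 𝕜) * (trigD s (a * x) : ℝ)) x := by
  have h1 : HasDerivAt (fun x => trig s (a * x)) (trigD s (a * x) * a) x := by
    refine ((hasDerivAt_trig s (a * x)).comp x ((hasDerivAt_id x).const_mul a)).congr_deriv ?_
    ring
  have := (RCLike.ofRealCLM (K := 𝕜)).hasFDerivAt.comp_hasDerivAt x h1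
  refine HasDerivAt.congr_deriv this ?_
  simp [mul_comm]

lemma hasDerivAt_ofReal_trigD (s : Bool) (a x : ℝ) :
    HasDerivAt (fun x : ℝ => (a : 𝕜) * ((trigD s (a * x) : ℝ) : 𝕜))
      (-(a : 𝕜) ^ 2 * (trig s (a * x) : ℝ)) x := by
  have h1 : HasDerivAt (fun x => trigD s (a * x)) (-trig s (a * x) * a) x := by
    refine ((hasDerivAt_trigD s (a * x)).comp x ((hasDerivAt_id x).const_mul a)).congr_deriv ?_
    ring
  have := ((RCLike.ofRealCLM (K := 𝕜)).hasFDerivAt.comp_hasDerivAt x h1).const_mul (a : 𝕜)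
  refine HasDerivAt.congr_deriv this ?_
  simp
  ring

lemma bddC1_trig (s : Bool) (a : ℝ) :
    BddC1 (fun x : ℝ => ((trig s (a * x) : ℝ) : 𝕜))
      (fun x : ℝ => (a : 𝕜) * (trigD s (a * x) : ℝ)) := by
  have h1 := continuous_trigD s
  refine ⟨hasDerivAt_ofReal_trig s a, by fun_prop, 1 + |a|, fun x => ⟨?_, ?_⟩⟩
  · rw [RCLike.norm_ofReal]
    linarith [abs_trig_le s (a * x), abs_nonneg a]
  · rw [norm_mul, RCLike.norm_ofReal, RCLike.norm_ofReal]
    nlinarith [abs_trigD_le s (a * x), abs_nonneg a]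

lemma bddC1_trigD (s : Bool) (a : ℝ) :
    BddC1 (fun x : ℝ => (a : 𝕜) * ((trigD s (a * x) : ℝ) : 𝕜))
      (fun x : ℝ => -(a : 𝕜) ^ 2 * (trig s (a * x) : ℝ)) := by
  have h1 := continuous_trig s
  refine ⟨hasDerivAt_ofReal_trigD s a, by fun_prop, |a| + |a| ^ 2, fun x => ⟨?_, ?_⟩⟩
  · rw [norm_mul, RCLike.norm_ofReal, RCLike.norm_ofReal]
    nlinarith [abs_trigD_le s (a * x), abs_nonneg a]
  · rw [norm_mul, norm_neg, norm_pow, RCLike.norm_ofReal, RCLike.norm_ofReal]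
    nlinarith [abs_trig_le s (a * x), abs_nonneg a, sq_nonneg |a|]

/-- The function `x ↦ trig s (a x)` as an element of `L²_μ`. -/
def trigE (𝕜 : Type*) [RCLike 𝕜] (m : ℕ) (s : Bool) (a : ℝ) : EdgeL2 𝕜 m :=
  toE m fun x : ℝ => ((trig s (a * x) : ℝ) : 𝕜)

/-- The derivative of `a ↦ trig s (a x)` as an element of `L²_μ`. -/
def trigX (𝕜 : Type*) [RCLike 𝕜] (m : ℕ) (s : Bool) (a : ℝ) : EdgeL2 𝕜 m :=
  toE m fun x : ℝ => (x : 𝕜) * (trigD s (a * x) : ℝ)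

/-- The image of `x ↦ trig s (a x)` under `½ ∂² - x ∂`. -/
def trigL (𝕜 : Type*) [RCLike 𝕜] (m : ℕ) (s : Bool) (a : ℝ) : EdgeL2 𝕜 m :=
  -((a : 𝕜) ^ 2 / 2) • trigE 𝕜 m s a - (a : 𝕜) • trigX 𝕜 m s a

lemma memLp_trigX (s : Bool) (a : ℝ) :
    MemLp (fun x : ℝ => (x : 𝕜) * (trigD s (a * x) : ℝ)) 2 (edgeMeasure m) := by
  have h1 := continuous_trigD s
  refine memLp_of_le_quadratic (Continuous.aestronglyMeasurable (by fun_prop)) 1 fun x => ?_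
  rw [norm_mul, RCLike.norm_ofReal, RCLike.norm_ofReal]
  have h2 := abs_trigD_le s (a * x)
  nlinarith [sq_abs x, sq_nonneg (|x| - 1), abs_nonneg x]

/-- The pointwise Taylor remainder is at most `(b - a)² x²`, and `x²` lies in `L²_μ`; hence
differentiability in norm. -/
lemma hasDerivAt_trigE (s : Bool) (a : ℝ) :
    HasDerivAt (trigE 𝕜 m s) (trigX 𝕜 m s a) a := by
  have hq : MemLp (fun x : ℝ => (x : 𝕜) ^ 2) 2 (edgeMeasure m) :=
    memLp_of_le_quadratic (Continuous.aestronglyMeasurable (by fun_prop)) 1 fun x => by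
      rw [norm_pow, RCLike.norm_ofReal, sq_abs]; linarith
  rw [hasDerivAt_iff_isLittleO]
  refine Asymptotics.IsBigO.trans_isLittleO (g := fun b => (b - a) ^ 2) ?_ ?_
  · refine Asymptotics.IsBigO.of_bound ‖toE m fun x : ℝ => (x : 𝕜) ^ 2‖ (Eventually.of_forall
      fun b => ?_)
    rw [mul_comm]
    refine Lp.norm_le_mul_norm_of_ae_le_mul ?_
    have e : trigE 𝕜 m s b - trigE 𝕜 m s a - (b - a) • trigX 𝕜 m s a
        = toE m fun x : ℝ => (((trig s (b * x) : ℝ) : 𝕜) - (trig s (a * x) : ℝ))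
            - ((b - a : ℝ) : 𝕜) * ((x : 𝕜) * (trigD s (a * x) : ℝ)) := by
      rw [toE_sub ((bddC1_trig s b).memLp.sub (bddC1_trig s a).memLp)
        ((memLp_trigX s a).const_mul _), toE_sub (bddC1_trig s b).memLp (bddC1_trig s a).memLp,
        toE_const_mul _ (memLp_trigX s a), RCLike.real_smul_eq_coe_smul (K := 𝕜)]
      rfl
    rw [e]
    filter_upwards [coeFn_toE hq, coeFn_toE (((bddC1_trig s b).memLp.sub
      (bddC1_trig s a).memLp).sub ((memLp_trigX (𝕜 := 𝕜) (m := m) s a).const_mul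
        ((b - a : ℝ) : 𝕜)))] with x h1 h2
    refine (congrArg norm h2).trans_le ?_
    rw [h1]
    simp only [Pi.sub_apply]
    have h3 := abs_trig_sub_sub_le s (b * x) (a * x)
    have h4 : ((trig s (b * x) : ℝ) : 𝕜) - (trig s (a * x) : ℝ)
        - ((b - a : ℝ) : 𝕜) * ((x : 𝕜) * (trigD s (a * x) : ℝ))
        = ((trig s (b * x) - trig s (a * x) - (b * x - a * x) * trigD s (a * x) : ℝ) : 𝕜) := by
      push_cast; ring
    rw [h4, RCLike.norm_ofReal, Real.norm_of_nonneg (sq_nonneg _), norm_pow,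
      RCLike.norm_ofReal, sq_abs]
    refine h3.trans (le_of_eq ?_)
    ring
  · have : (fun b => (b - a) ^ 2) = fun b => (b - a) * (b - a) := by funext b; ring
    rw [this]
    refine Asymptotics.IsLittleO.congr_right (g₁ := fun b => 1 * (b - a)) ?_ (by simp)
    refine Asymptotics.IsLittleO.mul_isBigO ?_ (Asymptotics.isBigO_refl _ _)
    rw [Asymptotics.isLittleO_one_iff]
    have : Tendsto (fun b : ℝ => b - a) (𝓝 a) (𝓝 (a - a)) := tendsto_id.sub_const a
    simpa using this

lemma continuous_trigE (s : Bool) : Continuous (trigE 𝕜 m s) :=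
  continuous_iff_continuousAt.2 fun a => (hasDerivAt_trigE s a).continuousAt

lemma hasDerivAt_inner_trigE (s : Bool) (f : EdgeL2 𝕜 m) (a : ℝ) :
    HasDerivAt (fun a => inner 𝕜 (trigE 𝕜 m s a) f) (inner 𝕜 (trigX 𝕜 m s a) f) a := by
  simpa using (hasDerivAt_trigE (𝕜 := 𝕜) (m := m) s a).inner 𝕜 (hasDerivAt_const a f)

lemma inner_trigL (s : Bool) (f : EdgeL2 𝕜 m) (a : ℝ) :
    inner 𝕜 (trigL 𝕜 m s a) f = -((a : 𝕜) ^ 2 / 2) * inner 𝕜 (trigE 𝕜 m s a) f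
      - (a : 𝕜) * inner 𝕜 (trigX 𝕜 m s a) f := by
  have h : -((a : 𝕜) ^ 2 / 2) = ((-(a ^ 2 / 2) : ℝ) : 𝕜) := by push_cast; ring
  rw [trigL, inner_sub_left, inner_smul_left, inner_smul_left, RCLike.conj_ofReal, h,
    RCLike.conj_ofReal]

/-! ### Totality -/

lemma toReal_ofReal_eq_max (r : ℝ) : (ENNReal.ofReal r).toReal = max r 0 := by
  rcases le_total 0 r with h | h
  · rw [ENNReal.toReal_ofReal h, max_eq_left h]
  · rw [ENNReal.ofReal_of_nonpos h, max_eq_right h, ENNReal.toReal_zero]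

/-- The positive and negative parts of `U` are densities of finite measures with the same
characteristic function, hence of equal measures. -/
lemma ae_eq_zero_of_integral_exp_eq_zero {U : ℝ → ℝ} (hU : Integrable U)
    (h : ∀ a : ℝ, ∫ x, U x • Complex.exp (a * x * Complex.I) = 0) : U =ᵐ[volume] 0 := by
  have m1 : AEMeasurable (fun x => ENNReal.ofReal (U x)) := hU.aemeasurable.ennreal_ofReal
  have m2 : AEMeasurable (fun x => ENNReal.ofReal (-U x)) := hU.neg.aemeasurable.ennreal_ofReal
  have f1 : ∫⁻ x, ENNReal.ofReal (U x) ≠ ⊤ := hU.lintegral_lt_top.ne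
  have f2 : ∫⁻ x, ENNReal.ofReal (-U x) ≠ ⊤ := hU.neg.lintegral_lt_top.ne
  have := isFiniteMeasure_withDensity f1
  have := isFiniteMeasure_withDensity f2
  have heq : volume.withDensity (fun x => ENNReal.ofReal (U x))
      = volume.withDensity (fun x => ENNReal.ofReal (-U x)) := by
    refine Measure.ext_of_charFun ?_
    funext a
    rw [charFun_apply_real, charFun_apply_real,
      integral_withDensity_eq_integral_toReal_smul₀ m1 (by simp),
      integral_withDensity_eq_integral_toReal_smul₀ m2 (by simp), ← sub_eq_zero,
      ← integral_sub, ← h a]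
    · refine integral_congr_ae (ae_of_all _ fun x => ?_)
      simp only [toReal_ofReal_eq_max, ← sub_smul]
      congr 1
      rcases le_total 0 (U x) with hx | hx <;> simp [hx]
    · refine hU.mono (by fun_prop) (ae_of_all _ fun x => ?_)
      rw [norm_smul, toReal_ofReal_eq_max, ← Complex.ofReal_mul,
        Complex.norm_exp_ofReal_mul_I, mul_one, Real.norm_eq_abs, Real.norm_eq_abs]
      simpa using abs_max_sub_max_le_abs (U x) 0 0
    · refine hU.mono (by fun_prop) (ae_of_all _ fun x => ?_)
      rw [norm_smul, toReal_ofReal_eq_max, ← Complex.ofReal_mul,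
        Complex.norm_exp_ofReal_mul_I, mul_one, Real.norm_eq_abs, Real.norm_eq_abs]
      simpa using abs_max_sub_max_le_abs (-U x) 0 0
  have := (withDensity_eq_iff m1 m2 f1).1 heq
  filter_upwards [this] with x hx
  rcases le_total 0 (U x) with h0 | h0
  · rw [ENNReal.ofReal_of_nonpos (neg_nonpos.2 h0), ENNReal.ofReal_eq_zero] at hx
    exact le_antisymm hx h0
  · rw [ENNReal.ofReal_of_nonpos h0, eq_comm, ENNReal.ofReal_eq_zero] at hx
    exact le_antisymm h0 (by simpa using hx)

lemma exists_exp_add_sgn_mul_exp (s : Bool) : ∃ c : ℂ, ∀ z : ℝ,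
    Complex.exp (z * Complex.I) + sgn s * Complex.exp (-(z * Complex.I)) = c * trig s z := by
  cases s
  · refine ⟨2 * Complex.I, fun z => ?_⟩
    simp only [sgn, trig, Bool.false_eq_true, if_false, Complex.ofReal_sin, Complex.sin, neg_mul]
    push_cast
    linear_combination (-(Complex.exp (-(z * Complex.I)) - Complex.exp (z * Complex.I))) *
      Complex.I_mul_I
  · refine ⟨2, fun z => ?_⟩
    simp only [sgn, trig, if_true, Complex.ofReal_cos, Complex.cos, neg_mul]
    push_cast
    ring

/-- The even or odd extension of `v` to the line has the cosine or sine transform of `v` as its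
Fourier transform, up to a constant factor. -/
lemma ae_eq_zero_of_integral_trig_eq_zero (s : Bool) {v : ℝ → ℝ} (hv : IntegrableOn v (Ioi 0))
    (h : ∀ a : ℝ, ∫ x in Ioi 0, trig s (a * x) * v x = 0) :
    v =ᵐ[volume.restrict (Ioi 0)] 0 := by
  set V : ℝ → ℝ := (Ioi 0).indicator v with hV
  have iV : Integrable V := hv.integrable_indicator measurableSet_Ioi
  have iexp : ∀ (W : ℝ → ℝ) (a : ℝ), Integrable W →
      Integrable (fun x => W x • Complex.exp (a * x * Complex.I)) := fun W a hW => by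
    refine hW.mono (by fun_prop) (ae_of_all _ fun x => ?_)
    rw [norm_smul, ← Complex.ofReal_mul, Complex.norm_exp_ofReal_mul_I, mul_one]
  obtain ⟨c, hc⟩ := exists_exp_add_sgn_mul_exp s
  have key := ae_eq_zero_of_integral_exp_eq_zero (U := fun x => V x + sgn s * V (-x))
    (iV.add (iV.comp_neg.const_mul _)) fun a => by
      have e1 : ∫ x, (sgn s * V (-x)) • Complex.exp (a * x * Complex.I)
          = ∫ x, (sgn s * V x) • Complex.exp (-(a * x * Complex.I)) := by
        rw [← integral_neg_eq_self]
        refine integral_congr_ae (ae_of_all _ fun x => ?_)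
        simp
      simp only [add_smul]
      rw [integral_add (iexp _ a iV) (iexp _ a (iV.comp_neg.const_mul _)), e1, ← integral_add
        (iexp _ a iV) (by simpa using iexp _ (-a) (iV.const_mul (sgn s)))]
      have e2 : (fun x => V x • Complex.exp (a * x * Complex.I)
          + (sgn s * V x) • Complex.exp (-(a * x * Complex.I)))
          = fun x => c * ((Ioi (0 : ℝ)).indicator (fun x => trig s (a * x) * v x) x : ℝ) := by
        funext x
        have := hc (a * x)
        push_cast at this
        by_cases hx : x ∈ Ioi (0 : ℝ)
        · simp only [hV, indicator_of_mem hx, Complex.real_smul]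
          push_cast
          linear_combination (v x : ℂ) * this
        · simp [hV, indicator_of_notMem hx]
      rw [e2, integral_const_mul, integral_complex_ofReal, integral_indicator measurableSet_Ioi, h a]
      simp
  rw [EventuallyEq, ae_restrict_iff' measurableSet_Ioi]
  filter_upwards [key] with x hx h0
  have h1 : -x ∉ Ioi (0 : ℝ) := by simpa using (mem_Ioi.1 h0).le
  simpa [hV, indicator_of_mem h0, indicator_of_notMem h1] using hx

variable [NeZero m]

lemma eq_zero_of_inner_trigE_eq_zero (s : Bool) {u : EdgeL2 𝕜 m}
    (h : ∀ a, inner 𝕜 (trigE 𝕜 m s a) u = 0) : u = 0 := by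
  have hm : 0 < m := Nat.pos_of_ne_zero (NeZero.ne m)
  have hint : ∀ a : ℝ, Integrable (fun x => ((trig s (a * x) : ℝ) : 𝕜) * u x) (edgeMeasure m) :=
    fun a => by
      have := integrable_conj_mul (bddC1_trig (𝕜 := 𝕜) s a).memLp (Lp.memLp u)
      simpa using this
  have hint0 : Integrable u (edgeMeasure m) := (Lp.memLp u).integrable (by norm_num)
  have h' : ∀ a : ℝ, ∫ x, ((trig s (a * x) : ℝ) : 𝕜) * u x ∂edgeMeasure m = 0 := fun a => by
    rw [← h a, trigE, inner_toE_left (bddC1_trig s a).memLp]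
    simp
  -- Here `p` stands for the real or the imaginary part; it commutes with the real factor `trig s (a
  -- * x)`, which reduces the claim to real functions.
  have key : ∀ p : 𝕜 →L[ℝ] ℝ, (∀ (r : ℝ) (z : 𝕜), p (r * z) = r * p z) →
      ∀ᵐ x ∂edgeMeasure m, p (u x) = 0 := fun p hp => by
    have hv : IntegrableOn (fun x => density m x * p (u x)) (Ioi 0) :=
      (integrable_edgeMeasure m fun x => p (u x)).1 (p.integrable_comp hint0)
    have := ae_eq_zero_of_integral_trig_eq_zero s hv fun a => by
      have h1 := p.integral_comp_comm (hint a)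
      rw [h' a, map_zero, integral_edgeMeasure] at h1
      refine (integral_congr_ae (ae_of_all _ fun x => ?_)).trans h1
      simp only [hp, smul_eq_mul]
      ring
    rw [ae_edgeMeasure_iff hm]
    filter_upwards [this] with x hx
    have hd : 0 < density m x := by
      have : (0 : ℝ) < m := by exact_mod_cast hm
      unfold density; positivity
    simpa [hd.ne'] using hx
  refine Lp.ext ?_
  filter_upwards [key RCLike.reCLM (by simp), key RCLike.imCLM (by simp),
    Lp.coeFn_zero 𝕜 2 (edgeMeasure m)] with x h1 h2 h3
  rw [h3]
  exact RCLike.ext (by simpa using h1) (by simpa using h2)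

/-- The functions `e - 2 L e`, where `e` is trigonometric, are total. -/
lemma eq_zero_of_inner_trigE_sub_eq_zero (s : Bool) {u : EdgeL2 𝕜 m}
    (h : ∀ a, inner 𝕜 (trigE 𝕜 m s a - (2 : 𝕜) • trigL 𝕜 m s a) u = 0) : u = 0 := by
  set F : ℝ → 𝕜 := fun a => inner 𝕜 (trigE 𝕜 m s a) u
  have hF := hasDerivAt_inner_trigE s u
  have hode : ∀ a : ℝ, F a + (a : 𝕜) ^ 2 * F a + 2 * a * inner 𝕜 (trigX 𝕜 m s a) u = 0 := by
    intro a
    have := h a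
    have h2 : (starRingEnd 𝕜) (2 : 𝕜) = 2 := by
      exact_mod_cast RCLike.conj_ofReal (K := 𝕜) 2
    rw [inner_sub_left, inner_smul_left, h2, inner_trigL] at this
    linear_combination this
  -- The equation `(1 + a²) F + 2 a F' = 0` has the integrating factor `√a e^{a²/4}`. Squaring the
  -- product with `F` removes the root and gives a quantity that is constant on all of `ℝ` and
  -- vanishes at `a = 0`.
  have hPhi : ∀ a : ℝ, HasDerivAt (fun a : ℝ => (((a * Real.exp (a ^ 2 / 2) : ℝ)) : 𝕜) * F a ^ 2)
      0 a := by
    intro a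
    have h1 : HasDerivAt (fun a : ℝ => a * Real.exp (a ^ 2 / 2))
        (Real.exp (a ^ 2 / 2) * (1 + a ^ 2)) a := by
      refine ((hasDerivAt_id a).mul (((hasDerivAt_id a).pow 2).div_const 2).exp).congr_deriv ?_
      simp
      ring
    have h2 := (RCLike.ofRealCLM (K := 𝕜)).hasFDerivAt.comp_hasDerivAt a h1
    refine (h2.mul ((hF a).pow 2)).congr_deriv ?_
    simp only [Function.comp, RCLike.ofRealCLM_apply, Pi.pow_apply]
    push_cast
    simp only [F] at hode ⊢
    linear_combination (((Real.exp (a ^ 2 / 2) : ℝ) : 𝕜) * inner 𝕜 (trigE 𝕜 m s a) u) * hode a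
  have hconst : ∀ a : ℝ, (((a * Real.exp (a ^ 2 / 2) : ℝ)) : 𝕜) * F a ^ 2 = 0 := fun a => by
    have := is_const_of_deriv_eq_zero (fun a => (hPhi a).differentiableAt)
      (fun a => (hPhi a).deriv) a 0
    simpa using this
  -- For `a ≠ 0` the factor `a e^{a²/2}` can be cancelled; continuity covers `a = 0`.
  have hF0 : F = fun _ => 0 := by
    refine Continuous.ext_on (dense_compl_singleton (0 : ℝ))
      (continuous_iff_continuousAt.2 fun a => (hF a).continuousAt) continuous_const fun a ha => ?_
    simpa [Real.exp_ne_zero, mem_compl_singleton_iff.1 ha] using hconst a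
  exact eq_zero_of_inner_trigE_eq_zero s fun a => congrFun hF0 a

end

section

variable {𝕜 : Type*} [RCLike 𝕜] {m : ℕ}

/-! ### Symmetric sub-Markovian kernels -/

/-- A nonnegative symmetric kernel with respect to `μ_m` on an edge, of mass at most one and
bounded by a product of square-integrable functions. -/
structure SymKernel (m : ℕ) (p : ℝ → ℝ → ℝ) : Prop where
  measurable : Measurable (Function.uncurry p)
  nonneg : ∀ x y, 0 ≤ p x y
  symm : ∀ x y, p x y = p y x
  bound : ∃ a b : ℝ → ℝ, MemLp a 2 (edgeMeasure m) ∧ MemLp b 2 (edgeMeasure m) ∧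
    ∀ x y, p x y ≤ a x * b y
  lintegral_le : ∀ x, ∫⁻ y, ENNReal.ofReal (p x y) ∂edgeMeasure m ≤ 1

/-! ### Contractivity and symmetry of operators with symmetric sub-Markovian kernels. -/

namespace SymKernel

variable {p : ℝ → ℝ → ℝ}

lemma integrable_smul (hp : SymKernel m p) (f : EdgeL2 𝕜 m) (x : ℝ) :
    Integrable (fun y => p x y • f y) (edgeMeasure m) := by
  obtain ⟨a, b, ha, hb, hab⟩ := hp.bound
  have h1 : Integrable (fun y => b y * ‖f y‖) (edgeMeasure m) :=
    MemLp.integrable_mul (p := 2) (q := 2) hb (Lp.memLp f).norm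
  refine (h1.const_mul (a x)).mono' (hp.measurable.of_uncurry_left.aestronglyMeasurable.smul
    (Lp.aestronglyMeasurable f)) (ae_of_all _ fun y => ?_)
  rw [norm_smul, Real.norm_of_nonneg (hp.nonneg x y), ← mul_assoc]
  exact mul_le_mul_of_nonneg_right (hab x y) (norm_nonneg _)

lemma aestronglyMeasurable_integral (hp : SymKernel m p) (f : EdgeL2 𝕜 m) :
    AEStronglyMeasurable (fun x => ∫ y, p x y • f y ∂edgeMeasure m) (edgeMeasure m) := by
  refine (StronglyMeasurable.integral_prod_right (f := fun x y => p x y • f y) ?_).aestronglyMeasurable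
  exact hp.measurable.stronglyMeasurable.smul
    ((Lp.stronglyMeasurable f).comp_measurable measurable_snd)

/-- Cauchy–Schwarz for the measure with density `p x ·`, whose mass is at most one. -/
lemma sq_lintegral_le (hp : SymKernel m p) {g : ℝ → ℝ≥0∞} (hg : Measurable g) (x : ℝ) :
    (∫⁻ y, ENNReal.ofReal (p x y) * g y ∂edgeMeasure m) ^ (2 : ℝ)
      ≤ ∫⁻ y, ENNReal.ofReal (p x y) * g y ^ (2 : ℝ) ∂edgeMeasure m := by
  have hm : Measurable fun y => ENNReal.ofReal (p x y) :=
    hp.measurable.of_uncurry_left.ennreal_ofReal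
  set κ := (edgeMeasure m).withDensity fun y => ENNReal.ofReal (p x y) with hκ
  have e : ∀ {g : ℝ → ℝ≥0∞}, Measurable g →
      ∫⁻ y, ENNReal.ofReal (p x y) * g y ∂edgeMeasure m = ∫⁻ y, g y ∂κ := fun {g} hg => by
    rw [hκ, lintegral_withDensity_eq_lintegral_mul _ hm hg]; rfl
  rw [e hg, e (hg.pow_const _)]
  have h1 := ENNReal.lintegral_mul_le_Lp_mul_Lq κ Real.HolderConjugate.two_two
    (f := fun _ => 1) (g := g) (by fun_prop) hg.aemeasurable
  have h2 : κ univ ≤ 1 := by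
    rw [hκ, withDensity_apply _ MeasurableSet.univ, Measure.restrict_univ]
    exact hp.lintegral_le x
  simp only [Pi.mul_apply, one_mul, ENNReal.one_rpow, lintegral_one] at h1
  calc (∫⁻ y, g y ∂κ) ^ (2 : ℝ)
      ≤ (1 ^ (1 / (2 : ℝ)) * (∫⁻ y, g y ^ (2 : ℝ) ∂κ) ^ (1 / (2 : ℝ))) ^ (2 : ℝ) := by
        gcongr
        refine h1.trans ?_
        gcongr
    _ = _ := by
        rw [ENNReal.one_rpow, one_mul, ← ENNReal.rpow_mul]
        norm_num

/-- Schur's test: square inside the integral by `sq_lintegral_le`, exchange the integrals, and use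
the mass bound in the other variable, available by symmetry of the kernel. -/
lemma eLpNorm_integral_le (hp : SymKernel m p) (f : EdgeL2 𝕜 m) :
    eLpNorm (fun x => ∫ y, p x y • f y ∂edgeMeasure m) 2 (edgeMeasure m)
      ≤ eLpNorm f 2 (edgeMeasure m) := by
  rw [eLpNorm_eq_lintegral_rpow_enorm_toReal (by norm_num) (by norm_num),
    eLpNorm_eq_lintegral_rpow_enorm_toReal (by norm_num) (by norm_num)]
  simp only [ENNReal.toReal_ofNat]
  gcongr 1
  have hfm : Measurable fun y => ‖f y‖ₑ := (Lp.stronglyMeasurable f).enorm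
  calc ∫⁻ x, ‖∫ y, p x y • f y ∂edgeMeasure m‖ₑ ^ (2 : ℝ) ∂edgeMeasure m
      ≤ ∫⁻ x, ∫⁻ y, ENNReal.ofReal (p x y) * ‖f y‖ₑ ^ (2 : ℝ) ∂edgeMeasure m ∂edgeMeasure m := by
        refine lintegral_mono fun x => ?_
        refine le_trans ?_ (hp.sq_lintegral_le hfm x)
        gcongr
        refine (enorm_integral_le_lintegral_enorm _).trans (le_of_eq ?_)
        refine lintegral_congr fun y => ?_
        rw [enorm_smul, Real.enorm_of_nonneg (hp.nonneg x y)]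
    _ = ∫⁻ y, ∫⁻ x, ENNReal.ofReal (p x y) * ‖f y‖ₑ ^ (2 : ℝ) ∂edgeMeasure m ∂edgeMeasure m := by
        refine lintegral_lintegral_swap (Measurable.aemeasurable ?_)
        exact hp.measurable.ennreal_ofReal.mul ((hfm.pow_const _).comp measurable_snd)
    _ ≤ ∫⁻ y, ‖f y‖ₑ ^ (2 : ℝ) ∂edgeMeasure m := by
        refine lintegral_mono fun y => ?_
        simp only [hp.symm _ y]
        rw [lintegral_mul_const _ hp.measurable.of_uncurry_left.ennreal_ofReal]
        exact mul_le_of_le_one_left zero_le (hp.lintegral_le y)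

lemma memLp_integral (hp : SymKernel m p) (f : EdgeL2 𝕜 m) :
    MemLp (fun x => ∫ y, p x y • f y ∂edgeMeasure m) 2 (edgeMeasure m) :=
  ⟨hp.aestronglyMeasurable_integral f, (hp.eLpNorm_integral_le f).trans_lt (Lp.memLp f).2⟩

/-- The integral operator with kernel `p`. -/
def op (𝕜 : Type*) [RCLike 𝕜] (hp : SymKernel m p) : EdgeL2 𝕜 m →L[𝕜] EdgeL2 𝕜 m :=
  LinearMap.mkContinuous
    { toFun := fun f => (hp.memLp_integral f).toLp _
      map_add' := fun f g => by
        rw [← MemLp.toLp_add]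
        refine MemLp.toLp_congr _ _ (ae_of_all _ fun x => ?_)
        simp only [Pi.add_apply]
        rw [← integral_add (hp.integrable_smul f x) (hp.integrable_smul g x)]
        refine integral_congr_ae ?_
        filter_upwards [Lp.coeFn_add f g] with y hy
        rw [hy, Pi.add_apply, smul_add]
      map_smul' := fun c f => by
        simp only [RingHom.id_apply]
        rw [← MemLp.toLp_const_smul]
        refine MemLp.toLp_congr _ _ (ae_of_all _ fun x => ?_)
        simp only [Pi.smul_apply]
        rw [← integral_smul]
        refine integral_congr_ae ?_
        filter_upwards [Lp.coeFn_smul c f] with y hy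
        rw [hy, Pi.smul_apply, smul_comm] } 1
    fun f => by
      simp only [LinearMap.coe_mk, AddHom.coe_mk, one_mul, Lp.norm_toLp]
      rw [Lp.norm_def]
      exact ENNReal.toReal_mono (Lp.eLpNorm_ne_top f) (hp.eLpNorm_integral_le f)

lemma coeFn_op (hp : SymKernel m p) (f : EdgeL2 𝕜 m) :
    hp.op 𝕜 f =ᵐ[edgeMeasure m] fun x => ∫ y, p x y • f y ∂edgeMeasure m :=
  (hp.memLp_integral f).coeFn_toLp

lemma norm_op_le (hp : SymKernel m p) : ‖hp.op 𝕜‖ ≤ 1 :=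
  LinearMap.mkContinuous_norm_le _ zero_le_one _

/-- Fubini and the symmetry of the kernel. The product bound in `SymKernel` is what makes the double
integral absolutely convergent. -/
lemma inner_op (hp : SymKernel m p) (f g : EdgeL2 𝕜 m) :
    inner 𝕜 g (hp.op 𝕜 f) = inner 𝕜 (hp.op 𝕜 g) f := by
  obtain ⟨a, b, ha, hb, hab⟩ := hp.bound
  have h1 : inner 𝕜 g (hp.op 𝕜 f)
      = ∫ x, ∫ y, p x y • ((starRingEnd 𝕜) (g x) * f y) ∂edgeMeasure m ∂edgeMeasure m := by
    rw [L2.inner_def]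
    refine integral_congr_ae ?_
    filter_upwards [hp.coeFn_op f] with x hx
    rw [hx, RCLike.inner_apply, mul_comm, ← integral_const_mul]
    refine integral_congr_ae (ae_of_all _ fun y => ?_)
    simp only [mul_smul_comm]
  have h2 : inner 𝕜 (hp.op 𝕜 g) f
      = ∫ y, ∫ x, p x y • ((starRingEnd 𝕜) (g x) * f y) ∂edgeMeasure m ∂edgeMeasure m := by
    rw [L2.inner_def]
    refine integral_congr_ae ?_
    filter_upwards [hp.coeFn_op g] with y hy
    rw [hy, RCLike.inner_apply, mul_comm, ← integral_conj, ← integral_mul_const]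
    refine integral_congr_ae (ae_of_all _ fun x => ?_)
    simp only [hp.symm y x, RCLike.real_smul_eq_coe_mul, map_mul, RCLike.conj_ofReal, mul_assoc]
  rw [h1, h2]
  refine integral_integral_swap ?_
  have i1 : Integrable (fun x => a x * ‖g x‖) (edgeMeasure m) :=
    MemLp.integrable_mul (p := 2) (q := 2) ha (Lp.memLp g).norm
  have i2 : Integrable (fun y => b y * ‖f y‖) (edgeMeasure m) :=
    MemLp.integrable_mul (p := 2) (q := 2) hb (Lp.memLp f).norm
  refine (i1.mul_prod i2).mono' ?_ (ae_of_all _ fun q => ?_)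
  · have hg : StronglyMeasurable fun q : ℝ × ℝ => (starRingEnd 𝕜) (g q.1) :=
      RCLike.continuous_conj.comp_stronglyMeasurable
        ((Lp.stronglyMeasurable g).comp_measurable measurable_fst)
    exact (hp.measurable.stronglyMeasurable.smul
      (hg.mul ((Lp.stronglyMeasurable f).comp_measurable measurable_snd))).aestronglyMeasurable
  · simp only [Function.uncurry, norm_smul, norm_mul, RCLike.norm_conj]
    rw [Real.norm_of_nonneg (hp.nonneg _ _)]
    calc p q.1 q.2 * (‖g q.1‖ * ‖f q.2‖) ≤ (a q.1 * b q.2) * (‖g q.1‖ * ‖f q.2‖) :=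
          mul_le_mul_of_nonneg_right (hab _ _) (by positivity)
      _ = _ := by ring

end SymKernel

/-! ### The reflected Ornstein–Uhlenbeck kernels -/

lemma sgn_sq (s : Bool) : sgn s ^ 2 = 1 := by cases s <;> simp [sgn]

lemma density_pos [NeZero m] (x : ℝ) : 0 < density m x := by
  have : (0 : ℝ) < m := by exact_mod_cast Nat.pos_of_ne_zero (NeZero.ne m)
  unfold density; positivity

/-- The kernel `k(t, x, ±y)` relative to the measure `μ_m` on the edge. -/
def reflKernel (m : ℕ) (s : Bool) (t x y : ℝ) : ℝ := ouKernel t x (sgn s * y) / density m y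

lemma one_sub_exp_pos {t : ℝ} (ht : 0 < t) : 0 < 1 - Real.exp (-2 * t) := by
  have : Real.exp (-2 * t) < 1 := by rw [Real.exp_lt_one_iff]; linarith
  linarith

/-- The variance of the Ornstein–Uhlenbeck kernel. -/
def ouVar (t : ℝ) : ℝ≥0 := ((1 - Real.exp (-2 * t)) / 2).toNNReal

lemma coe_ouVar {t : ℝ} (ht : 0 < t) : (ouVar t : ℝ) = (1 - Real.exp (-2 * t)) / 2 :=
  Real.coe_toNNReal _ (by have := one_sub_exp_pos ht; positivity)

lemma ouVar_ne_zero {t : ℝ} (ht : 0 < t) : ouVar t ≠ 0 := by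
  intro h
  have h1 := coe_ouVar ht
  rw [h] at h1
  have := one_sub_exp_pos ht
  rw [NNReal.coe_zero] at h1
  linarith

/-- The kernel is the Gaussian density with mean `e^{-t} x` and variance `(1 - e^{-2t}) / 2`; its
mass, integrability and Fourier transform are read off from this. -/
lemma ouKernel_eq_gaussianPDFReal {t : ℝ} (ht : 0 < t) (x y : ℝ) :
    ouKernel t x y = ProbabilityTheory.gaussianPDFReal (Real.exp (-t) * x) (ouVar t) y := by
  have h := one_sub_exp_pos ht
  rw [ouKernel, ProbabilityTheory.gaussianPDFReal, coe_ouVar ht, one_div]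
  have h1 : 2 * Real.pi * ((1 - Real.exp (-2 * t)) / 2) = Real.pi * (1 - Real.exp (-2 * t)) := by
    ring
  have h2 : -(y - Real.exp (-t) * x) ^ 2 / (2 * ((1 - Real.exp (-2 * t)) / 2))
      = -(1 - Real.exp (-2 * t))⁻¹ * (Real.exp (-t) * x - y) ^ 2 := by
    rw [mul_div_cancel₀ _ two_ne_zero]
    field_simp
    ring
  rw [h1, h2]

lemma integrable_ouKernel {t : ℝ} (ht : 0 < t) (x : ℝ) : Integrable (ouKernel t x) := by
  rw [show ouKernel t x = _ from funext (ouKernel_eq_gaussianPDFReal ht x)]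
  exact ProbabilityTheory.integrable_gaussianPDFReal _ _

lemma lintegral_ouKernel_le {t : ℝ} (ht : 0 < t) (s : Bool) (x : ℝ) :
    ∫⁻ y in Ioi 0, ENNReal.ofReal (ouKernel t x (sgn s * y)) ≤ 1 := by
  have h1 := ProbabilityTheory.lintegral_gaussianPDFReal_eq_one (Real.exp (-t) * x)
    (ouVar_ne_zero ht)
  simp only [← ouKernel_eq_gaussianPDFReal ht] at h1
  refine (setLIntegral_le_lintegral _ _).trans (le_of_eq ?_)
  cases s
  · rw [← h1, ← lintegral_neg_eq_self]
    simp [sgn]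
  · rw [← h1]; simp [sgn]

/-- Symmetry is reversibility: in `k(t,x,±y) e^{-x²}` the exponent is symmetric in `x` and `y`. The
mass is at most that of a Gaussian on the whole line. -/
lemma symKernel_reflKernel [NeZero m] {t : ℝ} (ht : 0 < t) (s : Bool) :
    SymKernel m (reflKernel m s t) where
  measurable := by
    unfold reflKernel ouKernel density Function.uncurry
    fun_prop
  nonneg x y := div_nonneg (ouKernel_nonneg _ _ _) (density_nonneg _ _)
  symm x y := by
    have h1 := density_pos (m := m) x
    have h2 := density_pos (m := m) y
    have h3 := one_sub_exp_pos ht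
    have h4 : Real.exp (-2 * t) = Real.exp (-t) ^ 2 := by
      rw [← Real.exp_nat_mul]; congr 1; push_cast; ring
    have h5 := sgn_sq s
    unfold reflKernel
    rw [div_eq_div_iff h2.ne' h1.ne']
    unfold ouKernel density
    rw [h4] at h3 ⊢
    set q := Real.exp (-t)
    set c := 1 / √(Real.pi * (1 - q ^ 2))
    set d := 2 / (m * √Real.pi)
    have key : -(1 - q ^ 2)⁻¹ * (q * x - sgn s * y) ^ 2 + -x ^ 2
        = -(1 - q ^ 2)⁻¹ * (q * y - sgn s * x) ^ 2 + -y ^ 2 := by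
      field_simp
      linear_combination (x ^ 2 - y ^ 2) * h5
    have := congrArg Real.exp key
    rw [Real.exp_add, Real.exp_add] at this
    linear_combination c * d * this
  bound := by
    have hm : (0 : ℝ) < m := by exact_mod_cast Nat.pos_of_ne_zero (NeZero.ne m)
    set q := Real.exp (-t) with hq
    have hq0 : 0 < q := Real.exp_pos _
    have hq1 : q < 1 := by rw [hq, Real.exp_lt_one_iff]; linarith
    -- With this `δ`, the kernel is at most a constant times `exp((1-δ)x²/2) exp(-(1+δ)y²/2)`.
    -- Dividing by the density leaves growth `(1-δ)/2 < 1/2` in both variables, which is square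
    -- integrable because `δ > 0`.
    set δ := (1 - q) / (1 + q) with hδ
    have hδ0 : 0 < δ := by apply div_pos <;> linarith
    set c := 1 / √(Real.pi * (1 - Real.exp (-2 * t))) with hc
    have hp : 0 < √Real.pi := Real.sqrt_pos.2 Real.pi_pos
    refine ⟨fun x => (c * (m * √Real.pi / 2)) * Real.exp ((1 - δ) / 2 * x ^ 2),
      fun y => Real.exp ((1 - δ) / 2 * y ^ 2), (memLp_exp m (by linarith)).const_mul _,
      memLp_exp m (by linarith), fun x y => ?_⟩
    have h1 := ouKernel_le ht x (sgn s * y)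
    rw [mul_pow, sgn_sq, one_mul, ← hq, ← hδ, ← hc] at h1
    unfold reflKernel
    rw [div_le_iff₀ (density_pos y)]
    refine h1.trans (le_of_eq ?_)
    have he : Real.exp (-(1 + δ) / 2 * y ^ 2)
        = Real.exp (-y ^ 2) * Real.exp ((1 - δ) / 2 * y ^ 2) := by
      rw [← Real.exp_add]; congr 1; ring
    simp only [he, density]
    field_simp
  lintegral_le x := by
    have hmk : Measurable fun y => ENNReal.ofReal (reflKernel m s t x y) := by
      unfold reflKernel ouKernel density
      fun_prop
    unfold edgeMeasure
    rw [lintegral_withDensity_eq_lintegral_mul _ (measurable_density m).ennreal_ofReal hmk]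
    refine le_trans (le_of_eq (lintegral_congr fun y => ?_)) (lintegral_ouKernel_le ht s x)
    rw [Pi.mul_apply, ← ENNReal.ofReal_mul (density_nonneg _ _), reflKernel,
      mul_div_cancel₀ _ (density_pos y).ne']

lemma integral_reflKernel_smul [NeZero m] (s : Bool) (t x : ℝ) (f : ℝ → 𝕜) :
    ∫ y, reflKernel m s t x y • f y ∂edgeMeasure m
      = ∫ y in Ioi 0, ouKernel t x (sgn s * y) • f y := by
  rw [integral_edgeMeasure]
  refine integral_congr_ae (ae_of_all _ fun y => ?_)
  simp only [reflKernel, smul_smul, mul_div_cancel₀ _ (density_pos (m := m) y).ne']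

lemma integrable_ouKernel_smul [NeZero m] {t : ℝ} (ht : 0 < t) (s : Bool) (x : ℝ)
    (f : EdgeL2 𝕜 m) : IntegrableOn (fun y => ouKernel t x (sgn s * y) • f y) (Ioi 0) := by
  have := (integrable_edgeMeasure m _).1 ((symKernel_reflKernel (m := m) ht s).integrable_smul f x)
  refine this.congr (ae_of_all _ fun y => ?_)
  simp only [reflKernel, smul_smul, mul_div_cancel₀ _ (density_pos (m := m) y).ne']

/-- The Ornstein–Uhlenbeck operators on the half-line with Neumann (`s = true`) or Dirichlet
(`s = false`) boundary condition. -/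
def halfOp (𝕜 : Type*) [RCLike 𝕜] (m : ℕ) [NeZero m] (s : Bool) (t : ℝ≥0) :
    EdgeL2 𝕜 m →L[𝕜] EdgeL2 𝕜 m :=
  if ht : 0 < (t : ℝ) then
    (symKernel_reflKernel ht true).op 𝕜 + (sgn s : 𝕜) • (symKernel_reflKernel ht false).op 𝕜
  else ContinuousLinearMap.id 𝕜 _

/-! ### The half-line operators: bound, symmetry and action on trigonometric functions. -/

variable [NeZero m]

/-- A sum of two contractions. The crude constant suffices, since only boundedness uniform in `t` is
used. -/
lemma norm_halfOp_le (s : Bool) (t : ℝ≥0) : ‖halfOp 𝕜 m s t‖ ≤ 2 := by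
  unfold halfOp
  split_ifs with ht
  · refine (norm_add_le _ _).trans ?_
    rw [norm_smul]
    have h1 := (symKernel_reflKernel (m := m) ht true).norm_op_le (𝕜 := 𝕜)
    have h2 := (symKernel_reflKernel (m := m) ht false).norm_op_le (𝕜 := 𝕜)
    have h3 : ‖(sgn s : 𝕜)‖ = 1 := by cases s <;> simp [sgn]
    rw [h3]
    linarith
  · exact ContinuousLinearMap.norm_id_le.trans one_le_two

lemma inner_halfOp (s : Bool) (t : ℝ≥0) (f g : EdgeL2 𝕜 m) :
    inner 𝕜 g (halfOp 𝕜 m s t f) = inner 𝕜 (halfOp 𝕜 m s t g) f := by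
  unfold halfOp
  split_ifs with ht
  · simp only [add_apply, smul_apply, inner_add_left,
      inner_add_right, inner_smul_left, inner_smul_right, RCLike.conj_ofReal, SymKernel.inner_op]
  · rfl

/-- The real or imaginary part of the characteristic function of a Gaussian. -/
lemma integral_ouKernel_mul_trig {t : ℝ} (ht : 0 < t) (s : Bool) (a x : ℝ) :
    ∫ y, ouKernel t x y * trig s (a * y)
      = Real.exp (-(a ^ 2 * (1 - Real.exp (-2 * t)) / 4)) * trig s (a * Real.exp (-t) * x) := by
  have h := ProbabilityTheory.charFun_gaussianReal (μ := Real.exp (-t) * x) (v := ouVar t) a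
  rw [charFun_apply_real, ProbabilityTheory.integral_gaussianReal_eq_integral_smul
    (ouVar_ne_zero ht)] at h
  simp only [← ouKernel_eq_gaussianPDFReal ht] at h
  obtain ⟨p, hp⟩ : ∃ p : ℂ →L[ℝ] ℝ, ∀ z : ℝ, p (Complex.exp (z * Complex.I)) = trig s z := by
    cases s
    · exact ⟨Complex.imCLM, fun z => by simp [trig, Complex.exp_ofReal_mul_I_im]⟩
    · exact ⟨Complex.reCLM, fun z => by simp [trig, Complex.exp_ofReal_mul_I_re]⟩
  have hi : Integrable (fun y => ouKernel t x y • Complex.exp (a * y * Complex.I)) := by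
    refine (integrable_ouKernel ht x).mono (by unfold ouKernel; fun_prop) (ae_of_all _ fun y => ?_)
    rw [norm_smul, ← Complex.ofReal_mul, Complex.norm_exp_ofReal_mul_I, mul_one]
  have h1 := p.integral_comp_comm hi
  rw [h] at h1
  simp only [map_smul, ← Complex.ofReal_mul, hp, smul_eq_mul] at h1
  rw [h1]
  have hv : ((ouVar t : ℝ≥0) : ℂ) = (((1 - Real.exp (-2 * t)) / 2 : ℝ) : ℂ) := by
    rw [← coe_ouVar ht]
  have e : ((a * (Real.exp (-t) * x) : ℝ) : ℂ) * Complex.I - (ouVar t : ℝ≥0) * a ^ 2 / 2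
      = ((-(a ^ 2 * (1 - Real.exp (-2 * t)) / 4) : ℝ) : ℂ)
        + ((a * Real.exp (-t) * x : ℝ) : ℂ) * Complex.I := by
    rw [hv]; push_cast; ring
  rw [e, Complex.exp_add, ← Complex.ofReal_exp, ← Complex.real_smul, map_smul, hp, smul_eq_mul]

lemma integrable_ouKernel_mul_trig {t : ℝ} (ht : 0 < t) (s : Bool) (a x : ℝ) :
    Integrable fun y => ouKernel t x y * trig s (a * y) := by
  have hc := continuous_trig s
  refine (integrable_ouKernel ht x).mono (by unfold ouKernel; fun_prop) (ae_of_all _ fun y => ?_)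
  rw [norm_mul]
  exact mul_le_of_le_one_right (norm_nonneg _) (abs_trig_le s _)

lemma integral_add_reflected {g : ℝ → ℝ} (hg : Integrable g) :
    (∫ y in Ioi 0, g y) + ∫ y in Ioi 0, g (-y) = ∫ y, g y := by
  rw [integral_comp_neg_Ioi, neg_zero, add_comm]
  exact intervalIntegral.integral_Iic_add_Ioi hg.integrableOn hg.integrableOn

/-- The cosine is even and the sine odd, so the reflected kernel with sign `sgn s` unfolds the
half-line integral to an integral of `k(t,x,·)` over the whole line. -/
lemma halfOp_trigE (s : Bool) {t : ℝ≥0} (ht : 0 < (t : ℝ)) (a : ℝ) :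
    halfOp 𝕜 m s t (trigE 𝕜 m s a)
      = ((Real.exp (-(a ^ 2 * (1 - Real.exp (-2 * t)) / 4)) : ℝ) : 𝕜) •
        trigE 𝕜 m s (a * Real.exp (-t)) := by
  have hE := bddC1_trig (𝕜 := 𝕜) s a
  have hint : ∀ (r : Bool) (x : ℝ), ∫ y, reflKernel m r t x y • trigE 𝕜 m s a y ∂edgeMeasure m
      = ((∫ y in Ioi 0, ouKernel t x (sgn r * y) * trig s (a * y) : ℝ) : 𝕜) := fun r x => by
    rw [← integral_ofReal, integral_reflKernel_smul]
    refine integral_congr_ae ?_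
    filter_upwards [(ae_edgeMeasure_iff (Nat.pos_of_ne_zero (NeZero.ne m))).1
      (coeFn_toE hE.memLp)] with y hy
    rw [trigE, hy, RCLike.real_smul_eq_coe_mul, RCLike.ofReal_mul]
  rw [halfOp, dif_pos ht, add_apply, smul_apply]
  refine Lp.ext ?_
  filter_upwards [Lp.coeFn_add ((symKernel_reflKernel ht true).op 𝕜 (trigE 𝕜 m s a))
      ((sgn s : 𝕜) • (symKernel_reflKernel ht false).op 𝕜 (trigE 𝕜 m s a)),
    Lp.coeFn_smul (sgn s : 𝕜) ((symKernel_reflKernel ht false).op 𝕜 (trigE 𝕜 m s a)),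
    (symKernel_reflKernel ht true).coeFn_op (trigE 𝕜 m s a),
    (symKernel_reflKernel ht false).coeFn_op (trigE 𝕜 m s a),
    Lp.coeFn_smul ((Real.exp (-(a ^ 2 * (1 - Real.exp (-2 * t)) / 4)) : ℝ) : 𝕜)
      (trigE 𝕜 m s (a * Real.exp (-t))),
    coeFn_toE (bddC1_trig (𝕜 := 𝕜) s (a * Real.exp (-t))).memLp] with x h1 h2 h3 h4 h5 h6
  rw [h1, h5, Pi.add_apply, h2, Pi.smul_apply, Pi.smul_apply, h3, h4, hint, hint, trigE, h6,
    smul_eq_mul, smul_eq_mul, ← RCLike.ofReal_mul, ← RCLike.ofReal_mul, ← RCLike.ofReal_add,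
    ← integral_ouKernel_mul_trig ht, ← integral_add_reflected (integrable_ouKernel_mul_trig ht s a x),
    ← integral_const_mul]
  congr 2
  · simp [sgn]
  · refine integral_congr_ae (ae_of_all _ fun y => ?_)
    simp only [mul_neg, trig_neg]
    simp [sgn]

end

section

variable {𝕜 : Type*} [RCLike 𝕜] {m : ℕ}

/-! ### The generator on the half-line, tested against trigonometric functions -/

/-- `g` is the image of `f` under the adjoint of `½ ∂² - x ∂`, restricted to cosines (`s = true`)
or to sines (`s = false`). -/
def IsTrigAdjoint (s : Bool) (f g : EdgeL2 𝕜 m) : Prop :=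
  ∀ a, inner 𝕜 (trigE 𝕜 m s a) g = inner 𝕜 (trigL 𝕜 m s a) f

/-- The function `t ↦ ⟨trig s (a ·), T(t) f⟩`. -/
def trigPairing (s : Bool) (f : EdgeL2 𝕜 m) (a t : ℝ) : 𝕜 :=
  ((Real.exp (-(a ^ 2 * (1 - Real.exp (-2 * t)) / 4)) : ℝ) : 𝕜) *
    inner 𝕜 (trigE 𝕜 m s (a * Real.exp (-t))) f

/-- The family `t ↦ exp(-a² (1 - e^{-2t}) / 4) e_{a e^{-t}}` solves the evolution equation for `L`:
the derivative of the exponential supplies the zeroth-order term of `trigL`, and that of the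
frequency supplies the `trigX` term. -/
lemma hasDerivAt_trigPairing (s : Bool) (f : EdgeL2 𝕜 m) (a t : ℝ) :
    HasDerivAt (trigPairing s f a)
      (((Real.exp (-(a ^ 2 * (1 - Real.exp (-2 * t)) / 4)) : ℝ) : 𝕜) *
        inner 𝕜 (trigL 𝕜 m s (a * Real.exp (-t))) f) t := by
  have hb : HasDerivAt (fun t : ℝ => a * Real.exp (-t)) (-(a * Real.exp (-t))) t := by
    refine (((hasDerivAt_id t).neg.exp).const_mul a).congr_deriv ?_
    simp
  have he2 : Real.exp (-2 * t) = Real.exp (-t) ^ 2 := by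
    rw [← Real.exp_nat_mul]; congr 1; push_cast; ring
  have hl : HasDerivAt (fun t : ℝ => Real.exp (-(a ^ 2 * (1 - Real.exp (-2 * t)) / 4)))
      (Real.exp (-(a ^ 2 * (1 - Real.exp (-2 * t)) / 4)) *
        (-((a * Real.exp (-t)) ^ 2 / 2))) t := by
    have h1 : HasDerivAt (fun t : ℝ => Real.exp (-2 * t)) (Real.exp (-2 * t) * (-2 * 1)) t :=
      ((hasDerivAt_id t).const_mul (-2)).exp
    refine (((((h1.const_sub 1).const_mul (a ^ 2)).div_const 4).neg).exp).congr_deriv ?_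
    simp only [Pi.neg_apply]
    rw [mul_pow, he2]
    ring
  have hl' := (RCLike.ofRealCLM (K := 𝕜)).hasFDerivAt.comp_hasDerivAt t hl
  have hF := (hasDerivAt_inner_trigE s f (a * Real.exp (-t))).scomp t hb
  refine (hl'.mul hF).congr_deriv ?_
  simp only [Function.comp, RCLike.ofRealCLM_apply, inner_trigL, RCLike.real_smul_eq_coe_mul]
  push_cast
  ring

variable [NeZero m]

lemma inner_trigE_halfOp (s : Bool) (f : EdgeL2 𝕜 m) (a : ℝ) (t : ℝ≥0) :
    inner 𝕜 (trigE 𝕜 m s a) (halfOp 𝕜 m s t f) = trigPairing s f a t := by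
  rcases eq_or_lt_of_le t.2 with h | h
  · have ht : t = 0 := NNReal.eq h.symm
    subst ht
    simp [trigPairing, halfOp]
  · rw [inner_halfOp, halfOp_trigE s h, inner_smul_left, RCLike.conj_ofReal, trigPairing]

/-- Pair the difference quotient with `e_a`: its limit is `⟨e_a, g⟩`, and also the derivative of
`trigPairing` at `0`, namely `⟨L e_a, f⟩`. -/
lemma isTrigAdjoint_of_isGeneratorValue {s : Bool} {f g : EdgeL2 𝕜 m}
    (h : IsGeneratorValue (halfOp 𝕜 m s) f g) : IsTrigAdjoint s f g := by
  intro a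
  have h1 := (tendsto_const_nhds (x := trigE 𝕜 m s a)).inner (𝕜 := 𝕜) h
  have h2 := (hasDerivAt_iff_tendsto_slope_zero.1 (hasDerivAt_trigPairing s f a 0))
  have hc : Tendsto (fun t : ℝ≥0 => (t : ℝ)) (𝓝[>] 0) (𝓝[≠] 0) := by
    refine tendsto_nhdsWithin_iff.2 ⟨?_, ?_⟩
    · exact (NNReal.continuous_coe.tendsto' 0 0 rfl).mono_left nhdsWithin_le_nhds
    · filter_upwards [self_mem_nhdsWithin] with t ht
      exact (NNReal.coe_pos.2 ht).ne'
  refine tendsto_nhds_unique h1 (((h2.comp hc).congr fun t => ?_).trans_eq ?_)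
  · rw [inner_smul_right, inner_sub_right, inner_trigE_halfOp, Function.comp_apply, zero_add,
      RCLike.real_smul_eq_coe_mul]
    simp [trigPairing]
  · simp

lemma dense_span_trigE (s : Bool) :
    (Submodule.span 𝕜 (range (trigE 𝕜 m s))).topologicalClosure = ⊤ := by
  rw [Submodule.topologicalClosure_eq_top_iff, Submodule.eq_bot_iff]
  intro u hu
  refine eq_zero_of_inner_trigE_eq_zero s fun a => ?_
  exact (Submodule.mem_orthogonal _ _).1 hu _ (Submodule.subset_span ⟨a, rfl⟩)

lemma mem_closure_span_trigE (s : Bool) (u : EdgeL2 𝕜 m) :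
    u ∈ closure (Submodule.span 𝕜 (range (trigE 𝕜 m s)) : Set (EdgeL2 𝕜 m)) := by
  rw [← Submodule.topologicalClosure_coe, dense_span_trigE]
  trivial

lemma tendsto_halfOp_trigE (s : Bool) (a : ℝ) :
    Tendsto (fun t => halfOp 𝕜 m s t (trigE 𝕜 m s a)) (𝓝[>] 0) (𝓝 (trigE 𝕜 m s a)) := by
  have hE := continuous_trigE (𝕜 := 𝕜) (m := m) s
  have hc : Continuous fun t : ℝ≥0 => ((Real.exp (-(a ^ 2 * (1 - Real.exp (-2 * t)) / 4)) : ℝ) : 𝕜) •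
        trigE 𝕜 m s (a * Real.exp (-t)) := by fun_prop
  refine ((hc.tendsto' 0 (trigE 𝕜 m s a) (by simp)).mono_left nhdsWithin_le_nhds).congr' ?_
  filter_upwards [self_mem_nhdsWithin] with t ht
  rw [halfOp_trigE s (NNReal.coe_pos.2 ht)]

/-- Strong continuity at `0` is explicit on trigonometric functions and extends from their dense
span by the uniform bound. -/
lemma tendsto_halfOp (s : Bool) (g : EdgeL2 𝕜 m) :
    Tendsto (fun t => halfOp 𝕜 m s t g) (𝓝[>] 0) (𝓝 g) := by
  have hspan : ∀ h ∈ Submodule.span 𝕜 (range (trigE 𝕜 m s)),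
      Tendsto (fun t => halfOp 𝕜 m s t h) (𝓝[>] 0) (𝓝 h) := by
    intro h hh
    induction hh using Submodule.span_induction with
    | mem x hx => obtain ⟨a, rfl⟩ := hx; exact tendsto_halfOp_trigE s a
    | zero => simp
    | add x y _ _ hx hy => simpa using hx.add hy
    | smul c x _ hx => simpa using hx.const_smul c
  rw [Metric.tendsto_nhds]
  intro ε hε
  obtain ⟨h, hh, hgh⟩ := Metric.mem_closure_iff.1 (mem_closure_span_trigE s g) (ε / 4) (by linarith)
  filter_upwards [Metric.tendsto_nhds.1 (hspan h hh) (ε / 4) (by linarith)] with t ht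
  have h1 : dist (halfOp 𝕜 m s t g) (halfOp 𝕜 m s t h) ≤ 2 * dist g h := by
    rw [dist_eq_norm, dist_eq_norm, ← map_sub]
    exact (halfOp 𝕜 m s t).le_of_opNorm_le (norm_halfOp_le s t) _
  have h2 := dist_triangle4 (halfOp 𝕜 m s t g) (halfOp 𝕜 m s t h) h g
  rw [dist_comm h g] at h2
  linarith

/-- The adjoint relation is assumed at every frequency, so it may be used at `a e^{-τ}`; this turns
the derivative of `⟨e_a, T(τ) f⟩` into `⟨e_a, T(τ) g⟩`. -/
lemma hasDerivWithinAt_inner_halfOp {s : Bool} {f g : EdgeL2 𝕜 m} (hfg : IsTrigAdjoint s f g)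
    {h : EdgeL2 𝕜 m} (hh : h ∈ Submodule.span 𝕜 (range (trigE 𝕜 m s))) {τ : ℝ} (hτ : 0 ≤ τ) :
    HasDerivWithinAt (fun τ : ℝ => inner 𝕜 h (halfOp 𝕜 m s τ.toNNReal f))
      (inner 𝕜 h (halfOp 𝕜 m s τ.toNNReal g)) (Ici 0) τ := by
  induction hh using Submodule.span_induction with
  | mem x hx =>
    obtain ⟨a, rfl⟩ := hx
    simp only [inner_trigE_halfOp]
    have h1 : trigPairing s g a τ.toNNReal
        = ((Real.exp (-(a ^ 2 * (1 - Real.exp (-2 * τ)) / 4)) : ℝ) : 𝕜) *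
        inner 𝕜 (trigL 𝕜 m s (a * Real.exp (-τ))) f := by
      rw [trigPairing, hfg, Real.coe_toNNReal τ hτ]
    rw [h1]
    refine (hasDerivAt_trigPairing s f a τ).hasDerivWithinAt.congr (fun x hx => ?_) ?_
    · rw [Real.coe_toNNReal x hx]
    · rw [Real.coe_toNNReal τ hτ]
  | zero => simpa using hasDerivWithinAt_const τ (Ici 0) (0 : 𝕜)
  | add x y _ _ hx hy => simp only [inner_add_left]; exact hx.add hy
  | smul c x _ hx => simpa only [inner_smul_left] using hx.const_mul _

/-- A quantitative form of `T(t) f - f = ∫_0^t T(r) g dr`. It is proved weakly, by the mean value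
inequality against `h` in the span of the `e_a`, with a constant proportional to `‖h‖`. -/
lemma norm_halfOp_sub_sub_le {s : Bool} {f g : EdgeL2 𝕜 m} (hfg : IsTrigAdjoint s f g)
    {t : ℝ≥0} {κ : ℝ} (hκ0 : 0 ≤ κ) (hκ : ∀ r < t, ‖halfOp 𝕜 m s r g - g‖ ≤ κ) :
    ‖halfOp 𝕜 m s t f - f - ((t : ℝ) : 𝕜) • g‖ ≤ t * κ := by
  set v := halfOp 𝕜 m s t f - f - ((t : ℝ) : 𝕜) • g with hv
  have hspan : ∀ h ∈ Submodule.span 𝕜 (range (trigE 𝕜 m s)),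
      ‖inner 𝕜 h v‖ ≤ t * κ * ‖h‖ := by
    intro h hh
    have hd : ∀ τ ∈ Icc (0 : ℝ) t, HasDerivWithinAt
        (fun τ : ℝ => inner 𝕜 h (halfOp 𝕜 m s τ.toNNReal f) - (τ : 𝕜) * inner 𝕜 h g)
        (inner 𝕜 h (halfOp 𝕜 m s τ.toNNReal g) - 1 * inner 𝕜 h g) (Icc 0 t) τ := by
      intro τ hτ
      have hof : HasDerivAt (fun x : ℝ => (x : 𝕜)) 1 τ := by
        simpa using (RCLike.ofRealCLM (K := 𝕜)).hasFDerivAt.comp_hasDerivAt τ (hasDerivAt_id τ)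
      exact ((hasDerivWithinAt_inner_halfOp hfg hh hτ.1).mono Icc_subset_Ici_self).sub
        (hof.mul_const _).hasDerivWithinAt
    have := norm_image_sub_le_of_norm_deriv_le_segment' (C := κ * ‖h‖) hd (fun τ hτ => by
      rw [one_mul, ← inner_sub_right, mul_comm]
      refine (norm_inner_le_norm _ _).trans (mul_le_mul_of_nonneg_left (hκ _ ?_) (norm_nonneg _))
      rw [← NNReal.coe_lt_coe, Real.coe_toNNReal τ hτ.1]
      exact hτ.2) t (right_mem_Icc.2 t.2)
    have e : inner 𝕜 h v = inner 𝕜 h (halfOp 𝕜 m s (t : ℝ).toNNReal f) - ((t : ℝ) : 𝕜) * inner 𝕜 h g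
        - (inner 𝕜 h (halfOp 𝕜 m s (0 : ℝ).toNNReal f) - ((0 : ℝ) : 𝕜) * inner 𝕜 h g) := by
      have h0 : halfOp 𝕜 m s 0 f = f := by simp [halfOp]
      rw [hv, inner_sub_right, inner_sub_right, inner_smul_right, Real.toNNReal_coe,
        Real.toNNReal_zero, h0, RCLike.ofReal_zero]
      ring
    rw [e]
    refine this.trans (le_of_eq ?_)
    ring
  have hcl : IsClosed {h : EdgeL2 𝕜 m | ‖inner 𝕜 h v‖ ≤ t * κ * ‖h‖} :=
    isClosed_le (by fun_prop) (by fun_prop)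
  -- The bound is a closed condition on `h` and holds on a dense subspace, so it may be applied to
  -- `h = v` itself.
  have hv2 : ‖inner 𝕜 v v‖ ≤ t * κ * ‖v‖ :=
    closure_minimal hspan hcl (mem_closure_span_trigE s v)
  rw [inner_self_eq_norm_sq_to_K, norm_pow, RCLike.norm_ofReal, abs_norm, sq] at hv2
  rcases eq_or_lt_of_le (norm_nonneg v) with h0 | h0
  · rw [← h0]; positivity
  · exact le_of_mul_le_mul_right hv2 h0

lemma isGeneratorValue_of_isTrigAdjoint {s : Bool} {f g : EdgeL2 𝕜 m}
    (hfg : IsTrigAdjoint s f g) : IsGeneratorValue (halfOp 𝕜 m s) f g := by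
  rw [IsGeneratorValue, Metric.tendsto_nhds]
  intro ε hε
  have h1 := Metric.tendsto_nhds.1 (tendsto_halfOp s g) (ε / 2) (by linarith)
  rw [eventually_nhdsWithin_iff, Metric.eventually_nhds_iff] at h1
  obtain ⟨δ, hδ, h1⟩ := h1
  have h2 : ∀ᶠ t : ℝ≥0 in 𝓝[>] 0, dist t 0 < δ :=
    nhdsWithin_le_nhds (Metric.ball_mem_nhds _ hδ)
  filter_upwards [self_mem_nhdsWithin, h2] with t ht htδ
  have ht' : 0 < (t : ℝ) := NNReal.coe_pos.2 ht
  have key := norm_halfOp_sub_sub_le hfg (t := t) (κ := ε / 2) (by linarith) fun r hr => by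
    -- The limit is along `t > 0` only, so `r = 0` is treated apart; there the operator is the
    -- identity.
    rcases eq_or_lt_of_le (zero_le (a := r)) with h | h
    · rw [← h]
      simp [halfOp]
      linarith
    · rw [← dist_eq_norm]
      refine (h1 ?_ h).le
      refine lt_of_le_of_lt ?_ htδ
      rw [NNReal.dist_eq, NNReal.dist_eq]
      simpa using hr.le
  have e : (((t : ℝ) : 𝕜))⁻¹ • (halfOp 𝕜 m s t f - f) - g
      = (((t : ℝ) : 𝕜))⁻¹ • (halfOp 𝕜 m s t f - f - ((t : ℝ) : 𝕜) • g) := by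
    rw [smul_sub _ _ (((t : ℝ) : 𝕜) • g), smul_smul, inv_mul_cancel₀, one_smul]
    exact_mod_cast ht'.ne'
  rw [dist_eq_norm, e, norm_smul, norm_inv, RCLike.norm_ofReal, abs_of_pos ht']
  calc (t : ℝ)⁻¹ * _ ≤ (t : ℝ)⁻¹ * (t * (ε / 2)) := by gcongr
    _ = ε / 2 := by field_simp
    _ < ε := by linarith

end

section

variable {𝕜 : Type*} [RCLike 𝕜] {m : ℕ}

/-! ### Integrals over bounded sets as inner products -/

/-- The element of `L²_μ` representing the functional `f ↦ ∫_0^∞ φ f`. -/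
def pairE (𝕜 : Type*) [RCLike 𝕜] (m : ℕ) (φ : ℝ → ℝ) : EdgeL2 𝕜 m :=
  toE m fun x => ((φ x / density m x : ℝ) : 𝕜)

/-- `φ` is measurable, bounded and vanishes far to the right. -/
def BddSupp (φ : ℝ → ℝ) : Prop :=
  Measurable φ ∧ (∃ C, ∀ x, |φ x| ≤ C) ∧ ∃ R, ∀ x, R < x → φ x = 0

lemma _root_.HasCompactSupport.bddSupp {φ : ℝ → ℝ} (hφ : HasCompactSupport φ) (hc : Continuous φ) :
    BddSupp φ := by
  refine ⟨hc.measurable, hc.bounded_above_of_compact_support hφ, ?_⟩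
  obtain ⟨R, hR⟩ := hφ.isCompact.bddAbove
  exact ⟨R, fun x hx => by_contra fun h => absurd (hR (subset_tsupport _ h)) (not_le.2 hx)⟩

lemma bddSupp_indicator {φ : ℝ → ℝ} (hc : Continuous φ) (b : ℝ) :
    BddSupp ((Ioc 0 b).indicator φ) := by
  obtain ⟨C, hC⟩ := (isCompact_Icc (a := (0 : ℝ)) (b := b)).exists_bound_of_continuousOn
    hc.continuousOn
  refine ⟨hc.measurable.indicator measurableSet_Ioc, ⟨max C 0, fun x => ?_⟩, b, fun x hx => ?_⟩
  · by_cases hx : x ∈ Ioc 0 b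
    · rw [indicator_of_mem hx]
      exact (hC x (Ioc_subset_Icc_self hx)).trans (le_max_left _ _)
    · simp [indicator_of_notMem hx]
  · exact indicator_of_notMem (fun h => absurd h.2 (not_le.2 hx)) _

section Pairing

variable [NeZero m]

lemma ae_edge_iff {p : ℝ → Prop} :
    (∀ᵐ x ∂edgeMeasure m, p x) ↔ ∀ᵐ x ∂volume.restrict (Ioi 0), p x :=
  ae_edgeMeasure_iff (Nat.pos_of_ne_zero (NeZero.ne m))

lemma memLp_div_density {φ : ℝ → ℝ} (hφ : BddSupp φ) :
    MemLp (fun x => ((φ x / density m x : ℝ) : 𝕜)) 2 (edgeMeasure m) := by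
  obtain ⟨hm, ⟨C, hC⟩, R, hR⟩ := hφ
  have hmd := measurable_density m
  refine MemLp.of_bound (C := C / density m R) (Measurable.aestronglyMeasurable (by fun_prop)) ?_
  rw [ae_edge_iff, ae_restrict_iff' measurableSet_Ioi]
  refine ae_of_all _ fun x hx => ?_
  have hC0 : 0 ≤ C := (abs_nonneg _).trans (hC 0)
  have hR0 := density_pos (m := m) R
  rw [RCLike.norm_ofReal, abs_div, abs_of_pos (density_pos x)]
  by_cases hxR : R < x
  · rw [hR x hxR, abs_zero, zero_div]; positivity
  · have : density m R ≤ density m x := by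
      unfold density
      gcongr
      · exact (mem_Ioi.1 hx).le
      · exact not_lt.1 hxR
    gcongr
    exact hC x

lemma inner_pairE {φ : ℝ → ℝ} (hφ : BddSupp φ) (f : EdgeL2 𝕜 m) :
    inner 𝕜 (pairE 𝕜 m φ) f = ∫ x in Ioi 0, φ x • f x := by
  rw [pairE, inner_toE_left (memLp_div_density hφ), integral_edgeMeasure]
  refine integral_congr_ae (ae_of_all _ fun x => ?_)
  simp only [RCLike.conj_ofReal, ← RCLike.real_smul_eq_coe_mul, smul_smul,
    mul_div_cancel₀ _ (density_pos (m := m) x).ne']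

lemma integrableOn_smul {φ : ℝ → ℝ} (hφ : BddSupp φ) (f : EdgeL2 𝕜 m) :
    IntegrableOn (fun x => φ x • f x) (Ioi 0) := by
  have h := (integrable_edgeMeasure m _).1
    (integrable_conj_mul (memLp_div_density (𝕜 := 𝕜) hφ) (Lp.memLp f))
  refine h.congr (ae_of_all _ fun x => ?_)
  simp only [RCLike.conj_ofReal, ← RCLike.real_smul_eq_coe_mul, smul_smul,
    mul_div_cancel₀ _ (density_pos (m := m) x).ne']

lemma integrableOn_Ioc (f : EdgeL2 𝕜 m) (b : ℝ) : IntegrableOn f (Ioc 0 b) := by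
  have h := integrableOn_smul (bddSupp_indicator continuous_const (φ := fun _ => 1) b) f
  refine (h.mono_set Ioc_subset_Ioi_self).congr_fun (fun x hx => ?_) measurableSet_Ioc
  simp [indicator_of_mem hx]

lemma inner_pairE_indicator {φ : ℝ → ℝ} (hφ : Continuous φ) (b : ℝ) (f : EdgeL2 𝕜 m) :
    inner 𝕜 (pairE 𝕜 m ((Ioc 0 b).indicator φ)) f = ∫ x in Ioc 0 b, φ x • f x := by
  rw [inner_pairE (bddSupp_indicator hφ b)]
  have : (fun x => (Ioc 0 b).indicator φ x • f x) = (Ioc 0 b).indicator fun x => φ x • f x := by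
    funext x
    by_cases hx : x ∈ Ioc 0 b <;> simp [hx]
  rw [this, setIntegral_indicator measurableSet_Ioc, inter_eq_right.2 Ioc_subset_Ioi_self]

/-! ### Weak derivatives -/

/-- Both Lebesgue integrals become inner products with fixed vectors of `L²_μ`. This makes the
relation visibly linear and closed under norm limits. -/
lemma isWeakDeriv_iff {f g : EdgeL2 𝕜 m} : IsWeakDeriv f g ↔
    ∀ φ : ℝ → ℝ, ContDiff ℝ ∞ φ → HasCompactSupport φ → tsupport φ ⊆ Ioi 0 →
      inner 𝕜 (pairE 𝕜 m (deriv φ)) f = -inner 𝕜 (pairE 𝕜 m φ) g := by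
  refine forall_congr' fun φ => forall_congr' fun h1 => forall_congr' fun h2 =>
    forall_congr' fun h3 => ?_
  rw [inner_pairE (h2.bddSupp h1.continuous),
    inner_pairE (h2.deriv.bddSupp (h1.continuous_deriv (by simp)))]

lemma IsWeakDeriv.add {f g f₁ g₁ : EdgeL2 𝕜 m} (h : IsWeakDeriv f g) (h₁ : IsWeakDeriv f₁ g₁) :
    IsWeakDeriv (f + f₁) (g + g₁) := by
  rw [isWeakDeriv_iff] at *
  intro φ a b c
  rw [inner_add_right, inner_add_right, h φ a b c, h₁ φ a b c]
  ring

lemma IsWeakDeriv.smul {f g : EdgeL2 𝕜 m} (c : 𝕜) (h : IsWeakDeriv f g) :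
    IsWeakDeriv (c • f) (c • g) := by
  rw [isWeakDeriv_iff] at *
  intro φ h1 h2 h3
  rw [inner_smul_right, inner_smul_right, h φ h1 h2 h3]
  ring

lemma IsWeakDeriv.sub {f g f₁ g₁ : EdgeL2 𝕜 m} (h : IsWeakDeriv f g) (h₁ : IsWeakDeriv f₁ g₁) :
    IsWeakDeriv (f - f₁) (g - g₁) := by
  simpa [sub_eq_add_neg] using h.add (h₁.smul (-1))

lemma isWeakDeriv_zero : IsWeakDeriv (0 : EdgeL2 𝕜 m) 0 := by
  rw [isWeakDeriv_iff]
  simp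

lemma IsWeakDeriv.of_tendsto {u v : ℕ → EdgeL2 𝕜 m} {f g : EdgeL2 𝕜 m}
    (h : ∀ n, IsWeakDeriv (u n) (v n)) (hu : Tendsto u atTop (𝓝 f)) (hv : Tendsto v atTop (𝓝 g)) :
    IsWeakDeriv f g := by
  rw [isWeakDeriv_iff]
  intro φ h1 h2 h3
  refine tendsto_nhds_unique ((tendsto_const_nhds.inner hu)) ?_
  refine ((tendsto_const_nhds.inner hv).neg).congr fun n => ?_
  exact (isWeakDeriv_iff.1 (h n) φ h1 h2 h3).symm

/-- The fundamental lemma of the calculus of variations, applied to the difference, which is locally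
integrable on `(0, ∞)`. -/
lemma IsWeakDeriv.unique {f g g₁ : EdgeL2 𝕜 m} (h : IsWeakDeriv f g) (h₁ : IsWeakDeriv f g₁) :
    g = g₁ := by
  have h0 := h.sub h₁
  rw [sub_self] at h0
  rw [← sub_eq_zero]
  set k := g - g₁
  have hloc : LocallyIntegrableOn k (Ioi 0) := by
    rw [locallyIntegrableOn_iff isLocallyClosed_Ioi]
    intro K hK hKc
    obtain ⟨R, hR⟩ := hKc.bddAbove
    exact (integrableOn_Ioc k R).mono_set fun x hx => ⟨hK hx, hR hx⟩
  have := isOpen_Ioi.ae_eq_zero_of_integral_contDiff_smul_eq_zero hloc fun φ h1 h2 h3 => by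
    have h4 := isWeakDeriv_iff.1 h0 φ h1 h2 h3
    rw [inner_zero_right, eq_comm, neg_eq_zero, inner_pairE (h2.bddSupp h1.continuous)] at h4
    rw [← h4, setIntegral_eq_integral_of_forall_compl_eq_zero]
    intro x hx
    rw [image_eq_zero_of_notMem_tsupport (fun hx' => hx (h3 hx')), zero_smul]
  refine Lp.ext ?_
  refine EventuallyEq.trans ?_ (Lp.coeFn_zero 𝕜 2 (edgeMeasure m)).symm
  rw [EventuallyEq, ae_edge_iff, ae_restrict_iff' measurableSet_Ioi]
  exact this

lemma BddC1.isWeakDeriv {u u' : ℝ → 𝕜} (h : BddC1 u u') :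
    IsWeakDeriv (toE m u) (toE m u') := by
  intro φ h1 h2 h3
  have hφ := h2.bddSupp h1.continuous
  have hφ' := h2.deriv.bddSupp (h1.continuous_deriv (by simp))
  have e1 : ∫ x in Ioi 0, deriv φ x • toE m u x = ∫ x in Ioi 0, deriv φ x • u x := by
    refine integral_congr_ae ?_
    filter_upwards [ae_edge_iff.1 (coeFn_toE (m := m) h.memLp)] with x hx
    rw [hx]
  have e2 : ∫ x in Ioi 0, φ x • toE m u' x = ∫ x in Ioi 0, φ x • u' x := by
    refine integral_congr_ae ?_
    filter_upwards [ae_edge_iff.1 (coeFn_toE (m := m) h.memLp')] with x hx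
    rw [hx]
  have i1 : IntegrableOn (fun x => deriv φ x • u x) (Ioi 0) :=
    (Continuous.integrable_of_hasCompactSupport
      ((h1.continuous_deriv (by simp)).smul h.continuous) h2.deriv.smul_right).integrableOn
  have i2 : IntegrableOn (fun x => φ x • u' x) (Ioi 0) :=
    (Continuous.integrable_of_hasCompactSupport
      (h1.continuous.smul h.continuous') h2.smul_right).integrableOn
  have hd : ∀ x ∈ Ici (0 : ℝ), HasDerivAt (fun x => φ x • u x) (φ x • u' x + deriv φ x • u x) x :=
    fun x _ => ((h1.differentiable (by simp) x).hasDerivAt).smul (h.hasDerivAt x)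
  have key := integral_Ioi_of_hasDerivAt_of_tendsto' hd (i2.add i1) (m := 0) (by
    have hcs : HasCompactSupport fun x => φ x • u x := h2.smul_right
    rw [hasCompactSupport_iff_eventuallyEq, Filter.coclosedCompact_eq_cocompact] at hcs
    exact (hcs.filter_mono _root_.atTop_le_cocompact).tendsto)
  rw [integral_add i2 i1, image_eq_zero_of_notMem_tsupport
    (fun h0 => lt_irrefl (0 : ℝ) (h3 h0)), zero_smul, sub_zero] at key
  rw [e1, e2]
  linear_combination key

end Pairing

/-! ### Cut-off functions -/

lemma deriv_smoothTransition_of_notMem {x : ℝ} (hx : x ∉ Icc (0 : ℝ) 1) :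
    deriv Real.smoothTransition x = 0 := by
  rw [mem_Icc, not_and_or, not_le, not_le] at hx
  rcases hx with hx | hx
  · have : Real.smoothTransition =ᶠ[𝓝 x] fun _ => 0 := by
      filter_upwards [Iio_mem_nhds hx] with y hy
      exact Real.smoothTransition.zero_of_nonpos (le_of_lt hy)
    rw [this.deriv_eq, deriv_const]
  · have : Real.smoothTransition =ᶠ[𝓝 x] fun _ => 1 := by
      filter_upwards [Ioi_mem_nhds hx] with y hy
      exact Real.smoothTransition.one_of_one_le (le_of_lt hy)
    rw [this.deriv_eq, deriv_const]

lemma exists_abs_deriv_smoothTransition_le :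
    ∃ K, 0 ≤ K ∧ ∀ x, |deriv Real.smoothTransition x| ≤ K := by
  have hc : Continuous (deriv Real.smoothTransition) :=
    (Real.smoothTransition.contDiff (n := 1)).continuous_deriv le_rfl
  obtain ⟨C, hC⟩ := (isCompact_Icc (a := (0 : ℝ)) (b := 1)).exists_bound_of_continuousOn
    hc.continuousOn
  refine ⟨max C 0, le_max_right _ _, fun x => ?_⟩
  by_cases hx : x ∈ Icc (0 : ℝ) 1
  · exact (hC x hx).trans (le_max_left _ _)
  · rw [deriv_smoothTransition_of_notMem hx, abs_zero]; exact le_max_right _ _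

/-- A smooth function that is `1` on `[2/r, r]` and vanishes outside `[1/r, 2r]`. -/
def cutoff (r x : ℝ) : ℝ := Real.smoothTransition (r * x - 1) * Real.smoothTransition (2 - r⁻¹ * x)

/-- The derivative of `cutoff r`. -/
def cutoffD (r x : ℝ) : ℝ :=
  r * deriv Real.smoothTransition (r * x - 1) * Real.smoothTransition (2 - r⁻¹ * x)
    - Real.smoothTransition (r * x - 1) * (r⁻¹ * deriv Real.smoothTransition (2 - r⁻¹ * x))

lemma contDiff_cutoff (r : ℝ) : ContDiff ℝ ∞ (cutoff r) := by
  unfold cutoff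
  exact (Real.smoothTransition.contDiff.comp (by fun_prop)).mul
    (Real.smoothTransition.contDiff.comp (by fun_prop))

lemma hasDerivAt_cutoff (r x : ℝ) : HasDerivAt (cutoff r) (cutoffD r x) x := by
  have hd : ∀ y, HasDerivAt Real.smoothTransition (deriv Real.smoothTransition y) y := fun y =>
    ((Real.smoothTransition.contDiff (n := 1)).differentiable one_ne_zero y).hasDerivAt
  have h1 := (hd (r * x - 1)).comp x (((hasDerivAt_id x).const_mul r).sub_const 1)
  have h2 := (hd (2 - r⁻¹ * x)).comp x (((hasDerivAt_id x).const_mul r⁻¹).const_sub 2)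
  refine (h1.mul h2).congr_deriv ?_
  simp only [cutoffD, Function.comp, id]
  ring

lemma abs_cutoff_le (r x : ℝ) : |cutoff r x| ≤ 1 := by
  rw [cutoff, abs_mul, abs_of_nonneg (Real.smoothTransition.nonneg _),
    abs_of_nonneg (Real.smoothTransition.nonneg _)]
  exact mul_le_one₀ (Real.smoothTransition.le_one _) (Real.smoothTransition.nonneg _)
    (Real.smoothTransition.le_one _)

/-- `cutoff r` depends on `x` only through `r x` and `x / r`, so `x` times its derivative is bounded
uniformly in `r`. -/
lemma exists_abs_mul_cutoffD_le : ∃ K, 0 ≤ K ∧ ∀ r, 0 < r → ∀ x, |x * cutoffD r x| ≤ K := by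
  obtain ⟨K, hK0, hK⟩ := exists_abs_deriv_smoothTransition_le
  have h1 : ∀ z, |z * deriv Real.smoothTransition (z - 1)| ≤ 2 * K := fun z => by
    by_cases hz : z - 1 ∈ Icc (0 : ℝ) 1
    · rw [abs_mul]
      have : |z| ≤ 2 := abs_le.2 ⟨by linarith [hz.1], by linarith [hz.2]⟩
      exact mul_le_mul this (hK _) (abs_nonneg _) zero_le_two
    · rw [deriv_smoothTransition_of_notMem hz, mul_zero, abs_zero]; positivity
  have h2 : ∀ z, |z * deriv Real.smoothTransition (2 - z)| ≤ 2 * K := fun z => by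
    by_cases hz : 2 - z ∈ Icc (0 : ℝ) 1
    · rw [abs_mul]
      have : |z| ≤ 2 := abs_le.2 ⟨by linarith [hz.2], by linarith [hz.1]⟩
      exact mul_le_mul this (hK _) (abs_nonneg _) zero_le_two
    · rw [deriv_smoothTransition_of_notMem hz, mul_zero, abs_zero]; positivity
  refine ⟨2 * K + 2 * K, by positivity, fun r hr x => ?_⟩
  have e : x * cutoffD r x = (r * x * deriv Real.smoothTransition (r * x - 1)) *
      Real.smoothTransition (2 - r⁻¹ * x)
      - Real.smoothTransition (r * x - 1) *
        (r⁻¹ * x * deriv Real.smoothTransition (2 - r⁻¹ * x)) := by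
    rw [cutoffD]; ring
  rw [e]
  refine (abs_sub _ _).trans (add_le_add ?_ ?_)
  · rw [abs_mul, abs_of_nonneg (Real.smoothTransition.nonneg _)]
    exact (mul_le_of_le_one_right (abs_nonneg _) (Real.smoothTransition.le_one _)).trans (h1 _)
  · rw [abs_mul, abs_of_nonneg (Real.smoothTransition.nonneg _)]
    exact (mul_le_of_le_one_left (abs_nonneg _) (Real.smoothTransition.le_one _)).trans (h2 _)

lemma cutoff_eq_zero {r x : ℝ} (hr : 0 < r) (hx : x ∉ Icc r⁻¹ (2 * r)) : cutoff r x = 0 := by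
  rw [mem_Icc, not_and_or, not_le, not_le] at hx
  rcases hx with hx | hx
  · rw [cutoff, Real.smoothTransition.zero_of_nonpos, zero_mul]
    have := mul_le_mul_of_nonneg_left hx.le hr.le
    rw [mul_inv_cancel₀ hr.ne'] at this
    linarith
  · rw [cutoff, Real.smoothTransition.zero_of_nonpos (x := 2 - r⁻¹ * x), mul_zero]
    have := mul_le_mul_of_nonneg_left hx.le (inv_pos.2 hr).le
    rw [mul_left_comm, inv_mul_cancel₀ hr.ne'] at this
    linarith

lemma eventually_cutoff {x : ℝ} (hx : 0 < x) :
    ∀ᶠ n : ℕ in atTop, cutoff (n + 1) x = 1 ∧ cutoffD (n + 1) x = 0 := by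
  have h1 : Tendsto (fun n : ℕ => (n : ℝ) + 1) atTop atTop :=
    tendsto_atTop_add_const_right _ _ tendsto_natCast_atTop_atTop
  filter_upwards [h1.eventually_gt_atTop (2 / x), h1.eventually_gt_atTop x] with n h2 h3
  have hn : (0 : ℝ) < n + 1 := by positivity
  have h4 : 1 < ((n : ℝ) + 1) * x - 1 := by
    rw [div_lt_iff₀ hx] at h2; linarith
  have h5 : 1 < 2 - ((n : ℝ) + 1)⁻¹ * x := by
    have : ((n : ℝ) + 1)⁻¹ * x < 1 := by
      rw [inv_mul_lt_iff₀ hn]; linarith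
    linarith
  constructor
  · rw [cutoff, Real.smoothTransition.one_of_one_le h4.le, Real.smoothTransition.one_of_one_le h5.le,
      one_mul]
  · rw [cutoffD, deriv_smoothTransition_of_notMem (fun h => absurd h.2 (not_le.2 h4)),
      deriv_smoothTransition_of_notMem (fun h => absurd h.2 (not_le.2 h5))]
    ring

end

section

variable {𝕜 : Type*} [RCLike 𝕜] {m : ℕ} [NeZero m]

/-! ### Approximation of weakly differentiable functions -/

lemma contDiff_density (m : ℕ) : ContDiff ℝ ∞ (density m) := by
  unfold density
  exact contDiff_const.mul (by fun_prop)

/-- Integration by parts for weakly differentiable functions, with a vanishing boundary term. -/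
lemma IsWeakDeriv.inner_eq {u v : EdgeL2 𝕜 m} (h : IsWeakDeriv u v) {w w' : ℝ → ℝ}
    (hw : ContDiff ℝ ∞ w) (hd : ∀ x, HasDerivAt w (w' x) x) {C : ℝ} (hC : ∀ x, |w x| ≤ C * |x|)
    (mw : MemLp (fun x => (w x : 𝕜)) 2 (edgeMeasure m))
    (mw' : MemLp (fun x => ((w' x - 2 * x * w x : ℝ) : 𝕜)) 2 (edgeMeasure m)) :
    inner 𝕜 (toE m fun x => (w x : 𝕜)) v
      = -inner 𝕜 (toE m fun x => ((w' x - 2 * x * w x : ℝ) : 𝕜)) u := by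
  obtain ⟨K, hK0, hK⟩ := exists_abs_mul_cutoffD_le
  have hC0 : 0 ≤ C := by simpa using (abs_nonneg _).trans (hC 1)
  have hi1 : Integrable (fun x => w x • v x) (edgeMeasure m) := by
    simpa [RCLike.real_smul_eq_coe_mul] using integrable_conj_mul mw (Lp.memLp v)
  have hi2 : Integrable (fun x => (w' x - 2 * x * w x) • u x) (edgeMeasure m) := by
    refine (integrable_conj_mul mw' (Lp.memLp u)).congr (ae_of_all _ fun x => ?_)
    simp only [RCLike.conj_ofReal, RCLike.real_smul_eq_coe_mul]
  have hi3 : Integrable u (edgeMeasure m) := (Lp.memLp u).integrable (by norm_num)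
  have hw'c : Measurable w' := by
    have : w' = deriv w := funext fun x => (hd x).deriv.symm
    rw [this]; exact measurable_deriv w
  have hcd : ∀ r, Measurable (cutoffD r) := fun r => by
    have : cutoffD r = deriv (cutoff r) := funext fun x => (hasDerivAt_cutoff r x).deriv.symm
    rw [this]; exact measurable_deriv _
  have hum := Lp.aestronglyMeasurable u
  have hvm := Lp.aestronglyMeasurable v
  have hpos : ∀ᵐ x ∂edgeMeasure m, 0 < x := by
    rw [ae_edge_iff, ae_restrict_iff' measurableSet_Ioi]
    exact ae_of_all _ fun x hx => hx
  have hn : ∀ n : ℕ, (0 : ℝ) < n + 1 := fun n => by positivity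
  -- Test the weak derivative with `cutoff · w · density`; the last factor converts Lebesgue
  -- integrals into integrals over the edge measure and contributes the term `-2 x w`.
  have key : ∀ n : ℕ, ∫ x, (cutoffD (n + 1) x * w x + cutoff (n + 1) x * (w' x - 2 * x * w x)) • u x
      ∂edgeMeasure m = -∫ x, (cutoff (n + 1) x * w x) • v x ∂edgeMeasure m := fun n => by
    have hs : Function.support (fun x => cutoff (n + 1) x * w x * density m x)
        ⊆ Icc ((n : ℝ) + 1)⁻¹ (2 * (n + 1)) := fun x hx => by
      by_contra h0
      exact hx (by simp only [cutoff_eq_zero (hn n) h0, zero_mul])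
    have hts : tsupport (fun x => cutoff (n + 1) x * w x * density m x)
        ⊆ Icc ((n : ℝ) + 1)⁻¹ (2 * (n + 1)) := closure_minimal hs isClosed_Icc
    have h1 := h (fun x => cutoff (n + 1) x * w x * density m x)
      (((contDiff_cutoff _).mul hw).mul (contDiff_density m))
      (HasCompactSupport.of_support_subset_isCompact isCompact_Icc hs)
      (hts.trans fun x hx => lt_of_lt_of_le (inv_pos.2 (hn n)) hx.1)
    rw [integral_edgeMeasure, integral_edgeMeasure]
    refine Eq.trans ?_ (h1.trans ?_)
    · refine integral_congr_ae (ae_of_all _ fun x => ?_)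
      have := (((hasDerivAt_cutoff (n + 1) x).mul (hd x)).mul (hasDerivAt_density m x)).deriv
      simp only
      rw [show deriv (fun x => cutoff (n + 1) x * w x * density m x) x = _ from this, smul_smul]
      congr 1
      simp only [Pi.mul_apply]
      ring
    · congr 1
      refine integral_congr_ae (ae_of_all _ fun x => ?_)
      simp only [smul_smul]
      congr 1
      ring
  have l1 : Tendsto (fun n : ℕ => ∫ x, (cutoff (n + 1) x * w x) • v x ∂edgeMeasure m) atTop
      (𝓝 (∫ x, w x • v x ∂edgeMeasure m)) := by
    refine tendsto_integral_of_dominated_convergence (fun x => ‖w x • v x‖) (fun n => ?_) hi1.norm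
      (fun n => ae_of_all _ fun x => ?_) ?_
    · have := (contDiff_cutoff (n + 1)).continuous
      have := hw.continuous
      exact (Continuous.aestronglyMeasurable (by fun_prop)).smul hvm
    · rw [mul_smul, norm_smul]
      exact mul_le_of_le_one_left (norm_nonneg _) (abs_cutoff_le _ _)
    · filter_upwards [hpos] with x hx
      refine tendsto_const_nhds.congr' ?_
      filter_upwards [eventually_cutoff hx] with n h2
      rw [h2.1, one_mul]
  have l2 : Tendsto (fun n : ℕ => ∫ x, (cutoffD (n + 1) x * w x
      + cutoff (n + 1) x * (w' x - 2 * x * w x)) • u x ∂edgeMeasure m) atTop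
      (𝓝 (∫ x, (w' x - 2 * x * w x) • u x ∂edgeMeasure m)) := by
    -- The term with the derivative of the cutoff stays bounded because `|w x| ≤ C |x|` and `x *
    -- cutoffD` is bounded uniformly in `n`; it tends to `0` pointwise.
    refine tendsto_integral_of_dominated_convergence
      (fun x => C * K * ‖u x‖ + ‖(w' x - 2 * x * w x) • u x‖) (fun n => ?_)
      ((hi3.norm.const_mul _).add hi2.norm) (fun n => ae_of_all _ fun x => ?_) ?_
    · have h1 := (contDiff_cutoff (n + 1)).continuous.measurable
      have h2 := hw.continuous.measurable
      have h3 := hcd (n + 1)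
      exact (Measurable.aestronglyMeasurable (by fun_prop)).smul hum
    · rw [add_smul]
      refine (norm_add_le _ _).trans (add_le_add ?_ ?_)
      · rw [norm_smul]
        gcongr
        rw [Real.norm_eq_abs, abs_mul]
        calc |cutoffD (n + 1) x| * |w x| ≤ |cutoffD (n + 1) x| * (C * |x|) := by gcongr; exact hC x
          _ = C * |x * cutoffD (n + 1) x| := by rw [abs_mul]; ring
          _ ≤ C * K := by gcongr; exact hK _ (hn n) x
      · rw [mul_smul, norm_smul]
        exact mul_le_of_le_one_left (norm_nonneg _) (abs_cutoff_le _ _)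
    · filter_upwards [hpos] with x hx
      refine tendsto_const_nhds.congr' ?_
      filter_upwards [eventually_cutoff hx] with n h2
      rw [h2.1, h2.2, zero_mul, zero_add, one_mul]
  have hfin := tendsto_nhds_unique l2 (l1.neg.congr fun n => (key n).symm)
  rw [inner_toE_left mw, inner_toE_left mw']
  simp only [RCLike.conj_ofReal, ← RCLike.real_smul_eq_coe_mul]
  rw [hfin, neg_neg]

/-- Integration by parts against the derivative of the cosine, `-a sin(a x)`. It vanishes at `0`, so
no boundary value of `u` is needed at this stage. -/
lemma IsWeakDeriv.inner_trig_eq {u v : EdgeL2 𝕜 m} (h : IsWeakDeriv u v) (a : ℝ) :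
    inner 𝕜 (toE m fun x : ℝ => (a : 𝕜) * ((trigD true (a * x) : ℝ) : 𝕜)) v
      = -inner 𝕜 ((2 : 𝕜) • trigL 𝕜 m true a) u := by
  have e : (fun x : ℝ => (a : 𝕜) * ((trigD true (a * x) : ℝ) : 𝕜))
      = fun x : ℝ => ((a * trigD true (a * x) : ℝ) : 𝕜) := by
    funext x; push_cast; rfl
  have e2 : (fun x : ℝ => ((-a ^ 2 * trig true (a * x) - 2 * x * (a * trigD true (a * x)) : ℝ) : 𝕜))
      = fun x : ℝ => -(a : 𝕜) ^ 2 * ((trig true (a * x) : ℝ) : 𝕜)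
        - 2 * (a : 𝕜) * ((x : 𝕜) * ((trigD true (a * x) : ℝ) : 𝕜)) := by
    funext x; push_cast; ring
  have m1 := (bddC1_trig (𝕜 := 𝕜) true a).memLp (m := m)
  have m2 := memLp_trigX (𝕜 := 𝕜) (m := m) true a
  have key := h.inner_eq (w := fun x => a * trigD true (a * x))
    (w' := fun x => -a ^ 2 * trig true (a * x)) (C := a ^ 2)
    (by
      simp only [trigD, if_true]
      fun_prop)
    (fun x => by
      refine (((hasDerivAt_trigD true (a * x)).comp x
        ((hasDerivAt_id x).const_mul a)).const_mul a).congr_deriv ?_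
      ring)
    (fun x => by
      simp only [trigD, if_true]
      rw [abs_mul, abs_neg]
      have := Real.abs_sin_le_abs (x := a * x)
      calc |a| * |Real.sin (a * x)| ≤ |a| * |a * x| := by gcongr
        _ = a ^ 2 * |x| := by rw [abs_mul, ← mul_assoc, abs_mul_abs_self, sq])
    (by rw [← e]; exact (bddC1_trigD true a).memLp)
    (by rw [e2]; exact (m1.const_mul _).sub (m2.const_mul _))
  rw [e, key, e2, toE_sub (m1.const_mul _) (m2.const_mul _), toE_const_mul _ m1, toE_const_mul _ m2]
  congr 2
  rw [trigL, smul_sub, smul_smul, smul_smul]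
  congr 2
  ring

/-- Weakly differentiable functions are approximated by smooth ones in the norm of `H¹_μ`. -/
lemma IsWeakDeriv.exists_seq {u v : EdgeL2 𝕜 m} (h : IsWeakDeriv u v) :
    ∃ w w' : ℕ → ℝ → 𝕜, (∀ n, BddC1 (w n) (w' n)) ∧
      Tendsto (fun n => toE m (w n)) atTop (𝓝 u) ∧
      Tendsto (fun n => toE m (w' n)) atTop (𝓝 v) := by
  -- The graph of the derivative on `BddC1` functions. Density in `H¹_μ` is shown without
  -- mollifiers: project `(u, v)` orthogonally onto the closure of this graph and show that the
  -- remainder `r` vanishes.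
  let K : Submodule 𝕜 (WithLp 2 (EdgeL2 𝕜 m × EdgeL2 𝕜 m)) :=
    { carrier := {q | ∃ w w' : ℝ → 𝕜, BddC1 w w' ∧ q = WithLp.toLp 2 (toE m w, toE m w')}
      add_mem' := by
        rintro _ _ ⟨w, w', hw, rfl⟩ ⟨z, z', hz, rfl⟩
        refine ⟨_, _, hw.add hz, ?_⟩
        rw [toE_add hw.memLp hz.memLp, toE_add hw.memLp' hz.memLp']
        rfl
      zero_mem' := by
        refine ⟨_, _, BddC1.zero, ?_⟩
        have : toE m (fun _ => (0 : 𝕜)) = 0 := by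
          refine toE_eq BddC1.zero.memLp ?_
          exact Lp.coeFn_zero _ _ _
        rw [this]
        rfl
      smul_mem' := by
        rintro c _ ⟨w, w', hw, rfl⟩
        refine ⟨_, _, hw.const_mul c, ?_⟩
        rw [toE_const_mul _ hw.memLp, toE_const_mul _ hw.memLp']
        rfl }
  have hseq : ∀ q ∈ K.topologicalClosure, ∃ w w' : ℕ → ℝ → 𝕜, (∀ n, BddC1 (w n) (w' n)) ∧
      Tendsto (fun n => toE m (w n)) atTop (𝓝 q.fst) ∧
      Tendsto (fun n => toE m (w' n)) atTop (𝓝 q.snd) := by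
    intro q hq
    obtain ⟨x, hx, hxq⟩ := mem_closure_iff_seq_limit.1 hq
    choose w w' hw hxw using hx
    have hc := (WithLp.prod_continuous_ofLp 2 (EdgeL2 𝕜 m) (EdgeL2 𝕜 m)).tendsto q |>.comp hxq
    refine ⟨w, w', hw, ?_, ?_⟩
    · refine ((continuous_fst.tendsto _).comp hc).congr fun n => ?_
      simp [hxw]
    · refine ((continuous_snd.tendsto _).comp hc).congr fun n => ?_
      simp [hxw]
  have hproj := K.topologicalClosure.exists_add_mem_mem_orthogonal (WithLp.toLp 2 (u, v))
  obtain ⟨p, hp, r, hr, hpr⟩ := hproj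
  have hpw : IsWeakDeriv p.fst p.snd := by
    obtain ⟨w, w', hw, h1, h2⟩ := hseq p hp
    exact IsWeakDeriv.of_tendsto (fun n => (hw n).isWeakDeriv) h1 h2
  have e1 : r.fst = u - p.fst := by
    have := congrArg WithLp.fst hpr
    simp at this
    rw [this]; abel
  have e2 : r.snd = v - p.snd := by
    have := congrArg WithLp.snd hpr
    simp at this
    rw [this]; abel
  have hrw : IsWeakDeriv r.fst r.snd := by
    rw [e1, e2]; exact h.sub hpw
  -- `r` is itself a function with its weak derivative, orthogonal to every `(e_a, e_a')` with `e_a`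
  -- the cosine. Moving the derivative over, its first component is orthogonal to every `e_a - 2 L
  -- e_a`.
  have hr1 : r.fst = 0 := by
    refine eq_zero_of_inner_trigE_sub_eq_zero true fun a => ?_
    have h1 := (Submodule.mem_orthogonal _ _).1 hr (WithLp.toLp 2 (trigE 𝕜 m true a,
      toE m fun x : ℝ => (a : 𝕜) * ((trigD true (a * x) : ℝ) : 𝕜)))
      (K.le_topologicalClosure ⟨_, _, bddC1_trig true a, rfl⟩)
    rw [WithLp.prod_inner_apply] at h1
    simp only at h1
    rw [inner_sub_left, sub_eq_add_neg, ← hrw.inner_trig_eq]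
    exact h1
  have hr2 : r.snd = 0 := by
    rw [hr1] at hrw
    exact hrw.unique isWeakDeriv_zero
  obtain ⟨w, w', hw, h1, h2⟩ := hseq p hp
  refine ⟨w, w', hw, ?_, ?_⟩
  · rwa [← sub_eq_zero.1 (e1.symm.trans hr1)] at h1
  · rwa [← sub_eq_zero.1 (e2.symm.trans hr2)] at h2

end

section

variable {𝕜 : Type*} [RCLike 𝕜] {m : ℕ}

/-! ### Test functions with boundary conditions -/

/-- From `2 ‖x u‖² = ‖u‖² + 2 Re ⟨x u, u'⟩` and Young's inequality. Thus multiplication by `x` maps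
`H¹_μ` boundedly to `L²_μ`, so `x f'` causes no extra condition on the domain. -/
lemma BddC1.norm_mul_sq_le {u u' : ℝ → 𝕜} (h : BddC1 u u') :
    ‖toE m fun x : ℝ => (x : 𝕜) * u x‖ ^ 2 ≤ ‖toE m u‖ ^ 2 + ‖toE m u'‖ ^ 2 := by
  have h1 := h.two_mul_re_inner (m := m)
  have h2 := re_inner_le_norm (𝕜 := 𝕜) (toE m fun x : ℝ => (x : 𝕜) * u x) (toE m u')
  nlinarith [sq_nonneg (‖toE m fun x : ℝ => (x : 𝕜) * u x‖ - ‖toE m u'‖)]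

lemma toE_trig_deriv (s : Bool) (a : ℝ) :
    toE m (fun x : ℝ => -(a : 𝕜) ^ 2 * ((trig s (a * x) : ℝ) : 𝕜))
      - (2 : 𝕜) • toE m (fun x : ℝ => (x : 𝕜) * ((a : 𝕜) * ((trigD s (a * x) : ℝ) : 𝕜)))
      = (2 : 𝕜) • trigL 𝕜 m s a := by
  have e : (fun x : ℝ => (x : 𝕜) * ((a : 𝕜) * ((trigD s (a * x) : ℝ) : 𝕜)))
      = fun x : ℝ => (a : 𝕜) * ((x : 𝕜) * ((trigD s (a * x) : ℝ) : 𝕜)) := by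
    funext x; ring
  rw [e, toE_const_mul _ (bddC1_trig s a).memLp, toE_const_mul _ (memLp_trigX s a), trigL, smul_sub,
    smul_smul, smul_smul, smul_smul, mul_neg, mul_div_cancel₀ _ two_ne_zero]
  rfl

/-- `h` is bounded with bounded derivatives `h'` and `h''` and satisfies the boundary
condition. -/
structure TestFun (s : Bool) (h h' h'' : ℝ → 𝕜) : Prop where
  fst : BddC1 h h'
  snd : BddC1 h' h''
  bc : if s then h' 0 = 0 else h 0 = 0

/-- The image of a test function under `∂² - 2 x ∂`. -/
def twoL (m : ℕ) (h' h'' : ℝ → 𝕜) : EdgeL2 𝕜 m :=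
  toE m h'' - (2 : 𝕜) • toE m fun x : ℝ => (x : 𝕜) * h' x

/-! ### Symmetry and a priori estimates for `∂² - 2x∂` with boundary condition. -/

namespace TestFun

variable {s : Bool} {h h' h'' k k' k'' : ℝ → 𝕜}

lemma add (H : TestFun s h h' h'') (K : TestFun s k k' k'') :
    TestFun s (fun x => h x + k x) (fun x => h' x + k' x) (fun x => h'' x + k'' x) := by
  refine ⟨H.fst.add K.fst, H.snd.add K.snd, ?_⟩
  have h1 := H.bc
  have h2 := K.bc
  cases s <;> simp_all

lemma const_mul (H : TestFun s h h' h'') (c : 𝕜) :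
    TestFun s (fun x => c * h x) (fun x => c * h' x) (fun x => c * h'' x) := by
  refine ⟨H.fst.const_mul c, H.snd.const_mul c, ?_⟩
  have h1 := H.bc
  cases s <;> simp_all

lemma sub (H : TestFun s h h' h'') (K : TestFun s k k' k'') :
    TestFun s (fun x => h x - k x) (fun x => h' x - k' x) (fun x => h'' x - k'' x) := by
  simpa [sub_eq_add_neg] using H.add (K.const_mul (-1))

lemma zero : TestFun s (fun _ => (0 : 𝕜)) (fun _ => 0) (fun _ => 0) :=
  ⟨BddC1.zero, BddC1.zero, by simp⟩

lemma trig (s : Bool) (a : ℝ) :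
    TestFun s (fun x : ℝ => ((StarOU.trig s (a * x) : ℝ) : 𝕜))
      (fun x : ℝ => (a : 𝕜) * ((trigD s (a * x) : ℝ) : 𝕜))
      (fun x : ℝ => -(a : 𝕜) ^ 2 * (StarOU.trig s (a * x) : ℝ)) :=
  ⟨bddC1_trig s a, bddC1_trigD s a, by cases s <;> simp [StarOU.trig, trigD]⟩

/-- The boundary term is a multiple of `conj (h 0) * k' 0`; one of its factors vanishes under either
boundary condition. -/
lemma inner_twoL (H : TestFun s h h' h'') (K : TestFun s k k' k'') :
    inner 𝕜 (toE m h) (twoL m k' k'') = -inner 𝕜 (toE m h') (toE m k') := by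
  have h1 := H.fst.inner_add_inner (m := m) K.snd
  have h2 : (starRingEnd 𝕜) (h 0) * k' 0 = 0 := by
    have h3 := H.bc
    have h4 := K.bc
    cases s <;> simp_all
  rw [h2, smul_zero, neg_zero] at h1
  exact eq_neg_of_add_eq_zero_left h1

lemma inner_sub_twoL (H : TestFun s h h' h'') (K : TestFun s k k' k'') :
    inner 𝕜 (toE m h) (toE m k - twoL m k' k'') = inner 𝕜 (toE m h - twoL m h' h'') (toE m k) := by
  rw [inner_sub_right, inner_sub_left, H.inner_twoL K, ← inner_conj_symm (twoL m h' h''),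
    K.inner_twoL H, map_neg, inner_conj_symm]

lemma twoL_sub (H : TestFun s h h' h'') (K : TestFun s k k' k'') :
    twoL m (fun x => h' x - k' x) (fun x => h'' x - k'' x) = twoL m h' h'' - twoL m k' k'' := by
  simp only [twoL, mul_sub]
  rw [toE_sub H.snd.memLp' K.snd.memLp', toE_sub H.snd.memLp_mul K.snd.memLp_mul, smul_sub]
  abel

/-- The energy identity `⟨h, h - 2 L h⟩ = ‖h‖² + ‖h'‖²` followed by Cauchy–Schwarz. -/
lemma norm_sq_add_le (H : TestFun s h h' h'') :
    ‖toE m h‖ ^ 2 + ‖toE m h'‖ ^ 2 ≤ ‖toE m h‖ * ‖toE m h - twoL m h' h''‖ := by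
  have h1 := re_inner_le_norm (𝕜 := 𝕜) (toE m h) (toE m h - twoL m h' h'')
  rw [inner_sub_right, H.inner_twoL H, inner_self_eq_norm_sq_to_K, inner_self_eq_norm_sq_to_K,
    sub_neg_eq_add] at h1
  norm_cast at h1

lemma norm_le (H : TestFun s h h' h'') : ‖toE m h‖ ≤ ‖toE m h - twoL m h' h''‖ := by
  have h1 := H.norm_sq_add_le (m := m)
  by_contra! h2
  nlinarith [norm_nonneg (toE m h), norm_nonneg (toE m h - twoL m h' h''), sq_nonneg ‖toE m h'‖]

lemma norm_deriv_le (H : TestFun s h h' h'') : ‖toE m h'‖ ≤ ‖toE m h - twoL m h' h''‖ := by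
  have h1 := H.norm_sq_add_le (m := m)
  have h2 := H.norm_le (m := m)
  refine le_of_sq_le_sq ?_ (norm_nonneg _)
  nlinarith [norm_nonneg (toE m h), norm_nonneg (toE m h - twoL m h' h'')]

/-- Expand the square of `h'' - 2 x h'`: by `BddC1.two_mul_re_inner` for `h'`, the cross term
cancels `4 ‖x h'‖²` and leaves `2 ‖h'‖²`. This is what controls `h''`. -/
lemma norm_twoL_sq (H : TestFun s h h' h'') :
    ‖twoL m h' h''‖ ^ 2 = ‖toE m h''‖ ^ 2 + 2 * ‖toE m h'‖ ^ 2 := by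
  have h1 := H.snd.two_mul_re_inner (m := m)
  have h2 : ‖(2 : 𝕜) • toE m fun x : ℝ => (x : 𝕜) * h' x‖
      = 2 * ‖toE m fun x : ℝ => (x : 𝕜) * h' x‖ := by
    rw [norm_smul, RCLike.norm_ofNat]
  rw [twoL, norm_sub_sq (𝕜 := 𝕜), h2, ← inner_conj_symm, RCLike.conj_re, inner_smul_left]
  have h3 : RCLike.re ((starRingEnd 𝕜) (2 : 𝕜) * inner 𝕜 (toE m fun x : ℝ => (x : 𝕜) * h' x)
      (toE m h'')) = 2 * RCLike.re (inner 𝕜 (toE m fun x : ℝ => (x : 𝕜) * h' x) (toE m h'')) := by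
    rw [show (2 : 𝕜) = ((2 : ℝ) : 𝕜) by norm_cast, RCLike.conj_ofReal, RCLike.re_ofReal_mul]
  rw [h3]
  nlinarith

lemma norm_deriv_deriv_le (H : TestFun s h h' h'') :
    ‖toE m h''‖ ≤ 2 * ‖toE m h - twoL m h' h''‖ := by
  have h1 := H.norm_twoL_sq (m := m)
  have h2 := H.norm_le (m := m)
  have h3 : ‖twoL m h' h''‖ ≤ ‖toE m h‖ + ‖toE m h - twoL m h' h''‖ := by
    have := norm_sub_le (toE m h) (toE m h - twoL m h' h'')
    rwa [sub_sub_cancel] at this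
  have h4 : ‖toE m h''‖ ≤ ‖twoL m h' h''‖ :=
    le_of_sq_le_sq (by nlinarith [sq_nonneg ‖toE m h'‖]) (norm_nonneg _)
  linarith

end TestFun

lemma cauchySeq_of_dist_le {E F : Type*} [PseudoMetricSpace E] [PseudoMetricSpace F] {u : ℕ → E}
    {v : ℕ → F} (hv : CauchySeq v) {C : ℝ} (hC : 0 < C)
    (h : ∀ k l, dist (u k) (u l) ≤ C * dist (v k) (v l)) : CauchySeq u := by
  rw [Metric.cauchySeq_iff] at *
  intro ε hε
  obtain ⟨N, hN⟩ := hv (ε / C) (by positivity)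
  refine ⟨N, fun k hk l hl => (h k l).trans_lt ?_⟩
  rw [← lt_div_iff₀' hC]
  exact hN k hk l hl

/-- The range of `1 - (∂² - 2 x ∂)` on test functions. -/
def testRange (𝕜 : Type*) [RCLike 𝕜] (m : ℕ) (s : Bool) : Submodule 𝕜 (EdgeL2 𝕜 m) where
  carrier := {v | ∃ h h' h'' : ℝ → 𝕜, TestFun s h h' h'' ∧ v = toE m h - twoL m h' h''}
  add_mem' := by
    rintro _ _ ⟨h, h', h'', H, rfl⟩ ⟨k, k', k'', K, rfl⟩
    refine ⟨_, _, _, H.add K, ?_⟩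
    simp only [twoL, mul_add]
    rw [toE_add H.fst.memLp K.fst.memLp, toE_add H.snd.memLp' K.snd.memLp',
      toE_add H.snd.memLp_mul K.snd.memLp_mul, smul_add]
    abel
  zero_mem' := by
    refine ⟨_, _, _, TestFun.zero, ?_⟩
    have : toE m (fun _ => (0 : 𝕜)) = 0 := toE_eq BddC1.zero.memLp (Lp.coeFn_zero _ _ _)
    simp [twoL, this]
  smul_mem' := by
    rintro c _ ⟨h, h', h'', H, rfl⟩
    refine ⟨_, _, _, H.const_mul c, ?_⟩
    simp only [twoL, mul_left_comm _ c]
    rw [toE_const_mul _ H.fst.memLp, toE_const_mul _ H.snd.memLp',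
      toE_const_mul _ H.snd.memLp_mul, smul_comm (2 : 𝕜) c, smul_sub, smul_sub]

/-! ### Boundary values -/

/-- The boundary value at `0` of a function `u` with weak derivative `v`. -/
def trace (u v : EdgeL2 𝕜 m) : 𝕜 :=
  inner 𝕜 (pairE 𝕜 m ((Ioc 0 1).indicator fun _ => 1)) u
    + inner 𝕜 (pairE 𝕜 m ((Ioc 0 1).indicator fun x => x - 1)) v

lemma tendsto_trace {u v : ℕ → EdgeL2 𝕜 m} {f g : EdgeL2 𝕜 m} (hu : Tendsto u atTop (𝓝 f))
    (hv : Tendsto v atTop (𝓝 g)) : Tendsto (fun n => trace (u n) (v n)) atTop (𝓝 (trace f g)) :=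
  (tendsto_const_nhds.inner hu).add (tendsto_const_nhds.inner hv)

lemma exists_subseq_ae {u : ℕ → EdgeL2 𝕜 m} {f : EdgeL2 𝕜 m} (h : Tendsto u atTop (𝓝 f)) :
    ∃ ns : ℕ → ℕ, StrictMono ns ∧
      ∀ᵐ x ∂edgeMeasure m, Tendsto (fun n => u (ns n) x) atTop (𝓝 (f x)) :=
  (tendstoInMeasure_of_tendsto_Lp h).exists_seq_tendsto_ae

/-- Convergence in `H¹_μ` makes `x w_n` a Cauchy sequence by `norm_mul_sq_le`; its limit is
identified pointwise along a subsequence converging almost everywhere. -/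
lemma exists_tendsto_mul {w w' : ℕ → ℝ → 𝕜} (hw : ∀ n, BddC1 (w n) (w' n)) {u v : EdgeL2 𝕜 m}
    (hu : Tendsto (fun n => toE m (w n)) atTop (𝓝 u))
    (hv : Tendsto (fun n => toE m (w' n)) atTop (𝓝 v)) :
    ∃ z : EdgeL2 𝕜 m, Tendsto (fun n => toE m fun x : ℝ => (x : 𝕜) * w n x) atTop (𝓝 z) ∧
      z =ᵐ[edgeMeasure m] fun x : ℝ => (x : 𝕜) * u x := by
  have hcauchy : CauchySeq fun n => toE m fun x : ℝ => (x : 𝕜) * w n x := by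
    rw [Metric.cauchySeq_iff]
    intro ε hε
    obtain ⟨N, hN⟩ := Metric.cauchySeq_iff.1 hu.cauchySeq (ε / 2) (by linarith)
    obtain ⟨M, hM⟩ := Metric.cauchySeq_iff.1 hv.cauchySeq (ε / 2) (by linarith)
    refine ⟨max N M, fun k hk l hl => ?_⟩
    have h1 := hN k (le_of_max_le_left hk) l (le_of_max_le_left hl)
    have h2 := hM k (le_of_max_le_right hk) l (le_of_max_le_right hl)
    have h3 := ((hw k).sub (hw l)).norm_mul_sq_le (m := m)
    simp only [mul_sub] at h3
    rw [toE_sub (hw k).memLp_mul (hw l).memLp_mul, toE_sub (hw k).memLp (hw l).memLp,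
      toE_sub (hw k).memLp' (hw l).memLp', ← dist_eq_norm, ← dist_eq_norm, ← dist_eq_norm] at h3
    refine lt_of_pow_lt_pow_left₀ 2 hε.le (h3.trans_lt ?_)
    nlinarith [dist_nonneg (x := toE m (w k)) (y := toE m (w l)),
      dist_nonneg (x := toE m (w' k)) (y := toE m (w' l))]
  obtain ⟨z, hz⟩ := cauchySeq_tendsto_of_complete hcauchy
  refine ⟨z, hz, ?_⟩
  obtain ⟨ns, hns, h1⟩ := exists_subseq_ae hu
  obtain ⟨ks, hks, h2⟩ := exists_subseq_ae (hz.comp hns.tendsto_atTop)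
  have e1 : ∀ᵐ x ∂edgeMeasure m, ∀ n, toE m (w n) x = w n x :=
    ae_all_iff.2 fun n => coeFn_toE (hw n).memLp
  have e2 : ∀ᵐ x ∂edgeMeasure m, ∀ n, toE m (fun x : ℝ => (x : 𝕜) * w n x) x = (x : 𝕜) * w n x :=
    ae_all_iff.2 fun n => coeFn_toE (hw n).memLp_mul
  filter_upwards [h1, h2, e1, e2] with x h1 h2 e1 e2
  refine tendsto_nhds_unique h2 ?_
  refine ((h1.comp hks.tendsto_atTop).const_mul (x : 𝕜)).congr fun n => ?_
  simp only [Function.comp, e1, e2]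

lemma HasBoundaryValue.add {u v : EdgeL2 𝕜 m} {c d : 𝕜} (hc : HasBoundaryValue u c)
    (hd : HasBoundaryValue v d) : HasBoundaryValue (u + v) (c + d) := by
  obtain ⟨p, hp, hup, rfl⟩ := hc
  obtain ⟨q, hq, hvq, rfl⟩ := hd
  refine ⟨fun x => p x + q x, hp.add hq, ?_, rfl⟩
  filter_upwards [Lp.coeFn_add u v, hup, hvq] with x h1 h2 h3
  rw [h1, Pi.add_apply, h2, h3]

lemma HasBoundaryValue.smul {u : EdgeL2 𝕜 m} {c : 𝕜} (r : 𝕜) (hc : HasBoundaryValue u c) :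
    HasBoundaryValue (r • u) (r * c) := by
  obtain ⟨p, hp, hup, rfl⟩ := hc
  refine ⟨fun x => r * p x, continuousOn_const.mul hp, ?_, rfl⟩
  filter_upwards [Lp.coeFn_smul r u, hup] with x h1 h2
  rw [h1, Pi.smul_apply, h2, smul_eq_mul]

/-- The Neumann (`s = true`) or Dirichlet (`s = false`) boundary condition. -/
def BoundaryCond (s : Bool) (f f' : EdgeL2 𝕜 m) : Prop :=
  if s then HasBoundaryValue f' 0 else HasBoundaryValue f 0

variable [NeZero m]

lemma inner_pairE_indicator_toE {φ : ℝ → ℝ} (hφ : Continuous φ) (b : ℝ) {u : ℝ → 𝕜}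
    (hu : MemLp u 2 (edgeMeasure m)) :
    inner 𝕜 (pairE 𝕜 m ((Ioc 0 b).indicator φ)) (toE m u) = ∫ x in Ioc 0 b, φ x • u x := by
  rw [inner_pairE_indicator hφ]
  refine integral_congr_ae (ae_restrict_of_ae_restrict_of_subset Ioc_subset_Ioi_self ?_)
  filter_upwards [ae_edge_iff.1 (coeFn_toE hu)] with x hx
  rw [hx]

/-- Integrate `((x - 1) u)' = u + (x - 1) u'` over `[0, 1]`: the weight vanishes at `1` and equals
`-1` at `0`. So `trace` is the point value at `0`, written in a form continuous in `H¹_μ`. -/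
lemma BddC1.trace_eq {u u' : ℝ → 𝕜} (h : BddC1 u u') : trace (toE m u) (toE m u') = u 0 := by
  have hc := h.continuous
  have hc' := h.continuous'
  rw [trace, inner_pairE_indicator_toE continuous_const 1 h.memLp,
    inner_pairE_indicator_toE (by fun_prop) 1 h.memLp',
    ← intervalIntegral.integral_of_le zero_le_one, ← intervalIntegral.integral_of_le zero_le_one,
    ← intervalIntegral.integral_add (Continuous.intervalIntegrable (by fun_prop) _ _)
      (Continuous.intervalIntegrable (by fun_prop) _ _)]
  have hd : ∀ x ∈ uIcc (0 : ℝ) 1,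
      HasDerivAt (fun x => (x - 1) • u x) ((1 : ℝ) • u x + (x - 1) • u' x) x := fun x _ => by
    rw [add_comm]
    exact ((hasDerivAt_id x).sub_const 1).smul (h.hasDerivAt x)
  rw [intervalIntegral.integral_eq_sub_of_hasDerivAt hd
    (Continuous.intervalIntegrable (by fun_prop) _ _)]
  simp

lemma BddC1.eq_add_inner {u u' : ℝ → 𝕜} (h : BddC1 u u') {x : ℝ} (hx : 0 ≤ x) :
    u x = u 0 + inner 𝕜 (pairE 𝕜 m ((Ioc 0 x).indicator fun _ => 1)) (toE m u') := by
  rw [inner_pairE_indicator_toE continuous_const x h.memLp', ← intervalIntegral.integral_of_le hx]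
  simp only [one_smul]
  rw [intervalIntegral.integral_eq_sub_of_hasDerivAt (fun x _ => h.hasDerivAt x)
    (h.continuous'.intervalIntegrable _ _)]
  ring

/-- The continuous representative is `x ↦ trace u v + ∫_0^x v`. The formula holds for the smooth
approximants and passes to the limit almost everywhere along a subsequence. -/
lemma IsWeakDeriv.hasBoundaryValue {u v : EdgeL2 𝕜 m} (h : IsWeakDeriv u v) :
    HasBoundaryValue u (trace u v) := by
  obtain ⟨w, w', hw, hu, hv⟩ := h.exists_seq
  refine ⟨fun x => trace u v + ∫ y in Ioc 0 x, v y, ?_, ?_, by simp⟩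
  · refine continuousOn_const.add fun x hx => ?_
    have h1 := intervalIntegral.continuousOn_primitive (f := v) (μ := volume) (a := 0) (b := x + 1)
      ((integrableOn_Icc_iff_integrableOn_Ioc enorm_ne_top).2 (integrableOn_Ioc v _))
    refine (h1 x ⟨hx, by linarith⟩).mono_of_mem_nhdsWithin ?_
    rw [← Ici_inter_Iic]
    exact inter_mem_nhdsWithin _ (Iic_mem_nhds (by linarith))
  · obtain ⟨ns, hns, hae⟩ := exists_subseq_ae hu
    have hw_ae : ∀ᵐ x ∂edgeMeasure m, ∀ n, toE m (w n) x = w n x :=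
      ae_all_iff.2 fun n => coeFn_toE (hw n).memLp
    have hpos : ∀ᵐ x ∂edgeMeasure m, 0 < x := by
      rw [ae_edge_iff, ae_restrict_iff' measurableSet_Ioi]
      exact ae_of_all _ fun x hx => hx
    filter_upwards [hae, hw_ae, hpos] with x h1 h2 h3
    refine tendsto_nhds_unique h1 ?_
    have h4 := (tendsto_trace hu hv).comp hns.tendsto_atTop
    have h5 := (tendsto_const_nhds (x := pairE 𝕜 m ((Ioc 0 x).indicator fun _ => 1))).inner
      (𝕜 := 𝕜) (hv.comp hns.tendsto_atTop)
    rw [inner_pairE_indicator continuous_const] at h5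
    simp only [one_smul] at h5
    refine (h4.add h5).congr fun n => ?_
    simp only [Function.comp]
    rw [h2, (hw (ns n)).trace_eq, ← (hw (ns n)).eq_add_inner h3.le]

lemma HasBoundaryValue.unique {u : EdgeL2 𝕜 m} {c d : 𝕜} (hc : HasBoundaryValue u c)
    (hd : HasBoundaryValue u d) : c = d := by
  obtain ⟨v, hv, huv, rfl⟩ := hc
  obtain ⟨w, hw, huw, rfl⟩ := hd
  have h1 : v =ᵐ[volume.restrict (Ici 0)] w := by
    rw [← Measure.restrict_congr_set Ioi_ae_eq_Ici]
    exact ae_edge_iff.1 (huv.symm.trans huw)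
  exact Measure.eqOn_of_ae_eq h1 hv hw (by rw [interior_Ici, closure_Ioi]) self_mem_Ici

/-! ### The domain of the generator on the half-line -/

/-- Integrate by parts twice, on approximants of `f'` (`k1`) and of `f` (`k2`), and let the
approximation converge. The boundary terms contain `e_a(0) f'(0)` and `e_a'(0) f(0)`. -/
lemma isTrigAdjoint_of_isWeakDeriv {s : Bool} {f f' f'' : EdgeL2 𝕜 m} (h : IsWeakDeriv f f')
    (h' : IsWeakDeriv f' f'') (hb : BoundaryCond s f f') :
    ∃ z : EdgeL2 𝕜 m, (z =ᵐ[edgeMeasure m] fun x : ℝ => (x : 𝕜) * f' x) ∧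
      IsTrigAdjoint s f ((1 / 2 : 𝕜) • f'' - z) := by
  obtain ⟨w, w', hw, hw1, hw2⟩ := h'.exists_seq
  obtain ⟨y, y', hy, hy1, hy2⟩ := h.exists_seq
  obtain ⟨z, hz, hzae⟩ := exists_tendsto_mul hw hw1 hw2
  refine ⟨z, hzae, fun a => ?_⟩
  have tw : Tendsto (fun n => w n 0) atTop (𝓝 (trace f' f'')) :=
    (tendsto_trace hw1 hw2).congr fun n => (hw n).trace_eq
  have ty : Tendsto (fun n => y n 0) atTop (𝓝 (trace f f')) :=
    (tendsto_trace hy1 hy2).congr fun n => (hy n).trace_eq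
  have k1 : inner 𝕜 (trigE 𝕜 m s a) (f'' - (2 : 𝕜) • z)
      + inner 𝕜 (toE m fun x : ℝ => (a : 𝕜) * ((trigD s (a * x) : ℝ) : 𝕜)) f'
      = -(density m 0 • ((starRingEnd 𝕜) ((trig s (a * 0) : ℝ) : 𝕜) * trace f' f'')) := by
    refine tendsto_nhds_unique ((tendsto_const_nhds.inner (hw2.sub (hz.const_smul (2 : 𝕜)))).add
      (tendsto_const_nhds.inner hw1)) (((tw.const_mul _).const_smul _).neg.congr fun n => ?_)
    exact ((bddC1_trig s a).inner_add_inner (hw n)).symm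
  have k2 : inner 𝕜 f ((2 : 𝕜) • trigL 𝕜 m s a)
      + inner 𝕜 f' (toE m fun x : ℝ => (a : 𝕜) * ((trigD s (a * x) : ℝ) : 𝕜))
      = -(density m 0 • ((starRingEnd 𝕜) (trace f f') *
        ((a : 𝕜) * ((trigD s (a * 0) : ℝ) : 𝕜)))) := by
    refine tendsto_nhds_unique ((hy1.inner tendsto_const_nhds).add
      (hy2.inner tendsto_const_nhds)) ((((((RCLike.continuous_conj.tendsto _).comp ty).mul_const
        _).const_smul (density m 0)).neg).congr fun n => ?_)
    rw [← toE_trig_deriv]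
    exact ((hy n).inner_add_inner (bddC1_trigD s a)).symm
  -- For sines `e_a(0) = 0` and `f(0) = 0` by the Dirichlet condition; for cosines `f'(0) = 0` by
  -- the Neumann condition and `e_a'(0) = 0`.
  have r1 : (starRingEnd 𝕜) ((trig s (a * 0) : ℝ) : 𝕜) * trace f' f'' = 0 := by
    cases s
    · simp [trig]
    · rw [h'.hasBoundaryValue.unique (by simpa [BoundaryCond] using hb), mul_zero]
  have r2 : (starRingEnd 𝕜) (trace f f') * ((a : 𝕜) * ((trigD s (a * 0) : ℝ) : 𝕜)) = 0 := by
    cases s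
    · rw [h.hasBoundaryValue.unique (by simpa [BoundaryCond] using hb), map_zero, zero_mul]
    · simp [trigD]
  rw [r1, smul_zero, neg_zero] at k1
  rw [r2, smul_zero, neg_zero] at k2
  have k3 := congrArg (starRingEnd 𝕜) k2
  rw [map_add, inner_conj_symm, inner_conj_symm, map_zero, inner_smul_left] at k3
  have h2 : (starRingEnd 𝕜) (2 : 𝕜) = 2 := by
    exact_mod_cast RCLike.conj_ofReal (K := 𝕜) 2
  rw [h2] at k3
  rw [inner_sub_right, inner_smul_right] at k1 ⊢
  linear_combination (1 / 2 : 𝕜) * k1 - (1 / 2 : 𝕜) * k3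

/-- The trigonometric functions are themselves test functions, so the range already contains the
total family `e_a - 2 L e_a`. -/
lemma mem_closure_testRange (s : Bool) (u : EdgeL2 𝕜 m) :
    u ∈ closure (testRange 𝕜 m s : Set (EdgeL2 𝕜 m)) := by
  have : (testRange 𝕜 m s).topologicalClosure = ⊤ := by
    rw [Submodule.topologicalClosure_eq_top_iff, Submodule.eq_bot_iff]
    intro u hu
    refine eq_zero_of_inner_trigE_sub_eq_zero s fun a => ?_
    refine (Submodule.mem_orthogonal _ _).1 hu _ ⟨_, _, _, TestFun.trig s a, ?_⟩
    rw [twoL, toE_trig_deriv]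
    rfl
  rw [← Submodule.topologicalClosure_coe, this]
  trivial

/-- Regularity: `h - 2 L h = f - 2 g` has a strong solution by the density of `testRange` and the a
priori estimates, and the totality of `e_a - 2 L e_a` identifies it with `f`. -/
lemma exists_isWeakDeriv_of_isTrigAdjoint {s : Bool} {f g : EdgeL2 𝕜 m}
    (hfg : IsTrigAdjoint s f g) :
    ∃ f' f'' z : EdgeL2 𝕜 m, IsWeakDeriv f f' ∧ IsWeakDeriv f' f'' ∧ BoundaryCond s f f' ∧
      (z =ᵐ[edgeMeasure m] fun x : ℝ => (x : 𝕜) * f' x) ∧ g = (1 / 2 : 𝕜) • f'' - z := by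
  obtain ⟨v, hv, hlim⟩ := mem_closure_iff_seq_limit.1
    (mem_closure_testRange s (f - (2 : 𝕜) • g))
  choose h h' h'' H hvH using hv
  have hd : ∀ k l, dist (v k) (v l) = ‖toE m (fun x => h k x - h l x)
      - twoL m (fun x => h' k x - h' l x) (fun x => h'' k x - h'' l x)‖ := fun k l => by
    rw [(H k).twoL_sub (H l), toE_sub (H k).fst.memLp (H l).fst.memLp, dist_eq_norm, hvH, hvH]
    congr 1
    abel
  have c0 : CauchySeq fun n => toE m (h n) :=
    cauchySeq_of_dist_le hlim.cauchySeq one_pos fun k l => by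
      rw [one_mul, hd, dist_eq_norm, ← toE_sub (H k).fst.memLp (H l).fst.memLp]
      exact ((H k).sub (H l)).norm_le
  have c1 : CauchySeq fun n => toE m (h' n) :=
    cauchySeq_of_dist_le hlim.cauchySeq one_pos fun k l => by
      rw [one_mul, hd, dist_eq_norm, ← toE_sub (H k).snd.memLp (H l).snd.memLp]
      exact ((H k).sub (H l)).norm_deriv_le
  have c2 : CauchySeq fun n => toE m (h'' n) :=
    cauchySeq_of_dist_le hlim.cauchySeq two_pos fun k l => by
      rw [hd, dist_eq_norm, ← toE_sub (H k).snd.memLp' (H l).snd.memLp']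
      exact ((H k).sub (H l)).norm_deriv_deriv_le
  obtain ⟨f₀, l0⟩ := cauchySeq_tendsto_of_complete c0
  obtain ⟨f₁, l1⟩ := cauchySeq_tendsto_of_complete c1
  obtain ⟨f₂, l2⟩ := cauchySeq_tendsto_of_complete c2
  obtain ⟨z, lz, hz⟩ := exists_tendsto_mul (fun n => (H n).snd) l1 l2
  have h2 : (starRingEnd 𝕜) (2 : 𝕜) = 2 := by
    exact_mod_cast RCLike.conj_ofReal (K := 𝕜) 2
  -- By symmetry of `L` on test functions in the limit, and by the adjoint relation for `f`, the
  -- products of `e_a - 2 L e_a` with `f₀` and with `f` both equal `⟨e_a, f - 2 g⟩`.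
  have hf : f = f₀ := by
    rw [← sub_eq_zero]
    refine eq_zero_of_inner_trigE_sub_eq_zero s fun a => ?_
    have e1 : inner 𝕜 (trigE 𝕜 m s a) (f - (2 : 𝕜) • g)
        = inner 𝕜 (trigE 𝕜 m s a - (2 : 𝕜) • trigL 𝕜 m s a) f₀ := by
      refine tendsto_nhds_unique (tendsto_const_nhds.inner hlim)
        ((tendsto_const_nhds.inner l0).congr fun n => ?_)
      rw [hvH, ← toE_trig_deriv]
      exact ((TestFun.trig s a).inner_sub_twoL (H n)).symm
    rw [inner_sub_right, ← e1, inner_sub_right, inner_smul_right, hfg a, inner_sub_left,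
      inner_smul_left, h2, sub_self]
  subst hf
  have hg : f - (2 : 𝕜) • g = f - (f₂ - (2 : 𝕜) • z) := by
    refine tendsto_nhds_unique hlim ((l0.sub (l2.sub (lz.const_smul (2 : 𝕜)))).congr fun n => ?_)
    rw [hvH]; rfl
  refine ⟨f₁, f₂, z, IsWeakDeriv.of_tendsto (fun n => (H n).fst.isWeakDeriv) l0 l1,
    IsWeakDeriv.of_tendsto (fun n => (H n).snd.isWeakDeriv) l1 l2, ?_, hz, ?_⟩
  -- The boundary condition survives because `trace` is continuous along the approximating sequence.
  · have w1 : IsWeakDeriv f f₁ := IsWeakDeriv.of_tendsto (fun n => (H n).fst.isWeakDeriv) l0 l1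
    have w2 : IsWeakDeriv f₁ f₂ := IsWeakDeriv.of_tendsto (fun n => (H n).snd.isWeakDeriv) l1 l2
    cases s
    · have t : trace f f₁ = 0 := by
        refine tendsto_nhds_unique (tendsto_trace l0 l1) (tendsto_const_nhds.congr fun n => ?_)
        rw [(H n).fst.trace_eq]
        simpa using (H n).bc.symm
      simpa [BoundaryCond, t] using w1.hasBoundaryValue
    · have t : trace f₁ f₂ = 0 := by
        refine tendsto_nhds_unique (tendsto_trace l1 l2) (tendsto_const_nhds.congr fun n => ?_)
        rw [(H n).snd.trace_eq]
        simpa using (H n).bc.symm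
      simpa [BoundaryCond, t] using w2.hasBoundaryValue
  · have h3 : (2 : 𝕜) • g = f₂ - (2 : 𝕜) • z := sub_right_injective hg
    have h4 : g = (1 / 2 : 𝕜) • ((2 : 𝕜) • g) := by
      rw [smul_smul]; norm_num
    rw [h4, h3, smul_sub, smul_smul]
    norm_num

end

section

variable {𝕜 : Type*} [RCLike 𝕜] {m : ℕ}

/-! ### Reduction of the star to the half-line -/

lemma HasBoundaryValue.zero : HasBoundaryValue (0 : EdgeL2 𝕜 m) 0 :=
  ⟨fun _ => 0, continuousOn_const, Lp.coeFn_zero _ _ _, rfl⟩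

lemma HasBoundaryValue.sum {u : Fin m → EdgeL2 𝕜 m} {c : Fin m → 𝕜}
    (h : ∀ i, HasBoundaryValue (u i) (c i)) : HasBoundaryValue (∑ i, u i) (∑ i, c i) := by
  classical
  induction (Finset.univ : Finset (Fin m)) using Finset.induction_on with
  | empty => simpa using HasBoundaryValue.zero
  | insert i S hi ih => rw [Finset.sum_insert hi, Finset.sum_insert hi]; exact (h i).add ih

lemma trace_sum (u v : Fin m → EdgeL2 𝕜 m) :
    ∑ i, trace (u i) (v i) = trace (∑ i, u i) (∑ i, v i) := by
  simp only [trace, inner_sum, Finset.sum_add_distrib]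

/-- The mean of a function on the star over the edges. -/
def mean (𝕜 : Type*) [RCLike 𝕜] (m : ℕ) : StarL2 𝕜 m →L[𝕜] EdgeL2 𝕜 m :=
  (m : 𝕜)⁻¹ • ∑ j, PiLp.proj 2 (fun _ : Fin m => EdgeL2 𝕜 m) j

lemma mean_apply (f : StarL2 𝕜 m) : mean 𝕜 m f = (m : 𝕜)⁻¹ • ∑ j, f j := by
  simp [mean]

variable [NeZero m]

lemma IsWeakDeriv.sum {u v : Fin m → EdgeL2 𝕜 m} (h : ∀ i, IsWeakDeriv (u i) (v i)) :
    IsWeakDeriv (∑ i, u i) (∑ i, v i) := by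
  classical
  induction (Finset.univ : Finset (Fin m)) using Finset.induction_on with
  | empty => simpa using isWeakDeriv_zero
  | insert i S hi ih => rw [Finset.sum_insert hi, Finset.sum_insert hi]; exact (h i).add ih

lemma natCast_smul_mean (f : StarL2 𝕜 m) : (m : 𝕜) • mean 𝕜 m f = ∑ j, f j := by
  rw [mean_apply, smul_smul, mul_inv_cancel₀ (Nat.cast_ne_zero.2 (NeZero.ne m)), one_smul]

lemma sum_sub_mean (f : StarL2 𝕜 m) : ∑ i, (f i - mean 𝕜 m f) = 0 := by
  rw [Finset.sum_sub_distrib, ← natCast_smul_mean, Finset.sum_const, Finset.card_univ,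
    Fintype.card_fin, Nat.cast_smul_eq_nsmul, sub_self]

lemma edgeOp_apply {t : ℝ} (ht : 0 < t) (i j : Fin m) (f : EdgeL2 𝕜 m) :
    edgeOp 𝕜 ht i j f
      = (if i = j then (symKernel_reflKernel ht true).op 𝕜 f
          - (symKernel_reflKernel ht false).op 𝕜 f else 0)
        + (2 / m : 𝕜) • (symKernel_reflKernel ht false).op 𝕜 f := by
  have h0 : edgeOp 𝕜 ht i j f =ᵐ[edgeMeasure m] edgeIntegral m t i j f :=
    (memLp_edgeIntegral ht i j f).coeFn_toLp
  have hJ := fun s => (symKernel_reflKernel (m := m) ht s).coeFn_op f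
  have hi := fun s x => integrable_ouKernel_smul (m := m) ht s x f
  have e : ∀ x, edgeIntegral m t i j f x
      = (if i = j then (∫ y, reflKernel m true t x y • f y ∂edgeMeasure m)
          - (∫ y, reflKernel m false t x y • f y ∂edgeMeasure m) else 0)
        + (2 / m : 𝕜) * ∫ y, reflKernel m false t x y • f y ∂edgeMeasure m := fun x => by
    have i1 := hi true x
    have i2 := hi false x
    simp only [sgn, if_true, one_mul, Bool.false_eq_true, if_false, neg_mul] at i1 i2
    simp only [edgeIntegral, integral_reflKernel_smul, starKernel, sgn, if_true, one_mul,
      Bool.false_eq_true, if_false, neg_mul]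
    have i3 : IntegrableOn (fun y => (2 / m : ℝ) • (ouKernel t x (-y) • f y)) (Ioi 0) :=
      i2.smul (2 / m : ℝ)
    have i4 : IntegrableOn (fun y => ouKernel t x y • f y - ouKernel t x (-y) • f y) (Ioi 0) :=
      i1.sub i2
    have c : ∀ v : 𝕜, (2 / m : 𝕜) * v = (2 / m : ℝ) • v := fun v => by
      rw [RCLike.real_smul_eq_coe_mul]; push_cast; rfl
    rw [c, ← integral_smul]
    split_ifs with hij
    · rw [← integral_sub i1 i2, ← integral_add i4 i3]
      simp only [add_smul, sub_smul, smul_smul]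
    · simp only [zero_add, smul_smul]
  refine Lp.ext ?_
  split_ifs with hij
  · filter_upwards [h0, hJ true, hJ false,
      Lp.coeFn_add ((symKernel_reflKernel ht true).op 𝕜 f - (symKernel_reflKernel ht false).op 𝕜 f)
        ((2 / m : 𝕜) • (symKernel_reflKernel ht false).op 𝕜 f),
      Lp.coeFn_sub ((symKernel_reflKernel ht true).op 𝕜 f) ((symKernel_reflKernel ht false).op 𝕜 f),
      Lp.coeFn_smul (2 / m : 𝕜) ((symKernel_reflKernel ht false).op 𝕜 f)]
      with x h0 h1 h2 h3 h4 h5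
    rw [h0, h3, Pi.add_apply, h4, h5, Pi.sub_apply, Pi.smul_apply, h1, h2, e, if_pos hij,
      smul_eq_mul]
  · rw [zero_add]
    filter_upwards [h0, hJ false,
      Lp.coeFn_smul (2 / m : 𝕜) ((symKernel_reflKernel ht false).op 𝕜 f)] with x h0 h2 h5
    rw [h0, h5, Pi.smul_apply, h2, e, if_neg hij, zero_add, smul_eq_mul]

/-- On edge `i` the operator is `(K₊ - K₋) f_i + 2 K₋ mean`; adding and subtracting `(K₊ - K₋) mean`
gives the splitting. -/
lemma ouSemigroup_apply (t : ℝ≥0) (f : StarL2 𝕜 m) (i : Fin m) :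
    ouSemigroup 𝕜 m t f i
      = halfOp 𝕜 m false t (f i - mean 𝕜 m f) + halfOp 𝕜 m true t (mean 𝕜 m f) := by
  unfold ouSemigroup halfOp
  split_ifs with ht
  · have h1 : (((PiLp.continuousLinearEquiv 2 𝕜 fun _ : Fin m => EdgeL2 𝕜 m).symm :
        (Fin m → EdgeL2 𝕜 m) →L[𝕜] StarL2 𝕜 m) ∘L
        ContinuousLinearMap.pi fun i =>
        ∑ j, edgeOp 𝕜 ht i j ∘L PiLp.proj 2 (fun _ : Fin m => EdgeL2 𝕜 m) j) f i
        = ∑ j, edgeOp 𝕜 ht i j (f j) := by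
      simp
    rw [h1]
    simp only [edgeOp_apply, Finset.sum_add_distrib, Finset.sum_ite_eq, Finset.mem_univ, if_true]
    rw [← Finset.smul_sum, ← map_sum, ← natCast_smul_mean, map_smul, smul_smul,
      div_mul_cancel₀ _ (Nat.cast_ne_zero.2 (NeZero.ne m))]
    simp only [add_apply, smul_apply, sgn, if_true, Bool.false_eq_true, if_false, map_sub]
    simp only [RCLike.ofReal_neg, RCLike.ofReal_one, neg_smul, one_smul, two_smul]
    abel
  · simp

/-- The deviations from the mean sum to zero, so the Dirichlet part drops out. -/
lemma mean_ouSemigroup (t : ℝ≥0) (f : StarL2 𝕜 m) :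
    mean 𝕜 m (ouSemigroup 𝕜 m t f) = halfOp 𝕜 m true t (mean 𝕜 m f) := by
  rw [mean_apply]
  simp only [ouSemigroup_apply]
  rw [Finset.sum_add_distrib, ← map_sum, sum_sub_mean, map_zero, zero_add, Finset.sum_const,
    Finset.card_univ, Fintype.card_fin, ← Nat.cast_smul_eq_nsmul 𝕜, smul_smul,
    inv_mul_cancel₀ (Nat.cast_ne_zero.2 (NeZero.ne m)), one_smul]

lemma IsGeneratorValue.mean {f g : StarL2 𝕜 m} (h : IsGeneratorValue (ouSemigroup 𝕜 m) f g) :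
    IsGeneratorValue (halfOp 𝕜 m true) (StarOU.mean 𝕜 m f) (StarOU.mean 𝕜 m g) := by
  refine (((StarOU.mean 𝕜 m).continuous.tendsto g).comp h).congr fun t => ?_
  simp only [Function.comp, map_smul, map_sub, mean_ouSemigroup]

lemma IsGeneratorValue.sub_mean {f g : StarL2 𝕜 m} (h : IsGeneratorValue (ouSemigroup 𝕜 m) f g)
    (i : Fin m) : IsGeneratorValue (halfOp 𝕜 m false) (f i - StarOU.mean 𝕜 m f)
      (g i - StarOU.mean 𝕜 m g) := by
  have hi : Tendsto (fun t : ℝ≥0 => ((((t : ℝ) : 𝕜))⁻¹ • (ouSemigroup 𝕜 m t f - f)) i) (𝓝[>] 0)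
      (𝓝 (g i)) :=
    ((PiLp.proj 2 (fun _ : Fin m => EdgeL2 𝕜 m) (𝕜 := 𝕜) i).continuous.tendsto g).comp h
  refine (hi.sub h.mean).congr fun t => ?_
  rw [PiLp.smul_apply, PiLp.sub_apply, ouSemigroup_apply, ← smul_sub]
  congr 1
  abel

lemma isGeneratorValue_ouSemigroup {f : StarL2 𝕜 m} {g₀ : EdgeL2 𝕜 m} {g : Fin m → EdgeL2 𝕜 m}
    (h₀ : IsGeneratorValue (halfOp 𝕜 m true) (mean 𝕜 m f) g₀)
    (h : ∀ i, IsGeneratorValue (halfOp 𝕜 m false) (f i - mean 𝕜 m f) (g i)) :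
    IsGeneratorValue (ouSemigroup 𝕜 m) f (WithLp.toLp 2 fun i => g i + g₀) := by
  have hp : Tendsto (fun (t : ℝ≥0) (i : Fin m) => ((((t : ℝ) : 𝕜))⁻¹ • (ouSemigroup 𝕜 m t f - f)) i)
      (𝓝[>] 0) (𝓝 fun i => g i + g₀) := by
    refine tendsto_pi_nhds.2 fun i => (Tendsto.add (h i) h₀).congr fun t => ?_
    rw [PiLp.smul_apply, PiLp.sub_apply, ouSemigroup_apply, ← smul_add]
    congr 1
    abel
  exact ((PiLp.continuous_toLp 2 _).tendsto _).comp hp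

/-! ### The two inclusions on the star. -/

lemma exists_of_isGeneratorValue {f g : StarL2 𝕜 m} (h : IsGeneratorValue (ouSemigroup 𝕜 m) f g) :
    ∃ f' f'' : StarL2 𝕜 m,
      (∀ i, IsWeakDeriv (f i) (f' i) ∧ IsWeakDeriv (f' i) (f'' i)) ∧
      (∃ c : 𝕜, ∀ i, HasBoundaryValue (f i) c) ∧
      (∃ d : Fin m → 𝕜, (∀ i, HasBoundaryValue (f' i) (d i)) ∧ ∑ i, d i = 0) ∧
      ∀ i, g i =ᵐ[edgeMeasure m] fun x : ℝ => (1 / 2 : 𝕜) * f'' i x - (x : 𝕜) * f' i x := by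
  obtain ⟨p', p'', z₀, hp', hp'', hpb, hz₀, hg₀⟩ :=
    exists_isWeakDeriv_of_isTrigAdjoint (isTrigAdjoint_of_isGeneratorValue h.mean)
  choose q' q'' z hq' hq'' hqb hz hg using fun i =>
    exists_isWeakDeriv_of_isTrigAdjoint (isTrigAdjoint_of_isGeneratorValue (h.sub_mean i))
  simp only [BoundaryCond, Bool.false_eq_true, if_false, if_true] at hpb hqb
  -- The deviations sum to zero, hence by uniqueness so do their first and second weak derivatives.
  -- Since `p'` vanishes at the vertex, this is the source of the Kirchhoff condition.
  have hs' : ∑ i, q' i = 0 := by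
    have := IsWeakDeriv.sum hq'
    rw [sum_sub_mean] at this
    exact this.unique isWeakDeriv_zero
  have hs'' : ∑ i, q'' i = 0 := by
    have := IsWeakDeriv.sum hq''
    rw [hs'] at this
    exact this.unique isWeakDeriv_zero
  refine ⟨WithLp.toLp 2 fun i => q' i + p', WithLp.toLp 2 fun i => q'' i + p'', fun i => ⟨?_, ?_⟩,
    ⟨trace (mean 𝕜 m f) p', fun i => ?_⟩,
    ⟨fun i => trace (q' i) (q'' i), fun i => ?_, ?_⟩, fun i => ?_⟩
  · simpa using (hq' i).add hp'
  · exact (hq'' i).add hp''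
  · simpa using (hqb i).add hp'.hasBoundaryValue
  · simpa using (hq'' i).hasBoundaryValue.add hpb
  · rw [trace_sum, hs', hs'']
    simp [trace]
  · have e : g i = (1 / 2 : 𝕜) • (q'' i + p'') - (z i + z₀) := by
      rw [← sub_add_cancel (g i) (mean 𝕜 m g), hg i, hg₀, smul_add]
      abel
    simp only
    rw [e]
    filter_upwards [Lp.coeFn_sub ((1 / 2 : 𝕜) • (q'' i + p'')) (z i + z₀),
      Lp.coeFn_smul (1 / 2 : 𝕜) (q'' i + p''), Lp.coeFn_add (z i) z₀, Lp.coeFn_add (q' i) p',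
      hz i, hz₀] with x h1 h2 h3 h4 h5 h6
    rw [h1, Pi.sub_apply, h2, Pi.smul_apply, h3, h4, Pi.add_apply, Pi.add_apply, h5, h6,
      smul_eq_mul, mul_add]

lemma exists_isGeneratorValue {f f' f'' : StarL2 𝕜 m}
    (hw : ∀ i, IsWeakDeriv (f i) (f' i) ∧ IsWeakDeriv (f' i) (f'' i)) {c : 𝕜}
    (hc : ∀ i, HasBoundaryValue (f i) c) {d : Fin m → 𝕜}
    (hd : ∀ i, HasBoundaryValue (f' i) (d i)) (hd0 : ∑ i, d i = 0) :
    ∃ g, IsGeneratorValue (ouSemigroup 𝕜 m) f g := by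
  have w1 : IsWeakDeriv (mean 𝕜 m f) (mean 𝕜 m f') := by
    rw [mean_apply, mean_apply]
    exact (IsWeakDeriv.sum fun i => (hw i).1).smul _
  have w2 : IsWeakDeriv (mean 𝕜 m f') (mean 𝕜 m f'') := by
    rw [mean_apply, mean_apply]
    exact (IsWeakDeriv.sum fun i => (hw i).2).smul _
  have b1 : HasBoundaryValue (mean 𝕜 m f) c := by
    have := (HasBoundaryValue.sum hc).smul (m : 𝕜)⁻¹
    rwa [← mean_apply, Finset.sum_const, Finset.card_univ, Fintype.card_fin, nsmul_eq_mul,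
      ← mul_assoc, inv_mul_cancel₀ (Nat.cast_ne_zero.2 (NeZero.ne m)), one_mul] at this
  have b2 : HasBoundaryValue (mean 𝕜 m f') 0 := by
    have := (HasBoundaryValue.sum hd).smul (m : 𝕜)⁻¹
    rwa [← mean_apply, hd0, mul_zero] at this
  -- The Kirchhoff condition is the Neumann condition for the mean. Below, continuity at the vertex
  -- gives the mean the common value `c`, hence the Dirichlet condition for each `f i - mean`.
  obtain ⟨z₀, -, h₀⟩ := isTrigAdjoint_of_isWeakDeriv (s := true) w1 w2 (by simpa [BoundaryCond])
  choose z _ hz using fun i => isTrigAdjoint_of_isWeakDeriv (s := false) ((hw i).1.sub w1)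
    ((hw i).2.sub w2) (by
      have := (hc i).add (b1.smul (-1))
      simpa [BoundaryCond, ← sub_eq_add_neg] using this)
  exact ⟨_, isGeneratorValue_ouSemigroup (isGeneratorValue_of_isTrigAdjoint h₀)
    fun i => isGeneratorValue_of_isTrigAdjoint (hz i)⟩

end

end StarOU

end

theorem proposition4p5 {𝕜 : Type*} [RCLike 𝕜] (m : ℕ) (hm : 1 ≤ m) :
    (∀ f : StarOU.StarL2 𝕜 m,
      f ∈ (StarOU.generator (StarOU.ouSemigroup 𝕜 m)).domain ↔
        ∃ f' f'' : StarOU.StarL2 𝕜 m,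
          (∀ i, StarOU.IsWeakDeriv (f i) (f' i) ∧ StarOU.IsWeakDeriv (f' i) (f'' i)) ∧
          (∃ c : 𝕜, ∀ i, StarOU.HasBoundaryValue (f i) c) ∧
          (∃ d : Fin m → 𝕜, (∀ i, StarOU.HasBoundaryValue (f' i) (d i)) ∧ ∑ i, d i = 0)) ∧
    (∀ (f : (StarOU.generator (StarOU.ouSemigroup 𝕜 m)).domain) (f' f'' : StarOU.StarL2 𝕜 m),
      (∀ i, StarOU.IsWeakDeriv ((f : StarOU.StarL2 𝕜 m) i) (f' i)) →
      (∀ i, StarOU.IsWeakDeriv (f' i) (f'' i)) →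
      ∀ i, (StarOU.generator (StarOU.ouSemigroup 𝕜 m) f) i =ᵐ[StarOU.edgeMeasure m]
        fun x : ℝ => (1 / 2 : 𝕜) * f'' i x - (x : 𝕜) * f' i x) := by
  have : NeZero m := ⟨by omega⟩
  refine ⟨fun f => ⟨?_, ?_⟩, fun f f' f'' h1 h2 i => ?_⟩
  · rintro ⟨g, hg⟩
    obtain ⟨f', f'', hw, hc, hd, -⟩ := StarOU.exists_of_isGeneratorValue hg
    exact ⟨f', f'', hw, hc, hd⟩
  · rintro ⟨f', f'', hw, ⟨c, hc⟩, d, hd, hd0⟩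
    exact StarOU.exists_isGeneratorValue hw hc hd hd0
  · have hg : StarOU.IsGeneratorValue (StarOU.ouSemigroup 𝕜 m) f
        (StarOU.generator (StarOU.ouSemigroup 𝕜 m) f) := f.2.choose_spec
    obtain ⟨p', p'', hw, -, -, hae⟩ := StarOU.exists_of_isGeneratorValue hg
    -- The formula was obtained for one choice of weak derivatives; uniqueness transfers it to the
    -- given ones.
    have e1 : p' i = f' i := (hw i).1.unique (h1 i)
    have e2 : p'' i = f'' i := StarOU.IsWeakDeriv.unique (e1 ▸ (hw i).2) (h2 i)
    rw [← e1, ← e2]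
    exact hae i
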